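/- Notation and definitions. For an entire function $f$ put $f^{*}(z)=\overline{f(\bar z)}$. The class $\mathcal{HB}$ consists of the entire functions $E$ with $|E(\bar z)|<|E(z)|$ whenever $\operatorname{Im} z>0$. A function is of bounded type in $\mathbb{C}^{+}=\{\operatorname{Im} z>0\}$ if it is analytic there and is a quotient of two bounded analytic functions on $\mathbb{C}^{+}$; its mean type is $\limsup_{y\to+\infty} y^{-1}\log|f(iy)|$. For $E\in\mathcal{HB}$, the de Branges space $\mathcal{H}(E)$ is the set of entire functions $f$ such that $\|f\|_{E}^{2}=\int_{\mathbb{R}}|f(t)/E(t)|^{2}\,dt<\infty$ and $f/E$, $f^{*}/E$ are of bounded type and nonpositive mean type in $\mathbb{C}^{+}$. Its reproducing kernel is $$K_{E}(w,z)=\frac{\overline{E(w)}E(z)-E(\bar w)E^{*}(z)}{2\pi i(\bar w-z)},$$ extended by its limit at $z=\bar w$. We write $\mathcal{H}(E_{0})=\mathcal{H}(E)$ if the two spaces coincide as sets and their norms are equivalent. A phase function of $E$ is a continuous, strictly increasing $\varphi_{E}:\mathbb{R}\to\mathbb{R}$ with $E(x)=|E(x)|e^{-i\varphi_{E}(x)}$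 for all $x\in\mathbb{R}$. A set $\Lambda$ is a normalized sampling set for $\mathcal{H}(E)$ if $\Lambda\subset\mathbb{R}$ and there are constants $A,B>0$ such that for all $f\in\mathcal{H}(E)$ $$A\|f\|_{E}^{2}\le\sum_{\lambda\in\Lambda}\frac{|f(\lambda)|^{2}}{K_{E}(\lambda,\lambda)}\le B\|f\|_{E}^{2}.$$ Corollary. Let $E_{0},E,F\in\mathcal{HB}$ have no real zeros. Suppose that $\mathcal{H}(E_{0})=\mathcal{H}(E)$, and that $\varphi_{F}'\lesssim\varphi_{E}'$, that is, there is a constant $C>0$ with $\varphi_{F}'(x)\le C\varphi_{E}'(x)$ for all $x\in\mathbb{R}$, where $\varphi_{E},\varphi_{F}$ are phase functions of $E$ and $F$. Then the zero set of $EF+E^{*}F^{*}$ in $\mathbb{C}$ is a normalized sampling set for $\mathcal{H}(E_{0})$ (in particular, all its zeros are real). -/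

import Mathlib

namespace DeBranges

open Filter Topology MeasureTheory
open scoped ComplexConjugate

noncomputable section

/-- The open upper half-plane, as a subset of the complex plane. -/
def upperHalf : Set ℂ := {z | 0 < z.im}

/-- The function `f*`, `f*(z) = conj (f (conj z))`. -/
def sharp (f : ℂ → ℂ) : ℂ → ℂ := fun z => conj (f (conj z))

/-- The Hermite-Biehler class: entire functions with `|E (conj z)| < |E z|` for `Im z > 0`. -/
def HermiteBiehler (E : ℂ → ℂ) : Prop :=
  Differentiable ℂ E ∧ ∀ z : ℂ, 0 < z.im → ‖E (conj z)‖ < ‖E z‖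

/-- `E` has no zeros on the real axis. -/
def NoRealZeros (E : ℂ → ℂ) : Prop := ∀ x : ℝ, E x ≠ 0

/-- `g` is bounded and analytic in the open upper half-plane. -/
def BoundedAnalytic (g : ℂ → ℂ) : Prop :=
  DifferentiableOn ℂ g upperHalf ∧ ∃ M : ℝ, ∀ z ∈ upperHalf, ‖g z‖ ≤ M

/-- `f` is analytic and of bounded type in the upper half-plane: it is a quotient `p / q` of two
bounded analytic functions, where `q` does not vanish identically. -/
def BoundedType (f : ℂ → ℂ) : Prop :=
  DifferentiableOn ℂ f upperHalf ∧
    ∃ p q : ℂ → ℂ, BoundedAnalytic p ∧ BoundedAnalytic q ∧ (∃ z ∈ upperHalf, q z ≠ 0) ∧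
      ∀ z ∈ upperHalf, f z * q z = p z

/-- The mean type `limsup_{y → +∞} log |f (i y)| / y` in the upper half-plane, an extended real
number (with `log 0 = -∞`). -/
def meanType (f : ℂ → ℂ) : EReal :=
  limsup (fun y : ℝ => ENNReal.log ‖f (y * Complex.I)‖ₑ / (y : EReal)) atTop

/-- The underlying set of the de Branges space `H(E)`. -/
def space (E : ℂ → ℂ) : Set (ℂ → ℂ) :=
  {f | Differentiable ℂ f ∧
    Integrable (fun t : ℝ => ‖f t / E t‖ ^ 2) ∧
    BoundedType (fun z => f z / E z) ∧ meanType (fun z => f z / E z) ≤ 0 ∧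
    BoundedType (fun z => sharp f z / E z) ∧ meanType (fun z => sharp f z / E z) ≤ 0}

/-- The squared norm of `H(E)`. -/
def normSq (E f : ℂ → ℂ) : ℝ := ∫ t : ℝ, ‖f t / E t‖ ^ 2

/-- `H(E₁) = H(E₂)`: the spaces coincide as sets and their norms are equivalent. -/
def SameSpace (E₁ E₂ : ℂ → ℂ) : Prop :=
  space E₁ = space E₂ ∧
    ∃ c C : ℝ, 0 < c ∧ 0 < C ∧
      ∀ f ∈ space E₁, c * normSq E₁ f ≤ normSq E₂ f ∧ normSq E₂ f ≤ C * normSq E₁ f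

/-- The numerator of the reproducing kernel. It vanishes at `z = conj w`. -/
def kernelNum (E : ℂ → ℂ) (w z : ℂ) : ℂ := conj (E w) * E z - E (conj w) * sharp E z

/-- The reproducing kernel `K_E(w, z)` of `H(E)`, extended to the removable singularity
`z = conj w` by its limit. -/
def kernel (E : ℂ → ℂ) (w z : ℂ) : ℂ :=
  if z = conj w then -deriv (kernelNum E w) (conj w) / (2 * Real.pi * Complex.I)
  else kernelNum E w z / (2 * Real.pi * Complex.I * (conj w - z))

/-- `φ` is a phase function of `E`. -/
def IsPhase (E : ℂ → ℂ) (φ : ℝ → ℝ) : Prop :=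
  Continuous φ ∧ StrictMono φ ∧ ∀ x : ℝ, E x = ‖E x‖ * Complex.exp (-Complex.I * φ x)

/-- The family `(lam n)` of real numbers is a normalized sampling sequence for `H(E)`. The number
`K_E(x, x)` is real for real `x`. -/
def NormalizedSampling (E : ℂ → ℂ) {ι : Type*} (lam : ι → ℝ) : Prop :=
  ∃ A B : ℝ, 0 < A ∧ 0 < B ∧ ∀ f ∈ space E,
    Summable (fun n => ‖f (lam n)‖ ^ 2 / (kernel E (lam n) (lam n)).re) ∧
    A * normSq E f ≤ ∑' n, ‖f (lam n)‖ ^ 2 / (kernel E (lam n) (lam n)).re ∧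
    ∑' n, ‖f (lam n)‖ ^ 2 / (kernel E (lam n) (lam n)).re ≤ B * normSq E f

/-- The set `Λ` of complex numbers consists of real numbers, and these, each taken once, form a
normalized sampling sequence for `H(E)`. -/
def NormalizedSamplingSet (E : ℂ → ℂ) (Λ : Set ℂ) : Prop :=
  (∀ z ∈ Λ, z.im = 0) ∧ NormalizedSampling E (fun z : Λ => (z : ℂ).re)

/-- The zero set, in the complex plane, of an entire function. -/
def zeroSet (G : ℂ → ℂ) : Set ℂ := {z | G z = 0}

end

end DeBranges

/-!
Put `B = E F`, again a Hermite–Biehler function. For real `x`,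
`K_B(x, x) = |F(x)|² K_E(x, x) + |E(x)|² K_F(x, x) = |F(x)|² K_E(x, x) (1 + φ_F'(x) / φ_E'(x))`,
so `φ_F' ≲ φ_E'` makes `|f|² / K_E` and `|f F|² / K_B` comparable on the real line.

The zeros of `B + B*` are real, and the reproducing kernels of `H(B)` at these zeros are orthogonal.
An element of `H(B)` that vanishes at all of them is a constant multiple of `B + B*`, so their
closed span has codimension at most one in `H(B)`. The map `f ↦ f F` embeds `H(E)` isometrically as
a closed subspace of `H(B)`. That subspace does not contain `B + B*`: if `f F = B + B*`, then `F`
has no zeros, `F*/F` is an exponential, and `f / E` tends to a nonzero limit along the imaginary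
axis, which is impossible for an `H²` function. Bessel's inequality therefore gives the upper
sampling bound, and a closed subspace that meets a line only at zero makes a positive angle with
it, which gives the lower one.

Passing from `H(E)` to `H(E₀)` changes norms by bounded factors, and hence also `K(x, x)`, the
squared norm of the evaluation functional at `x`.
-/

namespace DeBranges

open Filter Topology MeasureTheory Metric Set
open scoped ComplexConjugate InnerProductSpace

section DiscGrowth

theorem norm_le_of_re_nonneg {h : ℂ → ℂ} {R : ℝ} (hh : DifferentiableOn ℂ h (ball 0 R))
    (h0 : ∀ z ∈ ball (0 : ℂ) R, 0 ≤ (h z).re) {z : ℂ} (hz : z ∈ ball 0 R) :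
    ‖h z‖ ≤ (R + ‖z‖) / (R - ‖z‖) * ‖h 0‖ := by
  have hR : 0 < R := pos_of_mem_ball hz
  have hlim : Tendsto (fun M : ℝ => 2 * M * ‖z‖ / (R - ‖z‖) + ‖h 0‖ * (R + ‖z‖) / (R - ‖z‖))
      (𝓝[>] 0) (𝓝 ((R + ‖z‖) / (R - ‖z‖) * ‖h 0‖)) := by
    refine Tendsto.mono_left (Continuous.tendsto' (by fun_prop) _ _ ?_) nhdsWithin_le_nhds
    ring
  refine ge_of_tendsto hlim (eventually_nhdsWithin_of_forall fun M hM => ?_)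
  simpa using Complex.borelCaratheodory (f := fun ζ => -h ζ) hM hh.neg (fun ζ hζ => by
    simpa using (neg_nonpos.2 (h0 ζ hζ)).trans (le_of_lt hM)) hR hz

theorem re_le_of_re_nonneg {h : ℂ → ℂ} {R : ℝ} (hh : DifferentiableOn ℂ h (ball 0 R))
    (h0 : ∀ z ∈ ball (0 : ℂ) R, 0 ≤ (h z).re) {z : ℂ} (hz : z ∈ ball 0 R) :
    (h z).re ≤ (R + ‖z‖) / (R - ‖z‖) * (h 0).re := by
  have hR : 0 < R := pos_of_mem_ball hz
  have hreal : h 0 - ((h 0).im : ℂ) * Complex.I = (h 0).re :=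
    sub_eq_iff_eq_add.2 (Complex.re_add_im _).symm
  calc (h z).re = (h z - ((h 0).im : ℂ) * Complex.I).re := by simp
    _ ≤ ‖h z - ((h 0).im : ℂ) * Complex.I‖ := Complex.re_le_norm _
    _ ≤ (R + ‖z‖) / (R - ‖z‖) * ‖h 0 - ((h 0).im : ℂ) * Complex.I‖ :=
        norm_le_of_re_nonneg (h := fun ζ => h ζ - ((h 0).im : ℂ) * Complex.I)
          (hh.sub_const _) (fun ζ hζ => by simpa using h0 ζ hζ) hz
    _ = (R + ‖z‖) / (R - ‖z‖) * (h 0).re := by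
        rw [hreal, Complex.norm_of_nonneg (h0 0 (mem_ball_self hR))]

theorem fourier_natCast_apply {T : ℝ} (k : ℕ) (x : AddCircle T) :
    (fourier k x : ℂ) = fourier 1 x ^ k := by
  induction k with
  | zero => simp
  | succ k ih => rw [Nat.cast_succ, fourier_add, ih, pow_succ]

theorem exists_re_eq_re_fourier {T : ℝ} (n : ℤ) (c : ℂ) {R : ℝ} (hR : R ≠ 0) :
    ∃ P : ℂ → ℂ, Differentiable ℂ P ∧ ∀ x : AddCircle T,
      (P (R * fourier 1 x)).re = (c * fourier n x).re := by
  have hR' : (R : ℂ) ≠ 0 := by exact_mod_cast hR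
  rcases n.eq_nat_or_neg with ⟨k, rfl | rfl⟩
  · refine ⟨fun z => c * (z / R) ^ k, by fun_prop, fun x => ?_⟩
    beta_reduce
    rw [mul_div_cancel_left₀ _ hR', fourier_natCast_apply]
  · refine ⟨fun z => conj c * (z / R) ^ k, by fun_prop, fun x => ?_⟩
    beta_reduce
    rw [mul_div_cancel_left₀ _ hR', fourier_neg, fourier_natCast_apply, ← Complex.conj_re,
      map_mul, Complex.conj_conj]

theorem exists_re_eq_re_of_mem_span_fourier {T R : ℝ} (hR : R ≠ 0) {g : C(AddCircle T, ℂ)}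
    (hg : g ∈ Submodule.span ℂ (range fourier)) :
    ∃ P : ℂ → ℂ, Differentiable ℂ P ∧ ∀ x : AddCircle T,
      (P (R * fourier 1 x)).re = (g x).re := by
  suffices ∀ c : ℂ, ∃ P : ℂ → ℂ, Differentiable ℂ P ∧ ∀ x : AddCircle T,
      (P (R * fourier 1 x)).re = (c * g x).re by simpa using this 1
  induction hg using Submodule.span_induction with
  | mem g hg =>
    obtain ⟨n, rfl⟩ := hg
    exact fun c => exists_re_eq_re_fourier n c hR
  | zero => exact fun c => ⟨0, differentiable_const 0, by simp⟩
  | add g₁ g₂ _ _ ih₁ ih₂ =>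
    intro c
    obtain ⟨P₁, hP₁, h₁⟩ := ih₁ c
    obtain ⟨P₂, hP₂, h₂⟩ := ih₂ c
    exact ⟨P₁ + P₂, hP₁.add hP₂, fun x => by
      simp only [Pi.add_apply, Complex.add_re, h₁, h₂, ContinuousMap.add_apply, mul_add]⟩
  | smul a g _ ih =>
    intro c
    obtain ⟨P, hP, h⟩ := ih (c * a)
    exact ⟨P, hP, fun x => by simp only [h, ContinuousMap.smul_apply, smul_eq_mul, mul_assoc]⟩

theorem exists_fourier_one_eq {z : ℂ} {R : ℝ} (hz : z ∈ sphere (0 : ℂ) R) :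
    ∃ x : AddCircle (2 * Real.pi), (R : ℂ) * fourier 1 x = z := by
  refine ⟨(z.arg : ℝ), ?_⟩
  have hpi : (Real.pi : ℂ) ≠ 0 := by exact_mod_cast Real.pi_ne_zero
  rw [fourier_coe_apply, ← mem_sphere_zero_iff_norm.1 hz]
  convert Complex.norm_mul_exp_arg_mul_I z using 3
  push_cast
  field_simp

theorem exists_entire_re_near_on_sphere {u : ℂ → ℝ} {R δ : ℝ} (hR : 0 < R)
    (hu : ContinuousOn u (sphere 0 R)) (hδ : 0 < δ) :
    ∃ P : ℂ → ℂ, Differentiable ℂ P ∧ ∀ z ∈ sphere (0 : ℂ) R, |(P z).re - u z| < δ := by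
  have : Fact (0 < 2 * Real.pi) := ⟨Real.two_pi_pos⟩
  let U : C(AddCircle (2 * Real.pi), ℂ) := ⟨fun x => (u (R * fourier 1 x) : ℂ),
    Complex.continuous_ofReal.comp (hu.comp_continuous (by fun_prop) fun x => by
      simp [Circle.norm_coe, abs_of_pos hR])⟩
  have hU : U ∈ closure (Submodule.span ℂ (range (fourier (T := 2 * Real.pi))) : Set _) := by
    rw [← Submodule.topologicalClosure_coe, span_fourier_closure_eq_top]
    trivial
  obtain ⟨g, hg, hgU⟩ := Metric.mem_closure_iff.1 hU δ hδ
  obtain ⟨P, hP, hPg⟩ := exists_re_eq_re_of_mem_span_fourier hR.ne' hg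
  refine ⟨P, hP, fun z hz => ?_⟩
  obtain ⟨x, rfl⟩ := exists_fourier_one_eq hz
  calc |(P (R * fourier 1 x)).re - u (R * fourier 1 x)| = |((g - U) x).re| := by
        rw [hPg, ContinuousMap.sub_apply, Complex.sub_re]; rfl
    _ ≤ ‖(g - U) x‖ := Complex.abs_re_le_norm _
    _ ≤ ‖g - U‖ := (g - U).norm_coe_le_norm x
    _ < δ := by rwa [← dist_eq_norm, dist_comm]

theorem norm_le_on_closedBall_of_norm_le_on_sphere {f : ℂ → ℂ} {R K : ℝ} (hR : 0 < R)
    (hf : DifferentiableOn ℂ f (closedBall 0 R)) (hK : ∀ z ∈ sphere (0 : ℂ) R, ‖f z‖ ≤ K)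
    {z : ℂ} (hz : z ∈ closedBall 0 R) : ‖f z‖ ≤ K :=
  Complex.norm_le_of_forall_mem_frontier_norm_le isBounded_ball
    (DifferentiableOn.diffContOnCl (by rwa [closure_ball _ hR.ne']))
    (by rwa [frontier_ball _ hR.ne']) (by rwa [closure_ball _ hR.ne'])

-- `exp P` with `Re P ≈ log max(|q|, ε)` on the circle replaces the zero-free part of `q`.
theorem exists_entire_re_near_log_norm {q : ℂ → ℂ} {R ε : ℝ} (hR : 0 < R) (hε : 0 < ε)
    (hε1 : ε ≤ 1) (hq : ContinuousOn q (sphere 0 R)) (hq1 : ∀ z ∈ sphere (0 : ℂ) R, ‖q z‖ ≤ 1) :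
    ∃ P : ℂ → ℂ, Differentiable ℂ P ∧ ∀ z ∈ sphere (0 : ℂ) R,
      ‖Complex.exp (P z)‖ ≤ Real.exp 1 ∧ ‖q z * Complex.exp (-P z)‖ ≤ Real.exp 1 ∧
      ‖Complex.exp (P z)‖ ≤ Real.exp 1 * max ‖q z‖ ε := by
  have hpos (z : ℂ) : 0 < max ‖q z‖ ε := lt_max_of_lt_right hε
  obtain ⟨P, hP, hPu⟩ := exists_entire_re_near_on_sphere (u := fun z => Real.log (max ‖q z‖ ε)) hR
    ((ContinuousOn.sup hq.norm continuousOn_const).log fun z _ => (hpos z).ne') one_pos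
  have hexp_log (z : ℂ) : Real.exp (Real.log (max ‖q z‖ ε)) = max ‖q z‖ ε := Real.exp_log (hpos z)
  have hupper : ∀ z ∈ sphere (0 : ℂ) R, ‖Complex.exp (P z)‖ ≤ Real.exp 1 * max ‖q z‖ ε := by
    intro z hz
    rw [Complex.norm_exp, ← hexp_log, ← Real.exp_add, Real.exp_le_exp]
    linarith [(abs_lt.1 (hPu z hz)).2]
  refine ⟨P, hP, fun z hz => ⟨(hupper z hz).trans ?_, ?_, hupper z hz⟩⟩
  · exact mul_le_of_le_one_right (Real.exp_pos 1).le (max_le (hq1 z hz) hε1)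
  · calc ‖q z * Complex.exp (-P z)‖ ≤ max ‖q z‖ ε * Real.exp (-(P z).re) := by
          rw [norm_mul, Complex.norm_exp, Complex.neg_re]
          gcongr
          exact le_max_left _ _
      _ ≤ Real.exp 1 := by
          rw [← hexp_log, ← Real.exp_add, Real.exp_le_exp]
          linarith [(abs_lt.1 (hPu z hz)).1]

theorem exists_entire_re_comparison {G q : ℂ → ℂ} {R : ℝ} (hR : 0 < R)
    (hG : DifferentiableOn ℂ G (closedBall 0 R)) (hq : DifferentiableOn ℂ q (closedBall 0 R))
    (hGq : ∀ z ∈ sphere (0 : ℂ) R, ‖G z * q z‖ ≤ 1) (hq1 : ∀ z ∈ sphere (0 : ℂ) R, ‖q z‖ ≤ 1) :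
    ∃ P : ℂ → ℂ, Differentiable ℂ P ∧ ∀ z ∈ closedBall (0 : ℂ) R,
      (P z).re ≤ 1 ∧ ‖q z‖ ≤ Real.exp (1 + (P z).re) ∧ ‖G z‖ ≤ Real.exp (1 - (P z).re) := by
  obtain ⟨M, hM⟩ := (isCompact_sphere (0 : ℂ) R).exists_bound_of_continuousOn
    (hG.continuousOn.mono sphere_subset_closedBall)
  have hGM : ∀ z ∈ sphere (0 : ℂ) R, ‖G z‖ * (max M 1)⁻¹ ≤ 1 := fun z hz =>
    mul_inv_le_one_of_le₀ ((hM z hz).trans (le_max_left _ _)) (by positivity)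
  obtain ⟨P, hP, hPq⟩ := exists_entire_re_near_log_norm (ε := (max M 1)⁻¹) hR (by positivity)
    (inv_le_one_of_one_le₀ (le_max_right _ _))
    (hq.continuousOn.mono sphere_subset_closedBall) hq1
  refine ⟨P, hP, fun z hz => ⟨?_, ?_, ?_⟩⟩
  · rw [← Real.exp_le_exp, ← Complex.norm_exp]
    exact norm_le_on_closedBall_of_norm_le_on_sphere hR hP.cexp.differentiableOn
      (fun z hz => (hPq z hz).1) hz
  · have h := norm_le_on_closedBall_of_norm_le_on_sphere hR
      (hq.mul hP.neg.cexp.differentiableOn) (fun z hz => (hPq z hz).2.1) hz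
    rw [Real.exp_add]
    simpa [Complex.norm_exp, Real.exp_neg, mul_inv_le_iff₀, Real.exp_pos] using h
  · rw [Real.exp_sub, le_div_iff₀ (Real.exp_pos _), ← Complex.norm_exp, ← norm_mul]
    refine norm_le_on_closedBall_of_norm_le_on_sphere hR (hG.mul hP.cexp.differentiableOn)
      (fun z hz => ?_) hz
    calc ‖G z * Complex.exp (P z)‖ ≤ ‖G z‖ * (Real.exp 1 * max ‖q z‖ (max M 1)⁻¹) := by
          rw [norm_mul]
          exact mul_le_mul_of_nonneg_left (hPq z hz).2.2 (norm_nonneg _)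
      _ = Real.exp 1 * max ‖G z * q z‖ (‖G z‖ * (max M 1)⁻¹) := by
          rw [norm_mul, ← mul_max_of_nonneg _ _ (norm_nonneg _)]
          ring
      _ ≤ Real.exp 1 := mul_le_of_le_one_right (Real.exp_pos 1).le (max_le (hGq z hz) (hGM z hz))

theorem norm_le_exp_of_norm_mul_le_one {G q : ℂ → ℂ} {R : ℝ}
    (hG : DifferentiableOn ℂ G (closedBall 0 R)) (hq : DifferentiableOn ℂ q (closedBall 0 R))
    (hGq : ∀ z ∈ sphere (0 : ℂ) R, ‖G z * q z‖ ≤ 1) (hq1 : ∀ z ∈ sphere (0 : ℂ) R, ‖q z‖ ≤ 1)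
    (hq0 : q 0 ≠ 0) {w : ℂ} (hw : w ∈ ball (0 : ℂ) R) :
    ‖G w‖ ≤ Real.exp ((R + ‖w‖) / (R - ‖w‖) * (2 - Real.log ‖q 0‖)) := by
  have hR : 0 < R := pos_of_mem_ball hw
  have hRw : 0 < R - ‖w‖ := sub_pos.2 (mem_ball_zero_iff.1 hw)
  obtain ⟨P, hP, hPq⟩ := exists_entire_re_comparison hR hG hq hGq hq1
  have hq_log : Real.log ‖q 0‖ ≤ 1 + (P 0).re :=
    (Real.log_le_iff_le_exp (norm_pos_iff.2 hq0)).2 (hPq 0 (mem_closedBall_self hR.le)).2.1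
  have hre : 1 - (P w).re ≤ (R + ‖w‖) / (R - ‖w‖) * (1 - (P 0).re) := by
    simpa using re_le_of_re_nonneg (h := fun z => 1 - P z) (hP.const_sub 1).differentiableOn
      (fun z hz => by simpa using (hPq z (ball_subset_closedBall hz)).1) hw
  calc ‖G w‖ ≤ Real.exp (1 - (P w).re) := (hPq w (ball_subset_closedBall hw)).2.2
    _ ≤ _ := Real.exp_le_exp.2
      (hre.trans (mul_le_mul_of_nonneg_left (by linarith) (by positivity)))

end DiscGrowth

section Cayley

/-- The conformal map of the unit disc onto the upper half-plane that sends `0` to `a`. -/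
noncomputable def cayley (a ζ : ℂ) : ℂ := (a - conj a * ζ) / (1 - ζ)

/-- The inverse of `cayley a`, mapping the upper half-plane onto the unit disc. -/
noncomputable def cayleyInv (a z : ℂ) : ℂ := (z - a) / (z - conj a)

theorem cayley_zero (a : ℂ) : cayley a 0 = a := by simp [cayley]

theorem one_sub_ne_zero_of_mem_ball {ζ : ℂ} (hζ : ζ ∈ ball (0 : ℂ) 1) : 1 - ζ ≠ 0 := by
  rintro h
  simp [← sub_eq_zero.1 h] at hζ

theorem cayley_im (a : ℂ) {ζ : ℂ} (hζ : 1 - ζ ≠ 0) :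
    (cayley a ζ).im = a.im * (1 - ‖ζ‖ ^ 2) / Complex.normSq (1 - ζ) := by
  have hnormSq : Complex.normSq (1 - ζ) ≠ 0 := by simpa using hζ
  rw [cayley, Complex.div_im, ← Complex.normSq_eq_norm_sq]
  field_simp
  simp only [Complex.sub_im, Complex.mul_im, Complex.conj_re, Complex.conj_im, Complex.sub_re,
    Complex.one_re, Complex.one_im, Complex.mul_re, Complex.normSq_apply]
  ring

theorem cayley_mem_upperHalf {a ζ : ℂ} (ha : a ∈ upperHalf) (hζ : ζ ∈ ball (0 : ℂ) 1) :
    cayley a ζ ∈ upperHalf := by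
  have hne := one_sub_ne_zero_of_mem_ball hζ
  have hpos : 0 < 1 - ‖ζ‖ ^ 2 := by nlinarith [norm_nonneg ζ, mem_ball_zero_iff.1 hζ]
  change 0 < (cayley a ζ).im
  rw [cayley_im a hne]
  exact div_pos (mul_pos ha hpos) (Complex.normSq_pos.2 hne)

theorem differentiableOn_comp_cayley {g : ℂ → ℂ} (hg : DifferentiableOn ℂ g upperHalf) {a : ℂ}
    (ha : a ∈ upperHalf) : DifferentiableOn ℂ (fun ζ => g (cayley a ζ)) (ball 0 1) := by
  refine hg.fun_comp (fun ζ hζ => ?_) fun ζ hζ => cayley_mem_upperHalf ha hζ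
  have := one_sub_ne_zero_of_mem_ball hζ
  unfold cayley
  fun_prop (disch := assumption)

theorem sub_conj_ne_zero {a z : ℂ} (ha : a ∈ upperHalf) (hz : z ∈ upperHalf) : z - conj a ≠ 0 := by
  intro h
  have him : z.im + a.im = 0 := by simpa using congrArg Complex.im h
  exact (add_pos hz ha).ne' him

theorem cayley_cayleyInv {a z : ℂ} (ha : a ∈ upperHalf) (hz : z ∈ upperHalf) :
    cayley a (cayleyInv a z) = z := by
  have hza := sub_conj_ne_zero ha hz
  have haa := sub_conj_ne_zero ha ha
  have hsub : 1 - cayleyInv a z = (a - conj a) / (z - conj a) := by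
    rw [cayleyInv]
    field_simp
    ring
  rw [cayley, hsub, cayleyInv]
  field_simp
  ring

theorem one_sub_sq_norm_cayleyInv {a z : ℂ} (ha : a ∈ upperHalf) (hz : z ∈ upperHalf) :
    1 - ‖cayleyInv a z‖ ^ 2 = 4 * a.im * z.im / ‖z - conj a‖ ^ 2 := by
  have hnormSq : Complex.normSq (z - conj a) ≠ 0 := by simpa using sub_conj_ne_zero ha hz
  rw [cayleyInv, norm_div, div_pow, ← Complex.normSq_eq_norm_sq, ← Complex.normSq_eq_norm_sq]
  field_simp
  simp only [Complex.normSq_apply, Complex.sub_re, Complex.sub_im, Complex.conj_re,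
    Complex.conj_im]
  ring

theorem cayleyInv_mem_ball {a z : ℂ} (ha : a ∈ upperHalf) (hz : z ∈ upperHalf) :
    cayleyInv a z ∈ ball (0 : ℂ) 1 := by
  have hnorm : 0 < ‖z - conj a‖ := norm_pos_iff.2 (sub_conj_ne_zero ha hz)
  have ha' : 0 < a.im := ha
  have hz' : 0 < z.im := hz
  have hpos : 0 < 1 - ‖cayleyInv a z‖ ^ 2 := one_sub_sq_norm_cayleyInv ha hz ▸ by positivity
  rw [mem_ball_zero_iff]
  nlinarith [norm_nonneg (cayleyInv a z)]

theorem exists_harnack_ratio_le {a : ℂ} (ha : a ∈ upperHalf) :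
    ∃ C : ℝ, 0 < C ∧ ∀ z ∈ upperHalf,
      (1 + ‖cayleyInv a z‖) / (1 - ‖cayleyInv a z‖) ≤ C * (‖z‖ ^ 2 + 1) / z.im := by
  have ha' : 0 < a.im := ha
  refine ⟨2 * (‖a‖ ^ 2 + 1) / a.im, by positivity, fun z hz => ?_⟩
  have hz' : 0 < z.im := hz
  have hlt := mem_ball_zero_iff.1 (cayleyInv_mem_ball ha hz)
  have hsq := one_sub_sq_norm_cayleyInv ha hz
  have hnorm : 0 < ‖z - conj a‖ := norm_pos_iff.2 (sub_conj_ne_zero ha hz)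
  have hnorm_le : ‖z - conj a‖ ^ 2 ≤ 2 * (‖a‖ ^ 2 + 1) * (‖z‖ ^ 2 + 1) := by
    have : ‖z - conj a‖ ≤ ‖z‖ + ‖a‖ := by simpa using norm_sub_le z (conj a)
    nlinarith [sq_nonneg (‖z‖ - ‖a‖), norm_nonneg (z - conj a),
      mul_nonneg (sq_nonneg ‖z‖) (sq_nonneg ‖a‖)]
  set r := ‖cayleyInv a z‖
  have hr : 0 ≤ r := norm_nonneg _
  calc (1 + r) / (1 - r) ≤ 4 / (1 - r ^ 2) := by
        rw [div_le_div_iff₀ (by linarith) (by nlinarith)]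
        have : 0 ≤ (1 - r) * (4 - (1 + r) ^ 2) := mul_nonneg (by linarith) (by nlinarith)
        nlinarith
    _ = ‖z - conj a‖ ^ 2 / (a.im * z.im) := by rw [hsq]; field_simp
    _ ≤ 2 * (‖a‖ ^ 2 + 1) * (‖z‖ ^ 2 + 1) / (a.im * z.im) := by gcongr
    _ = 2 * (‖a‖ ^ 2 + 1) / a.im * (‖z‖ ^ 2 + 1) / z.im := by field_simp

end Cayley

section Growth

theorem exists_norm_le_of_re_nonneg {a : ℂ} (ha : a ∈ upperHalf) :
    ∃ C : ℝ, 0 < C ∧ ∀ h : ℂ → ℂ, DifferentiableOn ℂ h upperHalf →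
      (∀ z ∈ upperHalf, 0 ≤ (h z).re) →
      ∀ z ∈ upperHalf, ‖h z‖ ≤ C * (‖z‖ ^ 2 + 1) / z.im * ‖h a‖ := by
  obtain ⟨C, hC, hratio⟩ := exists_harnack_ratio_le ha
  refine ⟨C, hC, fun h hh h0 z hz => ?_⟩
  have hw := cayleyInv_mem_ball ha hz
  have hle := norm_le_of_re_nonneg (differentiableOn_comp_cayley hh ha)
    (fun ζ hζ => h0 _ (cayley_mem_upperHalf ha hζ)) hw
  rw [cayley_cayleyInv ha hz, cayley_zero] at hle
  exact hle.trans (mul_le_mul_of_nonneg_right (hratio z hz) (norm_nonneg _))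

theorem norm_le_exp_of_norm_mul_le_one_unitDisc {G q : ℂ → ℂ}
    (hG : DifferentiableOn ℂ G (ball 0 1)) (hq : DifferentiableOn ℂ q (ball 0 1))
    (hGq : ∀ z ∈ ball (0 : ℂ) 1, ‖G z * q z‖ ≤ 1) (hq1 : ∀ z ∈ ball (0 : ℂ) 1, ‖q z‖ ≤ 1)
    (hq0 : q 0 ≠ 0) {w : ℂ} (hw : w ∈ ball (0 : ℂ) 1) :
    ‖G w‖ ≤ Real.exp ((1 + ‖w‖) / (1 - ‖w‖) * (2 - Real.log ‖q 0‖)) := by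
  have hw1 : ‖w‖ < 1 := mem_ball_zero_iff.1 hw
  have hcont : ContinuousAt (fun R : ℝ =>
      Real.exp ((R + ‖w‖) / (R - ‖w‖) * (2 - Real.log ‖q 0‖))) 1 := by
    have : (1 : ℝ) - ‖w‖ ≠ 0 := by linarith
    fun_prop (disch := assumption)
  refine ge_of_tendsto (hcont.tendsto.mono_left (nhdsWithin_le_nhds (s := Iio 1))) ?_
  filter_upwards [Ioo_mem_nhdsLT hw1] with R hR
  have hsub : closedBall (0 : ℂ) R ⊆ ball 0 1 := closedBall_subset_ball hR.2
  have hsub' := sphere_subset_closedBall.trans hsub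
  exact norm_le_exp_of_norm_mul_le_one (hG.mono hsub) (hq.mono hsub)
    (fun z hz => hGq z (hsub' hz)) (fun z hz => hq1 z (hsub' hz)) hq0 (mem_ball_zero_iff.2 hR.1)

theorem BoundedType.exists_norm_le_exp {f : ℂ → ℂ} (hf : BoundedType f) :
    ∃ C : ℝ, 0 ≤ C ∧ ∀ z ∈ upperHalf, ‖f z‖ ≤ Real.exp (C * (‖z‖ ^ 2 + 1) / z.im) := by
  obtain ⟨hfd, p, q, ⟨-, M₁, hp⟩, ⟨hqd, M₂, hq⟩, ⟨a, ha, hqa⟩, hfpq⟩ := hf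
  obtain ⟨C, hC, hratio⟩ := exists_harnack_ratio_le ha
  set M : ℝ := max 1 (max M₁ M₂)
  have hM : 0 < M := by positivity
  have hdiv {x : ℂ} (hx : ‖x‖ ≤ M) : ‖x / M‖ ≤ 1 := by
    rwa [norm_div, Complex.norm_of_nonneg hM.le, div_le_one hM]
  have hqM : ∀ z ∈ upperHalf, ‖q z / M‖ ≤ 1 := fun z hz => hdiv ((hq z hz).trans (by simp [M]))
  have hpM : ∀ z ∈ upperHalf, ‖f z * (q z / M)‖ ≤ 1 := fun z hz => by
    rw [← mul_div_assoc, hfpq z hz]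
    exact hdiv ((hp z hz).trans (by simp [M]))
  have hlog : 0 ≤ 2 - Real.log ‖q a / M‖ := by
    linarith [Real.log_nonpos (norm_nonneg _) (hqM a ha)]
  refine ⟨C * (2 - Real.log ‖q a / M‖), by positivity, fun z hz => ?_⟩
  have hle := norm_le_exp_of_norm_mul_le_one_unitDisc (differentiableOn_comp_cayley hfd ha)
    (differentiableOn_comp_cayley (hqd.div_const (M : ℂ)) ha)
    (fun ζ hζ => hpM _ (cayley_mem_upperHalf ha hζ))
    (fun ζ hζ => hqM _ (cayley_mem_upperHalf ha hζ))
    (by simpa [cayley_zero] using ⟨hqa, hM.ne'⟩) (cayleyInv_mem_ball ha hz)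
  rw [cayley_cayleyInv ha hz, cayley_zero] at hle
  refine hle.trans (Real.exp_le_exp.2 ?_)
  calc _ ≤ C * (‖z‖ ^ 2 + 1) / z.im * (2 - Real.log ‖q a / M‖) :=
        mul_le_mul_of_nonneg_right (hratio z hz) hlog
    _ = _ := by ring

theorem re_one_add_div_one_sub_nonneg {w : ℂ} (hw : ‖w‖ ≤ 1) :
    0 ≤ ((1 + w) / (1 - w)).re := by
  have hsq : Complex.normSq w ≤ 1 := by
    rw [Complex.normSq_eq_norm_sq]
    exact pow_le_one₀ (norm_nonneg w) hw
  have hre : ((1 + w) / (1 - w)).re = (1 - Complex.normSq w) / Complex.normSq (1 - w) := by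
    simp only [Complex.div_re, Complex.normSq_apply, Complex.add_re, Complex.sub_re,
      Complex.add_im, Complex.sub_im, Complex.one_re, Complex.one_im]
    ring
  exact hre ▸ div_nonneg (sub_nonneg.2 hsq) (Complex.normSq_nonneg _)

theorem norm_one_add_div_one_sub_le {w : ℂ} (hw : ‖w‖ < 1) :
    ‖(1 + w) / (1 - w)‖ ≤ 2 / (1 - ‖w‖) := by
  have := sub_pos.2 hw
  rw [norm_div]
  gcongr
  · linarith [norm_add_le 1 w, norm_one (α := ℂ)]
  · linarith [norm_sub_norm_le 1 w, norm_one (α := ℂ)]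

theorem exists_unit_mul_eq_norm (w : ℂ) : ∃ u : ℂ, ‖u‖ = 1 ∧ u * w = ‖w‖ := by
  rcases eq_or_ne w 0 with rfl | hw
  · exact ⟨1, by simp, by simp⟩
  · exact ⟨(‖w‖ : ℂ) / w, by simp [hw], div_mul_cancel₀ _ hw⟩

theorem exists_le_one_sub_norm {θ : ℂ → ℂ} (hθ : DifferentiableOn ℂ θ upperHalf)
    (h1 : ∀ z ∈ upperHalf, ‖θ z‖ < 1) :
    ∃ c : ℝ, 0 < c ∧ ∀ z ∈ upperHalf, c * z.im / (‖z‖ ^ 2 + 1) ≤ 1 - ‖θ z‖ := by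
  have hI : Complex.I ∈ upperHalf := by simp [upperHalf]
  obtain ⟨C, hC, hgrowth⟩ := exists_norm_le_of_re_nonneg hI
  have hθI : 0 < 1 - ‖θ Complex.I‖ := sub_pos.2 (h1 _ hI)
  refine ⟨(1 - ‖θ Complex.I‖) / (2 * C), by positivity, fun z hz => ?_⟩
  have hz' : 0 < z.im := hz
  have hθz : 0 < 1 - ‖θ z‖ := sub_pos.2 (h1 z hz)
  obtain ⟨u, hu, huz⟩ := exists_unit_mul_eq_norm (θ z)
  have hnorm (z : ℂ) : ‖u * θ z‖ = ‖θ z‖ := by rw [norm_mul, hu, one_mul]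
  have hlt : ∀ z ∈ upperHalf, ‖u * θ z‖ < 1 := fun z hz => (hnorm z).trans_lt (h1 z hz)
  have hne : ∀ z ∈ upperHalf, 1 - u * θ z ≠ 0 := fun z hz =>
    one_sub_ne_zero_of_mem_ball (mem_ball_zero_iff.2 (hlt z hz))
  have hrotated : 1 / (1 - ‖θ z‖) ≤ ‖(1 + u * θ z) / (1 - u * θ z)‖ := by
    rw [huz, ← Complex.ofReal_one, ← Complex.ofReal_sub, ← Complex.ofReal_add,
      ← Complex.ofReal_div, Complex.norm_of_nonneg (by positivity)]
    gcongr
    exact le_add_of_nonneg_right (norm_nonneg _)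
  have hcompare : 1 / (1 - ‖θ z‖) ≤ C * (‖z‖ ^ 2 + 1) / z.im * (2 / (1 - ‖θ Complex.I‖)) := by
    refine hrotated.trans ((hgrowth (fun z => (1 + u * θ z) / (1 - u * θ z))
      (((hθ.const_mul u).const_add 1).div ((hθ.const_mul u).const_sub 1) hne)
      (fun z hz => re_one_add_div_one_sub_nonneg (hlt z hz).le) z hz).trans ?_)
    exact mul_le_mul_of_nonneg_left (hnorm Complex.I ▸ norm_one_add_div_one_sub_le (hlt _ hI))
      (by positivity)
  calc (1 - ‖θ Complex.I‖) / (2 * C) * z.im / (‖z‖ ^ 2 + 1)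
      = (C * (‖z‖ ^ 2 + 1) / z.im * (2 / (1 - ‖θ Complex.I‖)))⁻¹ := by field_simp
    _ ≤ (1 / (1 - ‖θ z‖))⁻¹ := inv_anti₀ (by positivity) hcompare
    _ = 1 - ‖θ z‖ := by simp

end Growth

section HalfPlaneCauchy

/-- The closed upper half-plane, as a subset of the complex plane. -/
def closedUpperHalf : Set ℂ := {z | 0 ≤ z.im}

theorem ofReal_mem_closedUpperHalf (t : ℝ) : (t : ℂ) ∈ closedUpperHalf := by
  simp [closedUpperHalf]

theorem upperHalf_subset_closedUpperHalf : upperHalf ⊆ closedUpperHalf := fun _ hz =>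
  le_of_lt (α := ℝ) hz

theorem isClosed_closedUpperHalf : IsClosed closedUpperHalf :=
  isClosed_le continuous_const Complex.continuous_im

theorem convex_closedUpperHalf : Convex ℝ closedUpperHalf := convex_halfSpace_im_ge 0

theorem circleMap_zero_mem_closedUpperHalf {R θ : ℝ} (hR : 0 ≤ R) (hθ : θ ∈ Icc 0 Real.pi) :
    circleMap 0 R θ ∈ closedUpperHalf := by
  simpa [closedUpperHalf, circleMap, Complex.exp_ofReal_mul_I_im] using
    mul_nonneg hR (Real.sin_nonneg_of_mem_Icc hθ)

theorem integral_comp_mul_deriv_eq_sub {s : Set ℂ} {f g : ℂ → ℂ} (hf : ContinuousOn f s)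
    (hg : ∀ z ∈ s, HasDerivWithinAt g (f z) s z) {γ γ' : ℝ → ℂ} {a b : ℝ} (hab : a ≤ b)
    (hγ : ∀ t, HasDerivAt γ (γ' t) t) (hγ' : Continuous γ') (hs : MapsTo γ (Icc a b) s) :
    ∫ t in a..b, f (γ t) * γ' t = g (γ b) - g (γ a) := by
  have hcomp : ∀ t ∈ Icc a b,
      HasDerivWithinAt (fun t => g (γ t)) (f (γ t) * γ' t) (Icc a b) t := fun t ht => by
    simpa [mul_comm, Function.comp_def] using
      (hg _ (hs ht)).scomp t (hγ t).hasDerivWithinAt hs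
  refine intervalIntegral.integral_eq_sub_of_hasDerivAt_of_le hab
    (fun t ht => (hcomp t ht).continuousWithinAt)
    (fun t ht => (hcomp t (Ioo_subset_Icc_self ht)).hasDerivAt (Icc_mem_nhds ht.1 ht.2)) ?_
  refine ContinuousOn.intervalIntegrable_of_Icc hab (ContinuousOn.mul ?_ hγ'.continuousOn)
  exact hf.comp (fun t _ => (hγ t).continuousAt.continuousWithinAt) hs

theorem integral_add_integral_semicircle_eq_zero_of_lt {f : ℂ → ℂ} {r R : ℝ} (hr : 0 ≤ r)
    (hrR : r < R) (hf : DifferentiableOn ℂ f (closedUpperHalf ∩ ball 0 R)) :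
    (∫ t in -r..r, f t) + ∫ θ in 0..Real.pi, f (circleMap 0 r θ) * (circleMap 0 r θ * Complex.I)
      = 0 := by
  obtain ⟨g, hg⟩ :=
    (convex_closedUpperHalf.inter (convex_ball 0 R)).exists_forall_hasDerivWithinAt hf
  have hsegment := integral_comp_mul_deriv_eq_sub hf.continuousOn hg (γ := fun t : ℝ => (t : ℂ))
    (neg_le_self hr) (fun t => Complex.ofRealCLM.hasDerivAt) continuous_const fun t ht =>
      ⟨ofReal_mem_closedUpperHalf t, by simpa using (abs_le.2 ht).trans_lt hrR⟩
  have harc := integral_comp_mul_deriv_eq_sub hf.continuousOn hg Real.pi_pos.le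
    (hasDerivAt_circleMap 0 r) (by fun_prop) fun θ hθ =>
      ⟨circleMap_zero_mem_closedUpperHalf hr hθ, by simpa [abs_of_nonneg hr] using hrR⟩
  simp only [Complex.ofRealCLM_apply, Complex.ofReal_one, mul_one] at hsegment
  rw [hsegment, harc]
  simp [circleMap]

theorem continuous_integral_add_integral_semicircle {f : ℂ → ℂ} (hf : Continuous f) :
    Continuous fun r : ℝ => (∫ t in -r..r, f t) +
      ∫ θ in 0..Real.pi, f (circleMap 0 r θ) * (circleMap 0 r θ * Complex.I) := by
  have hcircle : Continuous fun p : ℝ × ℝ => circleMap 0 p.1 p.2 := by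
    unfold circleMap
    fun_prop
  have hint (a b : ℝ) : IntervalIntegrable (fun t : ℝ => f t) volume a b :=
    (hf.comp Complex.continuous_ofReal).intervalIntegrable a b
  have hprim : Continuous fun r : ℝ => ∫ t in 0..r, f t :=
    intervalIntegral.continuous_primitive hint 0
  refine Continuous.add ((hprim.sub (hprim.comp continuous_neg)).congr fun r =>
    intervalIntegral.integral_interval_sub_left (hint _ _) (hint _ _)) ?_
  exact intervalIntegral.continuous_parametric_intervalIntegral_of_continuous'
    ((hf.comp hcircle).mul (hcircle.mul continuous_const)) 0 Real.pi

theorem integral_add_integral_semicircle_eq_zero {f : ℂ → ℂ} {R : ℝ} (hR : 0 < R)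
    (hc : ContinuousOn f closedUpperHalf)
    (hf : DifferentiableOn ℂ f (closedUpperHalf ∩ ball 0 R)) :
    (∫ t in -R..R, f t) + ∫ θ in 0..Real.pi, f (circleMap 0 R θ) * (circleMap 0 R θ * Complex.I)
      = 0 := by
  let proj : ℂ → ℂ := fun z => z.re + |z.im| * Complex.I
  have hproj : ∀ z ∈ closedUpperHalf, proj z = z := fun z (hz : 0 ≤ z.im) => by
    simp only [proj, abs_of_nonneg hz, Complex.re_add_im]
  have hfp : Continuous (f ∘ proj) :=
    hc.comp_continuous (by fun_prop) fun z => by simp [proj, closedUpperHalf]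
  have hfp_eq {r : ℝ} (hr : 0 ≤ r) : (∫ t in -r..r, (f ∘ proj) t) + (∫ θ in 0..Real.pi,
        (f ∘ proj) (circleMap 0 r θ) * (circleMap 0 r θ * Complex.I)) = (∫ t in -r..r, f t) +
      ∫ θ in 0..Real.pi, f (circleMap 0 r θ) * (circleMap 0 r θ * Complex.I) := by
    congr 1
    · simp [hproj _ (ofReal_mem_closedUpperHalf _)]
    · refine intervalIntegral.integral_congr fun θ hθ => ?_
      rw [uIcc_of_le Real.pi_pos.le] at hθ
      simp [hproj _ (circleMap_zero_mem_closedUpperHalf hr hθ)]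
  rw [← hfp_eq hR.le]
  refine tendsto_nhds_unique
    ((continuous_integral_add_integral_semicircle hfp).continuousAt.tendsto.mono_left
      (nhdsWithin_le_nhds (s := Iio R))) (tendsto_const_nhds.congr' ?_)
  filter_upwards [Ioo_mem_nhdsLT hR] with r hr
  rw [hfp_eq hr.1.le, integral_add_integral_semicircle_eq_zero_of_lt hr.1.le hr.2 hf]

/-- A multiplier that decays rapidly along the upper half of the circle `|z| = R` and converges to
`exp (2 i c x)` on the real axis as `R → ∞`. -/
noncomputable def semicircleMultiplier (c R : ℝ) (z : ℂ) : ℂ :=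
  Complex.exp (-2 * c * R ^ 2 * Complex.I * (z / (z ^ 2 - R ^ 2))) * (1 - z ^ 2 / R ^ 2)

theorem norm_semicircleMultiplier (c R : ℝ) (z : ℂ) :
    ‖semicircleMultiplier c R z‖ =
      Real.exp (2 * c * R ^ 2 * (z / (z ^ 2 - R ^ 2)).im) * ‖1 - z ^ 2 / R ^ 2‖ := by
  have hcast : (-2 * c * R ^ 2 * Complex.I * (z / (z ^ 2 - R ^ 2)) : ℂ) =
      ((-2 * c * R ^ 2 : ℝ) : ℂ) * (Complex.I * (z / (z ^ 2 - R ^ 2))) := by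
    push_cast
    ring
  rw [semicircleMultiplier, norm_mul, Complex.norm_exp, hcast, Complex.re_ofReal_mul,
    Complex.I_mul_re]
  ring_nf

theorem im_div_sq_sub_sq (R : ℝ) (z : ℂ) : (z / (z ^ 2 - R ^ 2)).im =
    -(z.im * (‖z‖ ^ 2 + R ^ 2)) / Complex.normSq (z ^ 2 - R ^ 2) := by
  rw [Complex.div_im, ← Complex.normSq_eq_norm_sq, Complex.normSq_apply z]
  simp only [pow_two, ← Complex.ofReal_mul, Complex.sub_re, Complex.sub_im, Complex.mul_re,
    Complex.mul_im, Complex.ofReal_re, Complex.ofReal_im]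
  ring

theorem norm_semicircleMultiplier_le {c : ℝ} (hc : 0 ≤ c) (R : ℝ) {z : ℂ}
    (hz : z ∈ closedUpperHalf) : ‖semicircleMultiplier c R z‖ ≤ ‖1 - z ^ 2 / R ^ 2‖ := by
  have hz' : 0 ≤ z.im := hz
  rw [norm_semicircleMultiplier, im_div_sq_sub_sq, neg_div, mul_neg]
  refine mul_le_of_le_one_left (norm_nonneg _) (Real.exp_le_one_iff.2 (neg_nonpos.2 ?_))
  have := Complex.normSq_nonneg (z ^ 2 - R ^ 2)
  positivity

theorem norm_semicircleMultiplier_le_on_sphere (c : ℝ) {R : ℝ} {z : ℂ} (hz : z ∈ upperHalf)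
    (hzR : ‖z‖ = R) : ‖semicircleMultiplier c R z‖ ≤ 2 * Real.exp (-c * R ^ 2 / z.im) := by
  have hz' : 0 < z.im := hz
  have hR : 0 < R := hzR ▸ hz'.trans_le (Complex.im_le_norm z)
  have hnormSq : Complex.normSq (z ^ 2 - R ^ 2) = 4 * R ^ 2 * z.im ^ 2 := by
    have hzz : z ^ 2 - R ^ 2 = z * (2 * z.im * Complex.I) := by
      have hsub := Complex.sub_conj z
      push_cast at hsub
      rw [← hzR, ← Complex.mul_conj', ← hsub]
      ring
    rw [hzz, map_mul, ← Complex.sq_norm z, hzR]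
    simp only [map_mul, Complex.normSq_I, Complex.normSq_ofReal, Complex.normSq_ofNat]
    ring
  have hfactor : ‖1 - z ^ 2 / R ^ 2‖ ≤ 2 := by
    refine (norm_sub_le _ _).trans ?_
    rw [norm_div, norm_pow, norm_pow, Complex.norm_real, hzR, Real.norm_of_nonneg hR.le,
      div_self (by positivity), norm_one]
    norm_num
  have hexp : 2 * c * R ^ 2 * (z / (z ^ 2 - R ^ 2)).im = -c * R ^ 2 / z.im := by
    rw [im_div_sq_sub_sq, hnormSq, hzR]
    field_simp
    ring
  rw [norm_semicircleMultiplier, hexp, mul_comm]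
  gcongr

theorem analyticAt_semicircleMultiplier {c R : ℝ} {z : ℂ} (hz : z ^ 2 ≠ R ^ 2) :
    AnalyticAt ℂ (semicircleMultiplier c R) z := by
  have hne : z ^ 2 - (R : ℂ) ^ 2 ≠ 0 := sub_ne_zero.2 hz
  unfold semicircleMultiplier
  fun_prop (disch := exact hne)

theorem continuousOn_semicircleMultiplier {c R : ℝ} (hc : 0 ≤ c) (hR : R ≠ 0) :
    ContinuousOn (semicircleMultiplier c R) closedUpperHalf := by
  intro z _
  by_cases hzR : z ^ 2 = R ^ 2
  · have hfactor : 1 - z ^ 2 / (R : ℂ) ^ 2 = 0 := by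
      rw [hzR, div_self (by simpa using hR), sub_self]
    have hlim : Tendsto (fun w : ℂ => ‖1 - w ^ 2 / (R : ℂ) ^ 2‖) (𝓝[closedUpperHalf] z) (𝓝 0) := by
      have hcont : Continuous fun w : ℂ => ‖1 - w ^ 2 / (R : ℂ) ^ 2‖ := by fun_prop
      simpa only [hfactor, norm_zero] using
        (hcont.continuousWithinAt (x := z)).tendsto
    rw [ContinuousWithinAt, semicircleMultiplier, hfactor, mul_zero]
    refine squeeze_zero_norm' ?_ hlim
    filter_upwards [self_mem_nhdsWithin] with w hw using norm_semicircleMultiplier_le hc R hw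
  · exact (analyticAt_semicircleMultiplier hzR).continuousAt.continuousWithinAt

theorem tendsto_semicircleMultiplier (c x : ℝ) :
    Tendsto (fun R : ℝ => semicircleMultiplier c R x) atTop
      (𝓝 (Complex.exp (2 * c * x * Complex.I))) := by
  have hq : Tendsto (fun R : ℝ => ((x ^ 2 / R ^ 2 : ℝ) : ℂ)) atTop (𝓝 0) :=
    (Complex.continuous_ofReal.tendsto' 0 0 rfl).comp
      (tendsto_const_nhds.div_atTop (tendsto_pow_atTop two_ne_zero))
  have hlim := (((hq.const_sub 1).inv₀ (by simp)).const_mul (2 * c * x * Complex.I)).cexp.mul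
    (hq.const_sub 1)
  simp only [sub_zero, inv_one, mul_one] at hlim
  refine hlim.congr' ?_
  filter_upwards [eventually_gt_atTop |x|] with R hR
  have hR0 : (R : ℂ) ≠ 0 := Complex.ofReal_ne_zero.2 ((abs_nonneg x).trans_lt hR).ne'
  have hne : (x : ℂ) ^ 2 - R ^ 2 ≠ 0 := by
    have := sq_lt_sq' (neg_lt_of_abs_lt hR) (lt_of_abs_lt hR)
    exact_mod_cast (sub_neg.2 this).ne
  have hne' : (R : ℂ) ^ 2 - x ^ 2 ≠ 0 := by rwa [← neg_sub, neg_ne_zero]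
  rw [semicircleMultiplier]
  push_cast
  congr 2
  field_simp
  ring

theorem tendsto_integral_mul_semicircleMultiplier {c : ℝ} (hc : 0 ≤ c) {L : ℝ → ℂ}
    (hL : Integrable L) :
    Tendsto (fun R : ℝ => ∫ t in -R..R, L t * semicircleMultiplier c R t) atTop
      (𝓝 (∫ t, L t * Complex.exp (2 * c * t * Complex.I))) := by
  have hlim : Tendsto (fun R : ℝ => ∫ t,
      (Ioc (-R) R).indicator (fun t => L t * semicircleMultiplier c R t) t) atTop
      (𝓝 (∫ t, L t * Complex.exp (2 * c * t * Complex.I))) := by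
    refine tendsto_integral_filter_of_dominated_convergence (fun t => ‖L t‖) ?_ ?_ hL.norm ?_
    · filter_upwards [eventually_gt_atTop 0] with R hR
      exact (hL.aestronglyMeasurable.mul
        ((continuousOn_semicircleMultiplier hc hR.ne').comp_continuous Complex.continuous_ofReal
          ofReal_mem_closedUpperHalf).aestronglyMeasurable).indicator measurableSet_Ioc
    · filter_upwards [eventually_gt_atTop 0] with R hR
      refine Eventually.of_forall fun t => ?_
      by_cases ht : t ∈ Ioc (-R) R
      · rw [indicator_of_mem ht, norm_mul]
        refine mul_le_of_le_one_right (norm_nonneg _)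
          ((norm_semicircleMultiplier_le hc R (ofReal_mem_closedUpperHalf t)).trans ?_)
        have hle : t ^ 2 / R ^ 2 ≤ 1 := (div_le_one (by positivity)).2 (sq_le_sq' ht.1.le ht.2)
        norm_cast
        rw [Real.norm_of_nonneg (by linarith)]
        linarith [show 0 ≤ t ^ 2 / R ^ 2 by positivity]
      · simp [indicator_of_notMem ht]
    · refine Eventually.of_forall fun t => ?_
      refine ((tendsto_semicircleMultiplier c t).const_mul (L t)).congr' ?_
      filter_upwards [eventually_gt_atTop |t|] with R hR
      rw [indicator_of_mem (s := Ioc (-R) R) ⟨neg_lt_of_abs_lt hR, (lt_of_abs_lt hR).le⟩]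
  refine hlim.congr' ?_
  filter_upwards [eventually_gt_atTop 0] with R hR
  rw [intervalIntegral.integral_of_le (by linarith), integral_indicator measurableSet_Ioc]

theorem norm_mul_semicircleMultiplier_le {K C c R : ℝ} {L : ℂ → ℂ} (hC : 0 ≤ C) (hcC : 2 * C < c)
    (hL : ∀ z ∈ upperHalf, ‖L z‖ ≤ K * Real.exp (C * (‖z‖ ^ 2 + 1) / z.im)) (hR : 1 ≤ R) {z : ℂ}
    (hz : z ∈ closedUpperHalf) (hzR : ‖z‖ = R) :
    ‖L z * semicircleMultiplier c R z‖ ≤ 2 * K * Real.exp (-(c - 2 * C) * R) := by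
  have hK : 0 ≤ K := nonneg_of_mul_nonneg_left
    ((norm_nonneg _).trans (hL Complex.I (by simp [upperHalf]))) (Real.exp_pos _)
  rcases (show 0 ≤ z.im from hz).eq_or_lt with hreal | hpos
  · have hzsq : z ^ 2 = R ^ 2 := by
      rw [← hzR, ← Complex.conj_mul', Complex.conj_eq_iff_im.2 hreal.symm, pow_two]
    have hR' : (R : ℂ) ≠ 0 := Complex.ofReal_ne_zero.2 (by linarith)
    rw [semicircleMultiplier, hzsq, div_self (pow_ne_zero 2 hR'), sub_self, sub_self, mul_zero,
      mul_zero, norm_zero]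
    positivity
  have him : z.im ≤ R := hzR ▸ Complex.im_le_norm z
  have hexponent : C * (R ^ 2 + 1) / z.im + -c * R ^ 2 / z.im ≤ -(c - 2 * C) * R := by
    rw [← add_div, div_le_iff₀ hpos]
    nlinarith [mul_le_mul_of_nonneg_left him (mul_nonneg (sub_nonneg.2 hcC.le) (by linarith)),
      mul_nonneg hC (show 0 ≤ R ^ 2 - 1 by nlinarith)]
  calc ‖L z * semicircleMultiplier c R z‖
      ≤ K * Real.exp (C * (R ^ 2 + 1) / z.im) * (2 * Real.exp (-c * R ^ 2 / z.im)) := by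
        rw [norm_mul]
        exact mul_le_mul (hzR ▸ hL z hpos) (norm_semicircleMultiplier_le_on_sphere c hpos hzR)
          (norm_nonneg _) (by positivity)
    _ = 2 * K * Real.exp (C * (R ^ 2 + 1) / z.im + -c * R ^ 2 / z.im) := by
        rw [Real.exp_add]
        ring
    _ ≤ _ := by gcongr

theorem integral_mul_exp_eq_zero_of_growth {K C s : ℝ} {L : ℂ → ℂ} (hC : 0 ≤ C) (hs : 4 * C < s)
    (hL : AnalyticOnNhd ℂ L closedUpperHalf) (hint : Integrable fun t : ℝ => L t)
    (hgrowth : ∀ z ∈ upperHalf, ‖L z‖ ≤ K * Real.exp (C * (‖z‖ ^ 2 + 1) / z.im)) :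
    ∫ t : ℝ, L t * Complex.exp (s * t * Complex.I) = 0 := by
  have hcC : 2 * C < s / 2 := by linarith
  have hc : 0 ≤ s / 2 := by linarith
  have hlim := tendsto_integral_mul_semicircleMultiplier hc hint
  have harc : Tendsto (fun R : ℝ => ∫ t in -R..R, L t * semicircleMultiplier (s / 2) R t) atTop
      (𝓝 0) := by
    have hbound : Tendsto (fun R : ℝ =>
        2 * K * Real.exp (-(s / 2 - 2 * C) * R) * R * |Real.pi - 0|) atTop (𝓝 0) := by
      have := ((tendsto_rpow_mul_exp_neg_mul_atTop_nhds_zero 1 _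
        (sub_pos.2 hcC)).const_mul (2 * K)).mul_const |Real.pi - 0|
      simp only [Real.rpow_one, mul_zero, zero_mul] at this
      exact this.congr fun R => by ring
    refine squeeze_zero_norm' ?_ hbound
    filter_upwards [eventually_ge_atTop 1] with R hR
    have hR0 : 0 < R := by linarith
    rw [eq_neg_of_add_eq_zero_left (integral_add_integral_semicircle_eq_zero hR0
      (f := fun z => L z * semicircleMultiplier (s / 2) R z)
      (hL.continuousOn.mul (continuousOn_semicircleMultiplier hc hR0.ne')) ?_), norm_neg]
    · refine intervalIntegral.norm_integral_le_of_norm_le_const fun θ hθ => ?_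
      rw [uIoc_of_le Real.pi_pos.le] at hθ
      have hnorm : ‖circleMap 0 R θ‖ = R := by simp [hR0.le]
      rw [norm_mul, norm_mul (circleMap 0 R θ), Complex.norm_I, mul_one, hnorm]
      gcongr
      exact norm_mul_semicircleMultiplier_le hC hcC hgrowth hR
        (circleMap_zero_mem_closedUpperHalf hR0.le (Ioc_subset_Icc_self hθ)) hnorm
    · refine fun z hz => ((hL z hz.1).mul (analyticAt_semicircleMultiplier fun hzR => ?_)
        ).differentiableAt.differentiableWithinAt
      have hsq := congrArg norm hzR
      rw [norm_pow, norm_pow, Complex.norm_real, Real.norm_of_nonneg hR0.le] at hsq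
      exact (mem_ball_zero_iff.1 hz.2).ne ((pow_left_inj₀ (norm_nonneg _) hR0.le two_ne_zero).1 hsq)
  rw [← tendsto_nhds_unique hlim harc]
  refine integral_congr_ae (Eventually.of_forall fun t => ?_)
  push_cast
  ring_nf

theorem sq_one_add_inv_le {C y : ℝ} (hC : 0 < C) (hy : 0 < y) :
    (1 + 1 / y) ^ 2 ≤ (1 + 2 / C) ^ 2 * Real.exp (C / y) := by
  have hlinear : 1 + 1 / y ≤ (1 + 2 / C) * Real.exp (C / (2 * y)) :=
    calc 1 + 1 / y ≤ (1 + 2 / C) * (C / (2 * y) + 1) := by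
          have : (1 + 2 / C) * (C / (2 * y) + 1) = 1 + 1 / y + (C / (2 * y) + 2 / C) := by
            field_simp
            ring
          rw [this]
          exact le_add_of_nonneg_right (by positivity)
      _ ≤ (1 + 2 / C) * Real.exp (C / (2 * y)) := by
          gcongr
          exact Real.add_one_le_exp _
  calc (1 + 1 / y) ^ 2 ≤ ((1 + 2 / C) * Real.exp (C / (2 * y))) ^ 2 := by gcongr
    _ = (1 + 2 / C) ^ 2 * Real.exp (C / y) := by
        rw [mul_pow, ← Real.exp_nat_mul]
        congr 2
        push_cast
        field_simp

theorem tendsto_integral_mul_exp_nhdsGT_zero {L : ℝ → ℂ} (hL : Integrable L) :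
    Tendsto (fun s : ℝ => ∫ t, L t * Complex.exp (s * t * Complex.I)) (𝓝[>] 0)
      (𝓝 (∫ t, L t)) := by
  refine tendsto_integral_filter_of_dominated_convergence (fun t => ‖L t‖) ?_ ?_ hL.norm ?_
  · exact Eventually.of_forall fun s => hL.aestronglyMeasurable.mul
      (by fun_prop : Continuous fun t : ℝ => Complex.exp (s * t * Complex.I)).aestronglyMeasurable
  · refine Eventually.of_forall fun s => Eventually.of_forall fun t => ?_
    rw [norm_mul, ← Complex.ofReal_mul, Complex.norm_exp_ofReal_mul_I, mul_one]
  · refine Eventually.of_forall fun t => ?_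
    have hcont : Continuous fun s : ℝ => L t * Complex.exp (s * t * Complex.I) := by fun_prop
    exact (hcont.tendsto' 0 (L t) (by simp)).mono_left nhdsWithin_le_nhds

theorem integral_eq_zero_of_le {K : ℝ} {L : ℂ → ℂ}
    (hL : AnalyticOnNhd ℂ L closedUpperHalf) (hint : Integrable fun t : ℝ => L t)
    (hle : ∀ z ∈ upperHalf, ‖L z‖ ≤ K * (1 + 1 / z.im) ^ 2) : ∫ t : ℝ, L t = 0 := by
  have hK : 0 ≤ K := nonneg_of_mul_nonneg_left
    ((norm_nonneg _).trans (hle Complex.I (by simp [upperHalf]))) (by norm_num)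
  refine tendsto_nhds_unique (tendsto_integral_mul_exp_nhdsGT_zero hint)
    (tendsto_const_nhds.congr' ?_)
  filter_upwards [self_mem_nhdsWithin] with s (hs : 0 < s)
  have hC : 0 < s / 8 := by positivity
  refine (integral_mul_exp_eq_zero_of_growth (K := K * (1 + 2 / (s / 8)) ^ 2) hC.le (by linarith)
    hL hint fun z hz => (hle z hz).trans ?_).symm
  have hz' : 0 < z.im := hz
  rw [mul_assoc]
  refine mul_le_mul_of_nonneg_left ((sq_one_add_inv_le hC hz').trans ?_) hK
  gcongr
  nlinarith [mul_nonneg hC.le (sq_nonneg ‖z‖)]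

end HalfPlaneCauchy

section DifferenceQuotient

theorem continuous_ofReal_of_analyticOnNhd {f : ℂ → ℂ} (hf : AnalyticOnNhd ℂ f closedUpperHalf) :
    Continuous fun t : ℝ => f t :=
  hf.continuousOn.comp_continuous Complex.continuous_ofReal ofReal_mem_closedUpperHalf

theorem dslope_eq_div {f : ℂ → ℂ} {a z : ℂ} (h : z ≠ a) :
    dslope f a z = (f z - f a) / (z - a) := by
  rw [dslope_of_ne _ h, slope_def_module, smul_eq_mul, inv_mul_eq_div]

theorem analyticAt_dslope {f : ℂ → ℂ} {a z : ℂ} (hf : AnalyticAt ℂ f z) :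
    AnalyticAt ℂ (dslope f a) z := by
  rcases eq_or_ne z a with rfl | hza
  · obtain ⟨p, hp⟩ := hf
    exact ⟨_, hp.has_fpower_series_dslope_fslope⟩
  · have hquot : AnalyticAt ℂ (fun w => (f w - f a) / (w - a)) z :=
      (hf.fun_sub analyticAt_const).fun_div (by fun_prop) (sub_ne_zero.2 hza)
    refine hquot.congr ?_
    filter_upwards [isOpen_ne.mem_nhds hza] with w hw
    rw [dslope_eq_div hw]

theorem analyticOnNhd_dslope {f : ℂ → ℂ} {s : Set ℂ} (hf : AnalyticOnNhd ℂ f s) (a : ℂ) :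
    AnalyticOnNhd ℂ (dslope f a) s :=
  fun z hz => analyticAt_dslope (hf z hz)

theorem exists_norm_dslope_le_of_norm_sub_le {f : ℂ → ℂ}
    (hf : AnalyticOnNhd ℂ f closedUpperHalf) (w : ℂ) :
    ∃ M : ℝ, 0 ≤ M ∧ ∀ z ∈ closedUpperHalf, ‖z - w‖ ≤ 1 → ‖dslope f w z‖ ≤ M := by
  obtain ⟨M, hM⟩ := ((isCompact_closedBall w 1).inter_right
    isClosed_closedUpperHalf).exists_bound_of_continuousOn
    ((analyticOnNhd_dslope hf w).continuousOn.mono inter_subset_right)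
  exact ⟨max M 0, le_max_right _ _, fun z hz hzw =>
    (hM z ⟨by simpa [dist_eq_norm] using hzw, hz⟩).trans (le_max_left _ _)⟩

theorem exists_norm_dslope_le {f : ℂ → ℂ} {K : ℝ} {W : ℂ → ℝ}
    (hf : AnalyticOnNhd ℂ f closedUpperHalf) (w : ℂ) (hW : ∀ z ∈ upperHalf, 1 ≤ W z)
    (hfK : ∀ z ∈ upperHalf, ‖f z‖ ≤ K * W z) :
    ∃ K' : ℝ, ∀ z ∈ upperHalf, ‖dslope f w z‖ ≤ K' * W z := by
  obtain ⟨M, hM0, hM⟩ := exists_norm_dslope_le_of_norm_sub_le hf w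
  refine ⟨M + (|K| + ‖f w‖), fun z hz => ?_⟩
  have hWz := hW z hz
  have hsum : 0 ≤ |K| + ‖f w‖ := by positivity
  rcases le_or_gt ‖z - w‖ 1 with hnear | hfar
  · have hle := hM z (upperHalf_subset_closedUpperHalf hz) hnear
    nlinarith
  · have hne : z ≠ w := by
      rintro rfl
      norm_num at hfar
    rw [dslope_eq_div hne, norm_div]
    calc ‖f z - f w‖ / ‖z - w‖ ≤ ‖f z - f w‖ := div_le_self (norm_nonneg _) hfar.le
      _ ≤ K * W z + ‖f w‖ * 1 := by
        rw [mul_one]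
        exact (norm_sub_le _ _).trans (add_le_add_left (hfK z hz) _)
      _ ≤ |K| * W z + ‖f w‖ * W z := by
        gcongr
        exact le_abs_self K
      _ ≤ (M + (|K| + ‖f w‖)) * W z := by nlinarith

theorem sq_norm_ofReal_sub {p : ℂ} (hp : p.im ≠ 0) (t : ℝ) :
    ‖(t : ℂ) - p‖ ^ 2 = p.im ^ 2 * (1 + ((t - p.re) / p.im) ^ 2) := by
  rw [← Complex.normSq_eq_norm_sq, Complex.normSq_apply]
  simp only [Complex.sub_re, Complex.sub_im, Complex.ofReal_re, Complex.ofReal_im]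
  field_simp
  ring

theorem sq_norm_inv_ofReal_sub {p : ℂ} (hp : p.im ≠ 0) (t : ℝ) :
    ‖((t : ℂ) - p)⁻¹‖ ^ 2 = (p.im ^ 2)⁻¹ * (1 + ((t - p.re) / p.im) ^ 2)⁻¹ := by
  rw [norm_inv, inv_pow, sq_norm_ofReal_sub hp, mul_inv]

theorem integrable_sq_norm_inv_sub {p : ℂ} (hp : p.im ≠ 0) :
    Integrable fun t : ℝ => ‖((t : ℂ) - p)⁻¹‖ ^ 2 := by
  simp only [sq_norm_inv_ofReal_sub hp]
  exact ((integrable_inv_one_add_sq.comp_div hp).comp_sub_right p.re).const_mul _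

theorem integral_sq_norm_inv_sub {p : ℂ} (hp : p.im ≠ 0) :
    ∫ t : ℝ, ‖((t : ℂ) - p)⁻¹‖ ^ 2 = Real.pi / |p.im| := by
  have habs : |p.im| ≠ 0 := abs_ne_zero.2 hp
  simp only [sq_norm_inv_ofReal_sub hp]
  rw [integral_const_mul, integral_sub_right_eq_self (fun t : ℝ => (1 + (t / p.im) ^ 2)⁻¹) p.re,
    Measure.integral_comp_div (fun t : ℝ => (1 + t ^ 2)⁻¹) p.im, integral_univ_inv_one_add_sq,
    smul_eq_mul, ← sq_abs p.im]
  field_simp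

theorem ofReal_sub_ne_zero {p : ℂ} (hp : p.im ≠ 0) (t : ℝ) : (t : ℂ) - p ≠ 0 := by
  intro h
  have him := congrArg Complex.im h
  simp only [Complex.sub_im, Complex.ofReal_im, zero_sub, Complex.zero_im, neg_eq_zero] at him
  exact hp him

theorem memLp_inv_sub {p : ℂ} (hp : p.im ≠ 0) : MemLp (fun t : ℝ => ((t : ℂ) - p)⁻¹) 2 :=
  (memLp_two_iff_integrable_sq_norm (Continuous.inv₀ (by fun_prop)
    (ofReal_sub_ne_zero hp)).aestronglyMeasurable).2 (integrable_sq_norm_inv_sub hp)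

theorem memLp_dslope {f : ℂ → ℂ} (hf : AnalyticOnNhd ℂ f closedUpperHalf)
    (hf2 : MemLp (fun t : ℝ => f t) 2) {w : ℂ} (hfw : f w = 0) :
    MemLp (fun t : ℝ => dslope f w t) 2 := by
  obtain ⟨M, hM0, hM⟩ := exists_norm_dslope_le_of_norm_sub_le hf w
  let near : ℝ → ℝ := (Icc (w.re - 1) (w.re + 1)).indicator fun _ => M
  have hnear0 : ∀ t, 0 ≤ near t := indicator_nonneg fun _ _ => hM0
  have hdom : MemLp (fun t : ℝ => ‖f t‖ + near t) 2 :=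
    hf2.norm.add (memLp_indicator_const 2 measurableSet_Icc M (Or.inr (by simp)))
  refine hdom.of_le (continuous_ofReal_of_analyticOnNhd
    (analyticOnNhd_dslope hf w)).aestronglyMeasurable (Eventually.of_forall fun t => ?_)
  rw [Real.norm_of_nonneg (add_nonneg (norm_nonneg _) (hnear0 t))]
  rcases le_or_gt ‖(t : ℂ) - w‖ 1 with hle | hlt
  · have hre : |t - w.re| ≤ 1 := by
      simpa using (Complex.abs_re_le_norm ((t : ℂ) - w)).trans hle
    have hmem : t ∈ Icc (w.re - 1) (w.re + 1) := by
      constructor <;> linarith [abs_le.1 hre]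
    have hval : near t = M := indicator_of_mem hmem _
    linarith [hM t (ofReal_mem_closedUpperHalf t) hle, norm_nonneg (f t)]
  · have hmul := congrArg norm (sub_smul_dslope f w t)
    rw [hfw, sub_zero, norm_smul] at hmul
    nlinarith [norm_nonneg (dslope f w t), hnear0 t]

theorem integrable_dslope {f : ℂ → ℂ} (hf : AnalyticOnNhd ℂ f closedUpperHalf)
    (hf2 : MemLp (fun t : ℝ => f t) 2) {w : ℂ} (hfw : f w = 0) :
    Integrable fun t : ℝ => dslope f w t := by
  set p : ℂ := w.re - Complex.I with hp
  have hpim : p.im ≠ 0 := by simp [hp]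
  -- The difference quotient times `t - p` is still square integrable.
  have hmul : MemLp (fun t : ℝ => f t + (w - p) * dslope f w t) 2 :=
    hf2.add ((memLp_dslope hf hf2 hfw).const_mul _)
  refine (hmul.integrable_mul (memLp_inv_sub hpim)).congr (Eventually.of_forall fun t => ?_)
  have hne := ofReal_sub_ne_zero hpim t
  have hquot := sub_smul_dslope f w t
  rw [hfw, sub_zero, smul_eq_mul] at hquot
  simp only [Pi.mul_apply]
  rw [← hquot]
  field_simp
  ring

end DifferenceQuotient

section CauchyFormula

theorem sq_norm_integral_mul_le {α : Type*} [MeasurableSpace α] {μ : Measure α} {f g : α → ℂ}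
    (hf : MemLp f 2 μ) (hg : MemLp g 2 μ) :
    ‖∫ t, f t * g t ∂μ‖ ^ 2 ≤ (∫ t, ‖f t‖ ^ 2 ∂μ) * ∫ t, ‖g t‖ ^ 2 ∂μ := by
  have hnorm : ‖∫ t, f t * g t ∂μ‖ ≤ ∫ t, ‖f t‖ * ‖g t‖ ∂μ :=
    (norm_integral_le_integral_norm _).trans_eq (by simp only [norm_mul])
  have hHolder := integral_mul_le_Lp_mul_Lq_of_nonneg (μ := μ)
    (f := fun t => ‖f t‖) (g := fun t => ‖g t‖) Real.HolderConjugate.two_two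
    (Eventually.of_forall fun _ => norm_nonneg _) (Eventually.of_forall fun _ => norm_nonneg _)
    (by simpa using hf.norm) (by simpa using hg.norm)
  simp only [Real.rpow_two, ← Real.sqrt_eq_rpow] at hHolder
  have hf0 : 0 ≤ ∫ t, ‖f t‖ ^ 2 ∂μ := integral_nonneg fun _ => by positivity
  have hg0 : 0 ≤ ∫ t, ‖g t‖ ^ 2 ∂μ := integral_nonneg fun _ => by positivity
  calc ‖∫ t, f t * g t ∂μ‖ ^ 2 ≤ (√(∫ t, ‖f t‖ ^ 2 ∂μ) * √(∫ t, ‖g t‖ ^ 2 ∂μ)) ^ 2 :=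
        pow_le_pow_left₀ (norm_nonneg _) (hnorm.trans hHolder) 2
    _ = _ := by rw [mul_pow, Real.sq_sqrt hf0, Real.sq_sqrt hg0]

theorem integrable_mul_inv_sub {g : ℝ → ℂ} (hg : MemLp g 2) {w : ℂ} (hw : w.im ≠ 0) :
    Integrable fun t : ℝ => g t * ((t : ℂ) - w)⁻¹ :=
  hg.integrable_mul (memLp_inv_sub hw)

theorem sq_norm_integral_mul_inv_sub_le {g : ℝ → ℂ} (hg : MemLp g 2) {w : ℂ} (hw : w.im ≠ 0) :
    ‖∫ t : ℝ, g t * ((t : ℂ) - w)⁻¹‖ ^ 2 ≤ (∫ t, ‖g t‖ ^ 2) * (Real.pi / |w.im|) := by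
  rw [← integral_sq_norm_inv_sub hw]
  exact sq_norm_integral_mul_le hg (memLp_inv_sub hw)

theorem analyticOnNhd_inv_sub {p : ℂ} (hp : p.im < 0) :
    AnalyticOnNhd ℂ (fun z => (z - p)⁻¹) closedUpperHalf := by
  intro z hz
  refine AnalyticAt.fun_inv (by fun_prop) (sub_ne_zero.2 ?_)
  rintro rfl
  exact hp.not_ge hz

theorem norm_inv_sub_le {p z : ℂ} (hp : p.im < 0) (hz : 0 ≤ z.im) :
    ‖(z - p)⁻¹‖ ≤ (-p.im)⁻¹ := by
  rw [norm_inv]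
  refine inv_anti₀ (by linarith) ?_
  have him := (le_abs_self _).trans (Complex.abs_im_le_norm (z - p))
  simp only [Complex.sub_im] at him
  linarith

/-- `g z - g w * (w - p) / (z - p)`: the correction makes `g` vanish at `w` and keeps it square
integrable on the real axis, so that its difference quotient at `w` is integrable there. -/
noncomputable def cauchyAux (g : ℂ → ℂ) (w p z : ℂ) : ℂ := g z - g w * ((w - p) * (z - p)⁻¹)

theorem cauchyAux_self (g : ℂ → ℂ) {w p : ℂ} (h : w ≠ p) : cauchyAux g w p w = 0 := by
  rw [cauchyAux, mul_inv_cancel₀ (sub_ne_zero.2 h), mul_one, sub_self]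

theorem analyticOnNhd_cauchyAux {g : ℂ → ℂ} (hg : AnalyticOnNhd ℂ g closedUpperHalf) (w : ℂ)
    {p : ℂ} (hp : p.im < 0) : AnalyticOnNhd ℂ (cauchyAux g w p) closedUpperHalf := fun z hz =>
  (hg z hz).fun_sub (analyticAt_const.fun_mul
    (analyticAt_const.fun_mul (analyticOnNhd_inv_sub hp z hz)))

theorem memLp_cauchyAux {g : ℂ → ℂ} (hg : MemLp (fun t : ℝ => g t) 2) (w : ℂ) {p : ℂ}
    (hp : p.im ≠ 0) : MemLp (fun t : ℝ => cauchyAux g w p t) 2 :=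
  hg.sub (((memLp_inv_sub hp).const_mul _).const_mul _)

theorem dslope_cauchyAux_ofReal (g : ℂ → ℂ) {w p : ℂ} (hwp : w ≠ p) {t : ℝ} (hw : (t : ℂ) ≠ w) :
    dslope (cauchyAux g w p) w t =
      g t * ((t : ℂ) - w)⁻¹ - g w * (w - p) * (((t : ℂ) - p)⁻¹ * ((t : ℂ) - w)⁻¹) := by
  rw [dslope_eq_div hw, cauchyAux_self g hwp, cauchyAux]
  ring

theorem exists_norm_cauchyAux_le {g : ℂ → ℂ} {K : ℝ} {W : ℂ → ℝ} (w : ℂ) {p : ℂ} (hp : p.im < 0)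
    (hW : ∀ z ∈ upperHalf, 1 ≤ W z) (hgK : ∀ z ∈ upperHalf, ‖g z‖ ≤ K * W z) :
    ∃ K' : ℝ, ∀ z ∈ upperHalf, ‖cauchyAux g w p z‖ ≤ K' * W z := by
  have hp' : 0 < -p.im := by linarith
  refine ⟨K + ‖g w‖ * (‖w - p‖ * (-p.im)⁻¹), fun z hz => ?_⟩
  rw [add_mul]
  refine (norm_sub_le _ _).trans (add_le_add (hgK z hz) ?_)
  rw [norm_mul, norm_mul]
  have hz' : 0 < z.im := hz
  calc _ ≤ ‖g w‖ * (‖w - p‖ * (-p.im)⁻¹) := by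
        gcongr
        exact norm_inv_sub_le hp hz'.le
    _ ≤ _ := le_mul_of_one_le_right (by positivity) (hW z hz)

theorem exists_norm_dslope_cauchyAux_le {g : ℂ → ℂ} {K : ℝ} {W : ℂ → ℝ}
    (hg : AnalyticOnNhd ℂ g closedUpperHalf) (w : ℂ) {p : ℂ} (hp : p.im < 0)
    (hW : ∀ z ∈ upperHalf, 1 ≤ W z) (hgK : ∀ z ∈ upperHalf, ‖g z‖ ≤ K * W z) :
    ∃ K' : ℝ, ∀ z ∈ upperHalf, ‖dslope (cauchyAux g w p) w z‖ ≤ K' * W z := by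
  obtain ⟨K₁, hK₁⟩ := exists_norm_cauchyAux_le w hp hW hgK
  exact exists_norm_dslope_le (analyticOnNhd_cauchyAux hg w hp) w hW hK₁

theorem integrable_dslope_cauchyAux {g : ℂ → ℂ} (hga : AnalyticOnNhd ℂ g closedUpperHalf)
    (hg2 : MemLp (fun t : ℝ => g t) 2) {w p : ℂ} (hp : p.im < 0) (hwp : w ≠ p) :
    Integrable fun t : ℝ => dslope (cauchyAux g w p) w t :=
  integrable_dslope (analyticOnNhd_cauchyAux hga w hp) (memLp_cauchyAux hg2 w hp.ne)
    (cauchyAux_self g hwp)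

/-- The Hardy space `H²` of the upper half-plane, restricted to functions analytic on the closed
half-plane. Square integrability is required on the real axis only; the pointwise bound replaces the
integrals over parallel lines. -/
structure IsHardy (g : ℂ → ℂ) : Prop where
  analytic : AnalyticOnNhd ℂ g closedUpperHalf
  memLp : MemLp (fun t : ℝ => g t) 2
  bound : ∃ K : ℝ, ∀ z ∈ upperHalf, ‖g z‖ ≤ K * (1 + 1 / z.im)

theorem one_le_one_add_one_div {z : ℂ} (hz : z ∈ upperHalf) : 1 ≤ 1 + 1 / z.im :=
  le_add_of_nonneg_right (one_div_nonneg.2 (le_of_lt hz))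

theorem IsHardy.integral_dslope_cauchyAux {g : ℂ → ℂ} (hg : IsHardy g) {w p : ℂ}
    (hp : p.im < 0) (hwp : w ≠ p) : ∫ t : ℝ, dslope (cauchyAux g w p) w t = 0 := by
  obtain ⟨K, hK⟩ := hg.bound
  obtain ⟨K', hK'⟩ := exists_norm_dslope_cauchyAux_le hg.analytic w hp
    (fun _ => one_le_one_add_one_div) hK
  refine integral_eq_zero_of_le (K := |K'|)
    (analyticOnNhd_dslope (analyticOnNhd_cauchyAux hg.analytic w hp) w)
    (integrable_dslope_cauchyAux hg.analytic hg.memLp hp hwp) fun z hz => (hK' z hz).trans ?_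
  have hone := one_le_one_add_one_div hz
  calc K' * (1 + 1 / z.im) ≤ |K'| * (1 + 1 / z.im) :=
        mul_le_mul_of_nonneg_right (le_abs_self _) (by linarith)
    _ ≤ |K'| * (1 + 1 / z.im) ^ 2 :=
        mul_le_mul_of_nonneg_left (le_self_pow₀ hone two_ne_zero) (abs_nonneg _)

theorem ne_conj_of_mem_upperHalf {w : ℂ} (hw : w ∈ upperHalf) : w ≠ conj w :=
  sub_ne_zero.1 (sub_conj_ne_zero hw hw)

theorem conj_im_neg {w : ℂ} (hw : w ∈ upperHalf) : (conj w).im < 0 := by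
  simpa [upperHalf] using hw

theorem sub_conj_mul_pi_div_im {w : ℂ} (hw : w ∈ upperHalf) :
    (w - conj w) * (Real.pi / w.im : ℝ) = 2 * Real.pi * Complex.I := by
  have hw' : 0 < w.im := hw
  have hne : (w.im : ℂ) ≠ 0 := mod_cast hw'.ne'
  rw [Complex.sub_conj]
  push_cast
  field_simp

theorem integral_inv_sub_conj_mul_inv_sub {w : ℂ} (hw : w ∈ upperHalf) :
    ∫ t : ℝ, ((t : ℂ) - conj w)⁻¹ * ((t : ℂ) - w)⁻¹ = (Real.pi / w.im : ℝ) := by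
  have hw' : 0 < w.im := hw
  have hprod (t : ℝ) :
      ((t : ℂ) - conj w)⁻¹ * ((t : ℂ) - w)⁻¹ = (‖((t : ℂ) - w)⁻¹‖ ^ 2 : ℝ) := by
    have hconj : ((t : ℂ) - conj w)⁻¹ = conj ((t : ℂ) - w)⁻¹ := by simp
    rw [hconj, mul_comm, Complex.mul_conj, Complex.normSq_eq_norm_sq]
  simp only [hprod]
  rw [integral_complex_ofReal, integral_sq_norm_inv_sub hw'.ne', abs_of_pos hw']

theorem IsHardy.integral_mul_inv_sub {g : ℂ → ℂ} (hg : IsHardy g) {w : ℂ} (hw : w ∈ upperHalf) :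
    ∫ t : ℝ, g t * ((t : ℂ) - w)⁻¹ = 2 * Real.pi * Complex.I * g w := by
  have hw0 : w.im ≠ 0 := ne_of_gt hw
  have hwc := conj_im_neg hw
  have hzero := hg.integral_dslope_cauchyAux hwc (ne_conj_of_mem_upperHalf hw)
  simp only [dslope_cauchyAux_ofReal g (ne_conj_of_mem_upperHalf hw)
    (sub_ne_zero.1 (ofReal_sub_ne_zero hw0 _))] at hzero
  rw [integral_sub (integrable_mul_inv_sub hg.memLp hw0)
    ((integrable_mul_inv_sub (memLp_inv_sub hwc.ne) hw0).const_mul _), integral_const_mul,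
    integral_inv_sub_conj_mul_inv_sub hw, sub_eq_zero, mul_assoc, sub_conj_mul_pi_div_im hw]
    at hzero
  rw [hzero, mul_comm]

theorem norm_exp_mul_I_le_one {s : ℝ} (hs : 0 ≤ s) {z : ℂ} (hz : 0 ≤ z.im) :
    ‖Complex.exp (s * z * Complex.I)‖ ≤ 1 := by
  rw [Complex.norm_exp, Real.exp_le_one_iff]
  simpa using mul_nonneg hs hz

theorem isHardy_exp_mul_inv_sub {s : ℝ} (hs : 0 ≤ s) {p : ℂ} (hp : p.im < 0) :
    IsHardy fun z => Complex.exp (s * z * Complex.I) * (z - p)⁻¹ := by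
  have han : AnalyticOnNhd ℂ (fun z => Complex.exp (s * z * Complex.I) * (z - p)⁻¹)
      closedUpperHalf := fun z hz =>
    AnalyticAt.fun_mul (by fun_prop) (analyticOnNhd_inv_sub hp z hz)
  have hle {z : ℂ} (hz : 0 ≤ z.im) :
      ‖Complex.exp (s * z * Complex.I) * (z - p)⁻¹‖ ≤ ‖(z - p)⁻¹‖ := by
    rw [norm_mul]
    exact mul_le_of_le_one_left (norm_nonneg _) (norm_exp_mul_I_le_one hs hz)
  refine ⟨han, (memLp_inv_sub hp.ne).of_le
    (continuous_ofReal_of_analyticOnNhd han).aestronglyMeasurable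
    (Eventually.of_forall fun t => hle (by simp)), (-p.im)⁻¹, fun z hz => ?_⟩
  have hz' : 0 < z.im := hz
  exact (hle hz'.le).trans ((norm_inv_sub_le hp hz'.le).trans
    (le_mul_of_one_le_right (by rw [inv_nonneg]; linarith) (one_le_one_add_one_div hz)))

theorem sq_norm_le_of_integral_mul_inv_sub {g : ℝ → ℂ} (hg : MemLp g 2) {w a : ℂ}
    (hw : w ∈ upperHalf)
    (ha : ∫ t : ℝ, g t * ((t : ℂ) - w)⁻¹ = 2 * Real.pi * Complex.I * a) :
    ‖a‖ ^ 2 ≤ (∫ t, ‖g t‖ ^ 2) / (4 * Real.pi * w.im) := by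
  have hw' : 0 < w.im := hw
  have hCS := sq_norm_integral_mul_inv_sub_le hg hw'.ne'
  have hnorm : ‖2 * Real.pi * Complex.I * a‖ = 2 * Real.pi * ‖a‖ := by
    simp [abs_of_pos Real.pi_pos]
  rw [ha, hnorm, abs_of_pos hw', ← mul_div_assoc, le_div_iff₀ hw'] at hCS
  rw [le_div_iff₀ (by positivity)]
  refine le_of_mul_le_mul_right ?_ Real.pi_pos
  linarith

theorem IsHardy.sq_norm_le {g : ℂ → ℂ} (hg : IsHardy g) {w : ℂ} (hw : w ∈ upperHalf) :
    ‖g w‖ ^ 2 ≤ (∫ t : ℝ, ‖g t‖ ^ 2) / (4 * Real.pi * w.im) :=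
  sq_norm_le_of_integral_mul_inv_sub hg.memLp hw (hg.integral_mul_inv_sub hw)

end CauchyFormula

section BoundedType

theorem norm_exp_ofReal_mul_ofReal_mul_I (s t : ℝ) :
    ‖Complex.exp (s * t * Complex.I)‖ = 1 := by
  rw [← Complex.ofReal_mul, Complex.norm_exp_ofReal_mul_I]

theorem memLp_mul_exp {g : ℝ → ℂ} (hg : MemLp g 2) (s : ℝ) :
    MemLp (fun t : ℝ => g t * Complex.exp (s * t * Complex.I)) 2 := by
  refine hg.of_le (hg.aestronglyMeasurable.mul
    (Continuous.aestronglyMeasurable (by fun_prop))) (Eventually.of_forall fun t => ?_)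
  rw [norm_mul, norm_exp_ofReal_mul_ofReal_mul_I, mul_one]

theorem integral_mul_exp_mul_inv_sub_of_growth {g : ℂ → ℂ} {C s : ℝ} (hC : 0 ≤ C)
    (hs : 4 * C < s) (hga : AnalyticOnNhd ℂ g closedUpperHalf)
    (hg2 : MemLp (fun t : ℝ => g t) 2)
    (hgr : ∀ z ∈ upperHalf, ‖g z‖ ≤ Real.exp (C * (‖z‖ ^ 2 + 1) / z.im)) {w : ℂ}
    (hw : w ∈ upperHalf) :
    ∫ t : ℝ, g t * Complex.exp (s * t * Complex.I) * ((t : ℂ) - w)⁻¹ =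
      2 * Real.pi * Complex.I * (g w * Complex.exp (s * w * Complex.I)) := by
  have hw0 : w.im ≠ 0 := ne_of_gt hw
  have hs0 : 0 ≤ s := by linarith
  have hwc := conj_im_neg hw
  have hne := ne_conj_of_mem_upperHalf hw
  obtain ⟨K, hK⟩ := exists_norm_dslope_cauchyAux_le hga w hwc
    (W := fun z => Real.exp (C * (‖z‖ ^ 2 + 1) / z.im)) (K := 1)
    (fun z hz => Real.one_le_exp (div_nonneg (by positivity) (le_of_lt hz)))
    (fun z hz => (hgr z hz).trans_eq (one_mul _).symm)
  have hzero := integral_mul_exp_eq_zero_of_growth hC hs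
    (analyticOnNhd_dslope (analyticOnNhd_cauchyAux hga w hwc) w)
    (integrable_dslope_cauchyAux hga hg2 hwc hne) hK
  have hexp := isHardy_exp_mul_inv_sub hs0 hwc
  have hsplit (t : ℝ) : dslope (cauchyAux g w (conj w)) w t * Complex.exp (s * t * Complex.I) =
      g t * Complex.exp (s * t * Complex.I) * ((t : ℂ) - w)⁻¹ - g w * (w - conj w) *
        (Complex.exp (s * t * Complex.I) * ((t : ℂ) - conj w)⁻¹ * ((t : ℂ) - w)⁻¹) := by
    rw [dslope_cauchyAux_ofReal g hne (sub_ne_zero.1 (ofReal_sub_ne_zero hw0 _))]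
    ring
  simp only [hsplit] at hzero
  rw [integral_sub (integrable_mul_inv_sub (memLp_mul_exp hg2 s) hw0)
    ((integrable_mul_inv_sub hexp.memLp hw0).const_mul _), integral_const_mul,
    hexp.integral_mul_inv_sub hw, sub_eq_zero] at hzero
  rw [hzero]
  field_simp [sub_ne_zero.2 hne]

theorem sq_norm_le_exp_of_growth {g : ℂ → ℂ} {C s : ℝ} (hC : 0 ≤ C) (hs : 4 * C < s)
    (hga : AnalyticOnNhd ℂ g closedUpperHalf) (hg2 : MemLp (fun t : ℝ => g t) 2)
    (hgr : ∀ z ∈ upperHalf, ‖g z‖ ≤ Real.exp (C * (‖z‖ ^ 2 + 1) / z.im)) {w : ℂ}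
    (hw : w ∈ upperHalf) :
    ‖g w‖ ^ 2 ≤ (∫ t : ℝ, ‖g t‖ ^ 2) / (4 * Real.pi * w.im) * Real.exp (s * w.im) ^ 2 := by
  have hle := sq_norm_le_of_integral_mul_inv_sub (memLp_mul_exp hg2 s) hw
    (integral_mul_exp_mul_inv_sub_of_growth hC hs hga hg2 hgr hw)
  have hexp : ‖Complex.exp (s * w * Complex.I)‖ = (Real.exp (s * w.im))⁻¹ := by
    rw [Complex.norm_exp, ← Real.exp_neg]
    simp
  simp only [norm_mul, norm_exp_ofReal_mul_ofReal_mul_I, mul_one, hexp] at hle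
  rwa [← div_eq_mul_inv, div_pow, div_le_iff₀ (by positivity)] at hle

theorem eventually_norm_le_exp_of_meanType_le {f : ℂ → ℂ} (hf : meanType f ≤ 0) {δ : ℝ}
    (hδ : 0 < δ) : ∀ᶠ y : ℝ in atTop, ‖f (y * Complex.I)‖ ≤ Real.exp (δ * y) := by
  have hlt : meanType f < (δ : EReal) := hf.trans_lt (by exact_mod_cast hδ)
  filter_upwards [eventually_lt_of_limsup_lt hlt, eventually_gt_atTop 0] with y hy hy0
  rw [EReal.div_lt_iff (by exact_mod_cast hy0) (EReal.coe_ne_top y)] at hy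
  have hlog : ENNReal.log ‖f (y * Complex.I)‖ₑ <
      ENNReal.log (ENNReal.ofReal (Real.exp (δ * y))) := by
    rw [ENNReal.log_ofReal_of_pos (Real.exp_pos _), Real.log_exp]
    exact_mod_cast hy
  rw [ENNReal.log_lt_log_iff, ← ofReal_norm] at hlog
  exact ((ENNReal.ofReal_lt_ofReal_iff (Real.exp_pos _)).1 hlog).le

theorem meanType_nonpos_of_eventually_norm_le {f : ℂ → ℂ} {M : ℝ}
    (hf : ∀ᶠ y : ℝ in atTop, ‖f (y * Complex.I)‖ ≤ M) : meanType f ≤ 0 := by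
  refine le_of_forall_gt fun b hb => ?_
  obtain ⟨δ, hδ0, hδb⟩ := EReal.lt_iff_exists_real_btwn.1 hb
  have hδ : 0 < δ := by exact_mod_cast hδ0
  refine lt_of_le_of_lt (limsup_le_of_le (by isBoundedDefault) ?_) hδb
  have hlim : Tendsto (fun y : ℝ => Real.exp (y * δ)) atTop atTop :=
    Real.tendsto_exp_atTop.comp (tendsto_id.atTop_mul_const hδ)
  filter_upwards [hf, eventually_gt_atTop 0, hlim.eventually_ge_atTop M] with y hy hy0 hyM
  rw [EReal.div_le_iff_le_mul (by exact_mod_cast hy0) (EReal.coe_ne_top y)]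
  have hlog : ENNReal.log ‖f (y * Complex.I)‖ₑ ≤
      ENNReal.log (ENNReal.ofReal (Real.exp (y * δ))) := by
    rw [← ofReal_norm]
    exact ENNReal.log_le_log (ENNReal.ofReal_le_ofReal (hy.trans hyM))
  rw [ENNReal.log_ofReal_of_pos (Real.exp_pos _), Real.log_exp] at hlog
  exact_mod_cast hlog

/-- The function `ζ ↦ g (iζ + i) e^{-δζ}` on the right half-plane, to which the Phragmén–Lindelöf
principle is applied. -/
noncomputable def rotatedDamped (g : ℂ → ℂ) (δ : ℝ) (ζ : ℂ) : ℂ :=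
  g (Complex.I * ζ + Complex.I) * Complex.exp (-δ * ζ)

theorem norm_rotatedDamped (g : ℂ → ℂ) (δ : ℝ) (ζ : ℂ) :
    ‖rotatedDamped g δ ζ‖ = ‖g (Complex.I * ζ + Complex.I)‖ * Real.exp (-δ * ζ.re) := by
  rw [rotatedDamped, norm_mul, Complex.norm_exp]
  simp

theorem diffContOnCl_rotatedDamped {g : ℂ → ℂ} (hg : AnalyticOnNhd ℂ g closedUpperHalf) (δ : ℝ) :
    DiffContOnCl ℂ (rotatedDamped g δ) {ζ | 0 < ζ.re} := by
  refine DifferentiableOn.diffContOnCl fun ζ hζ => ?_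
  rw [Complex.closure_setOfPred_lt_re] at hζ
  have hmem : Complex.I * ζ + Complex.I ∈ closedUpperHalf := by
    have hre : 0 ≤ ζ.re := hζ
    simpa [closedUpperHalf] using by linarith
  have hcomp : DifferentiableAt ℂ (fun ζ => g (Complex.I * ζ + Complex.I)) ζ :=
    (hg _ hmem).differentiableAt.comp ζ (by fun_prop)
  exact (hcomp.mul (by fun_prop)).differentiableWithinAt

theorem norm_rotatedDamped_le {g : ℂ → ℂ} {B s δ : ℝ}
    (hexp : ∀ z : ℂ, 1 ≤ z.im → ‖g z‖ ≤ B * Real.exp (s * z.im)) (hδ : 0 ≤ δ) {ζ : ℂ}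
    (hζ : 0 ≤ ζ.re) : ‖rotatedDamped g δ ζ‖ ≤ B * Real.exp s * Real.exp (s * ζ.re) := by
  have him : (Complex.I * ζ + Complex.I).im = ζ.re + 1 := by simp
  have hg := hexp (Complex.I * ζ + Complex.I) (by rw [him]; linarith)
  rw [him, mul_add, mul_one, add_comm (s * ζ.re), Real.exp_add, ← mul_assoc] at hg
  rw [norm_rotatedDamped]
  exact (mul_le_of_le_one_right (norm_nonneg _)
    (Real.exp_le_one_iff.2 (by nlinarith))).trans hg

theorem eventually_norm_rotatedDamped_le {g : ℂ → ℂ} {δ : ℝ} (hmt : meanType g ≤ 0) (hδ : 0 < δ) :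
    ∀ᶠ x : ℝ in atTop, ‖rotatedDamped g δ x‖ ≤ Real.exp δ := by
  filter_upwards [(tendsto_atTop_add_const_right atTop (1 : ℝ) tendsto_id).eventually
    (eventually_norm_le_exp_of_meanType_le hmt hδ)] with x hx
  have harg : Complex.I * x + Complex.I = ((id x + 1 : ℝ) : ℂ) * Complex.I := by
    push_cast [id]
    ring
  rw [norm_rotatedDamped, harg, Complex.ofReal_re]
  calc _ ≤ Real.exp (δ * (x + 1)) * Real.exp (-δ * x) := by gcongr; exact hx
    _ = Real.exp δ := by rw [← Real.exp_add]; ring_nf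

theorem norm_rotatedDamped_le_of_meanType {g : ℂ → ℂ} {B s δ : ℝ}
    (hga : AnalyticOnNhd ℂ g closedUpperHalf)
    (hexp : ∀ z : ℂ, 1 ≤ z.im → ‖g z‖ ≤ B * Real.exp (s * z.im)) (hs : 0 ≤ s)
    (hmt : meanType g ≤ 0) (hδ : 0 < δ) {ζ : ℂ} (hζ : 0 ≤ ζ.re) :
    ‖rotatedDamped g δ ζ‖ ≤ B * Real.exp s := by
  have hB : 0 ≤ B := nonneg_of_mul_nonneg_left ((norm_nonneg _).trans (hexp Complex.I (by simp)))
    (Real.exp_pos _)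
  refine PhragmenLindelof.right_half_plane_of_bounded_on_real (diffContOnCl_rotatedDamped hga δ)
    ⟨1, by norm_num, s, ?_⟩ ⟨Real.exp δ, ?_⟩ (fun x => ?_) hζ
  · refine Asymptotics.IsBigO.of_bound (B * Real.exp s) (Eventually.filter_mono inf_le_right ?_)
    rw [eventually_principal]
    intro ζ hζ
    have hζ0 : 0 < ζ.re := hζ
    rw [Real.norm_of_nonneg (Real.exp_pos _).le, Real.rpow_one]
    refine (norm_rotatedDamped_le hexp hδ.le hζ0.le).trans ?_
    have hre := Complex.re_le_norm ζ
    gcongr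
  · rw [eventually_map]
    exact eventually_norm_rotatedDamped_le hmt hδ
  · simpa using norm_rotatedDamped_le hexp hδ.le (ζ := x * Complex.I) (by simp)

theorem norm_le_of_meanType {g : ℂ → ℂ} {B s : ℝ} (hga : AnalyticOnNhd ℂ g closedUpperHalf)
    (hexp : ∀ z : ℂ, 1 ≤ z.im → ‖g z‖ ≤ B * Real.exp (s * z.im)) (hs : 0 ≤ s)
    (hmt : meanType g ≤ 0) {z : ℂ} (hz : 1 ≤ z.im) : ‖g z‖ ≤ B * Real.exp s := by
  set ζ : ℂ := (z - Complex.I) / Complex.I with hζ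
  have harg : Complex.I * ζ + Complex.I = z := by
    rw [hζ]
    field_simp
    ring
  have hre : 0 ≤ ζ.re := by simpa [hζ] using hz
  have hlim : Tendsto (fun δ : ℝ => ‖rotatedDamped g δ ζ‖) (𝓝[>] 0) (𝓝 ‖g z‖) := by
    have hcont : Continuous fun δ : ℝ => ‖rotatedDamped g δ ζ‖ := by
      simp only [rotatedDamped]
      fun_prop
    have h0 : rotatedDamped g (0 : ℝ) ζ = g z := by simp [rotatedDamped, harg]
    simpa only [h0] using (hcont.tendsto 0).mono_left nhdsWithin_le_nhds
  refine le_of_tendsto hlim ?_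
  filter_upwards [self_mem_nhdsWithin] with δ hδ
  exact norm_rotatedDamped_le_of_meanType hga hexp hs hmt hδ hre

theorem BoundedType.exists_norm_le_exp_mul {g : ℂ → ℂ}
    (hga : AnalyticOnNhd ℂ g closedUpperHalf) (hg2 : MemLp (fun t : ℝ => g t) 2)
    (hbt : BoundedType g) :
    ∃ B s : ℝ, 0 ≤ B ∧ 0 ≤ s ∧
      ∀ z ∈ upperHalf, ‖g z‖ ≤ B * Real.exp (s * z.im) * (1 + 1 / z.im) := by
  obtain ⟨C, hC, hgr⟩ := hbt.exists_norm_le_exp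
  set A := (∫ t : ℝ, ‖g t‖ ^ 2) / (4 * Real.pi) with hA
  have hA0 : 0 ≤ A := div_nonneg (integral_nonneg fun _ => by positivity) (by positivity)
  refine ⟨√A, 4 * C + 1, Real.sqrt_nonneg A, by positivity, fun w hw => ?_⟩
  have hw' : 0 < w.im := hw
  have hinv : 0 < 1 / w.im := by positivity
  refine le_of_sq_le_sq ?_ (by positivity)
  calc ‖g w‖ ^ 2 ≤ A * (1 / w.im) * Real.exp ((4 * C + 1) * w.im) ^ 2 := by
        rw [hA, div_mul_div_comm, mul_one]
        exact sq_norm_le_exp_of_growth hC (by linarith) hga hg2 hgr hw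
    _ ≤ A * (1 + 1 / w.im) ^ 2 * Real.exp ((4 * C + 1) * w.im) ^ 2 := by
        gcongr
        nlinarith
    _ = (√A * Real.exp ((4 * C + 1) * w.im) * (1 + 1 / w.im)) ^ 2 := by
        rw [mul_pow, mul_pow, Real.sq_sqrt hA0]
        ring

theorem isHardy_of_boundedType {g : ℂ → ℂ} (hga : AnalyticOnNhd ℂ g closedUpperHalf)
    (hg2 : MemLp (fun t : ℝ => g t) 2) (hbt : BoundedType g) (hmt : meanType g ≤ 0) :
    IsHardy g := by
  obtain ⟨B, s, hB, hs, hg⟩ := hbt.exists_norm_le_exp_mul hga hg2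
  have hexp : ∀ z : ℂ, 1 ≤ z.im → ‖g z‖ ≤ 2 * B * Real.exp (s * z.im) := fun z hz => by
    have hpos : 0 < z.im := by linarith
    have hinv : 1 / z.im ≤ 1 := (div_le_one hpos).2 hz
    calc ‖g z‖ ≤ B * Real.exp (s * z.im) * (1 + 1 / z.im) := hg z hpos
      _ ≤ B * Real.exp (s * z.im) * (1 + 1) := by gcongr
      _ = 2 * B * Real.exp (s * z.im) := by ring
  refine ⟨hga, hg2, 2 * B * Real.exp s, fun z hz => ?_⟩
  have hpos : 0 < z.im := hz
  rcases le_total 1 z.im with hone | hone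
  · exact (norm_le_of_meanType hga hexp hs hmt hone).trans
      (le_mul_of_one_le_right (by positivity) (one_le_one_add_one_div hz))
  · refine (hg z hz).trans ?_
    have hsz : s * z.im ≤ s := mul_le_of_le_one_right hs hone
    gcongr
    linarith

end BoundedType

section HermiteBiehlerFunctions

theorem sharp_ofReal (f : ℂ → ℂ) (t : ℝ) : sharp f t = conj (f t) := by simp [sharp]

theorem norm_sharp_ofReal (f : ℂ → ℂ) (t : ℝ) : ‖sharp f t‖ = ‖f t‖ := by
  rw [sharp_ofReal, RCLike.norm_conj]

theorem sharp_conj (f : ℂ → ℂ) (z : ℂ) : sharp f (conj z) = conj (f z) := by simp [sharp]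

theorem sharp_mul (f g : ℂ → ℂ) : sharp (fun z => f z * g z) = fun z => sharp f z * sharp g z := by
  ext z; simp [sharp]

theorem hasDerivAt_sharp {f : ℂ → ℂ} (hf : Differentiable ℂ f) (z : ℂ) :
    HasDerivAt (sharp f) (conj (deriv f (conj z))) z := by
  have hderiv := (hf (conj z)).hasDerivAt.conj_conj
  rwa [Complex.conj_conj] at hderiv

theorem differentiable_sharp {f : ℂ → ℂ} (hf : Differentiable ℂ f) : Differentiable ℂ (sharp f) :=
  fun z => (hasDerivAt_sharp hf z).differentiableAt

theorem eq_zero_of_ofReal_eq_zero {f : ℂ → ℂ} (hf : Differentiable ℂ f)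
    (h : ∀ t : ℝ, f t = 0) : f = 0 := by
  refine AnalyticOnNhd.eq_of_frequently_eq (z₀ := ((0 : ℝ) : ℂ)) (fun z _ => hf.analyticAt z)
    (fun z _ => analyticAt_const) ?_
  have hofReal : Tendsto (fun t : ℝ => (t : ℂ)) (𝓝[≠] 0) (𝓝[≠] ((0 : ℝ) : ℂ)) :=
    tendsto_nhdsWithin_iff.2
      ⟨(Complex.continuous_ofReal.tendsto 0).mono_left nhdsWithin_le_nhds,
        eventually_nhdsWithin_of_forall fun t ht => by simpa using ht⟩
  exact hofReal.frequently (Frequently.of_forall fun t => h t)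

theorem ofReal_re_eq_of_im_eq_zero {z : ℂ} (hz : z.im = 0) : ((z.re : ℝ) : ℂ) = z :=
  Complex.ext rfl (by simp [hz])

variable {E F f : ℂ → ℂ}

theorem HermiteBiehler.ne_zero (hE : HermiteBiehler E) (hEr : NoRealZeros E) {z : ℂ}
    (hz : z ∈ closedUpperHalf) : E z ≠ 0 := by
  rcases (show 0 ≤ z.im from hz).eq_or_lt with him | him
  · rw [← ofReal_re_eq_of_im_eq_zero him.symm]
    exact hEr z.re
  · exact norm_pos_iff.1 ((norm_nonneg _).trans_lt (hE.2 z him))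

theorem HermiteBiehler.norm_sharp_lt (hE : HermiteBiehler E) {z : ℂ} (hz : z ∈ upperHalf) :
    ‖sharp E z‖ < ‖E z‖ := by
  rw [sharp, RCLike.norm_conj]
  exact hE.2 z hz

theorem HermiteBiehler.norm_sharp_le (hE : HermiteBiehler E) {z : ℂ}
    (hz : z ∈ closedUpperHalf) : ‖sharp E z‖ ≤ ‖E z‖ := by
  rcases (show 0 ≤ z.im from hz).eq_or_lt with him | him
  · rw [← ofReal_re_eq_of_im_eq_zero him.symm, norm_sharp_ofReal]
  · exact (hE.norm_sharp_lt him).le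

theorem HermiteBiehler.mul (hE : HermiteBiehler E) (hF : HermiteBiehler F) :
    HermiteBiehler fun z => E z * F z := by
  refine ⟨hE.1.mul hF.1, fun z hz => ?_⟩
  rw [norm_mul, norm_mul]
  exact mul_lt_mul'' (hE.2 z hz) (hF.2 z hz) (norm_nonneg _) (norm_nonneg _)

theorem HermiteBiehler.analyticOnNhd_div (hE : HermiteBiehler E) (hEr : NoRealZeros E)
    (hf : Differentiable ℂ f) : AnalyticOnNhd ℂ (fun z => f z / E z) closedUpperHalf :=
  fun z hz => (hf.analyticAt z).fun_div (hE.1.analyticAt z) (hE.ne_zero hEr hz)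

/-- The entire functions `f` for which `f / E` and `f* / E` belong to the Hardy space. It contains
`space E`, and unlike the conditions of bounded type and mean type in `space E` its defining
conditions are estimates, hence easily checked for products, quotients and limits. -/
def hardySpace (E : ℂ → ℂ) : Set (ℂ → ℂ) :=
  {f | Differentiable ℂ f ∧ IsHardy (fun z => f z / E z) ∧ IsHardy (fun z => sharp f z / E z)}

theorem space_subset_hardySpace (hE : HermiteBiehler E) (hEr : NoRealZeros E) :
    space E ⊆ hardySpace E := by
  rintro f ⟨hf, hint, hbt, hmt, hbt', hmt'⟩
  have han := hE.analyticOnNhd_div hEr hf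
  have han' := hE.analyticOnNhd_div hEr (differentiable_sharp hf)
  have hmem : MemLp (fun t : ℝ => f t / E t) 2 := (memLp_two_iff_integrable_sq_norm
    (continuous_ofReal_of_analyticOnNhd han).aestronglyMeasurable).2 hint
  have hmem' : MemLp (fun t : ℝ => sharp f t / E t) 2 := hmem.of_le
    (continuous_ofReal_of_analyticOnNhd han').aestronglyMeasurable
    (Eventually.of_forall fun t => by simp only [norm_div, norm_sharp_ofReal, le_refl])
  exact ⟨hf, isHardy_of_boundedType han hmem hbt hmt,
    isHardy_of_boundedType han' hmem' hbt' hmt'⟩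

end HermiteBiehlerFunctions

section Kernel

variable {E F f : ℂ → ℂ}

theorem kernelNum_self_ofReal (E : ℂ → ℂ) (x : ℝ) : kernelNum E x x = 0 := by
  simp [kernelNum, sharp, mul_comm]

theorem differentiable_kernelNum (hE : Differentiable ℂ E) (w : ℂ) :
    Differentiable ℂ (kernelNum E w) :=
  (hE.const_mul _).sub ((differentiable_sharp hE).const_mul _)

theorem kernel_ofReal_of_ne (E : ℂ → ℂ) {x : ℝ} {z : ℂ} (h : z ≠ x) :
    kernel E x z = kernelNum E x z / (2 * Real.pi * Complex.I * (x - z)) := by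
  rw [kernel, Complex.conj_ofReal, if_neg h]

theorem kernel_ofReal_eq_dslope (E : ℂ → ℂ) (x : ℝ) :
    kernel E x = fun z => -dslope (kernelNum E x) x z / (2 * Real.pi * Complex.I) := by
  ext z
  rcases eq_or_ne z x with rfl | h
  · rw [kernel, Complex.conj_ofReal, if_pos rfl, dslope_same]
  · rw [kernel_ofReal_of_ne E h, dslope_eq_div h, kernelNum_self_ofReal, sub_zero, ← div_neg,
      neg_sub, div_div, mul_comm]

theorem differentiable_kernel (hE : Differentiable ℂ E) (x : ℝ) :
    Differentiable ℂ (kernel E x) := by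
  rw [kernel_ofReal_eq_dslope]
  exact fun z => ((analyticAt_dslope
    ((differentiable_kernelNum hE x).analyticAt z)).differentiableAt.neg).div_const _

theorem sharp_kernel (hE : Differentiable ℂ E) (x : ℝ) : sharp (kernel E x) = kernel E x := by
  refine Continuous.ext_on (s := {(x : ℂ)}ᶜ) (dense_compl_singleton _)
    (differentiable_sharp (differentiable_kernel hE x)).continuous
    (differentiable_kernel hE x).continuous fun z (hz : z ≠ x) => ?_
  have hzc : conj z ≠ (x : ℂ) := fun h => hz (by
    rw [← Complex.conj_conj z, h, Complex.conj_ofReal])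
  rw [sharp, kernel_ofReal_of_ne E hzc, kernel_ofReal_of_ne E hz, kernelNum, kernelNum]
  simp only [map_div₀, map_sub, map_mul, Complex.conj_conj, Complex.conj_I, Complex.conj_ofReal,
    sharp, map_ofNat]
  rw [← neg_div_neg_eq]
  congr 1 <;> ring

theorem norm_kernelNum_le (hE : HermiteBiehler E) (x : ℝ) {z : ℂ} (hz : z ∈ closedUpperHalf) :
    ‖kernelNum E x z‖ ≤ 2 * ‖E x‖ * ‖E z‖ := by
  have hsharp := mul_le_mul_of_nonneg_left (hE.norm_sharp_le hz) (norm_nonneg (E x))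
  rw [kernelNum, Complex.conj_ofReal]
  refine (norm_sub_le _ _).trans ?_
  rw [norm_mul, norm_mul, RCLike.norm_conj]
  linarith

theorem norm_kernel_div_mul_le (hE : HermiteBiehler E) (hEr : NoRealZeros E) (x : ℝ)
    {z : ℂ} (hz : z ∈ closedUpperHalf) : ‖kernel E x z / E z‖ * ‖z - x‖ ≤ ‖E x‖ := by
  rcases eq_or_ne z x with rfl | hzx
  · simp
  have hEz : 0 < ‖E z‖ := norm_pos_iff.2 (hE.ne_zero hEr hz)
  have hpos : 0 < ‖z - x‖ := norm_pos_iff.2 (sub_ne_zero.2 hzx)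
  have hden : ‖2 * Real.pi * Complex.I * (x - z)‖ = 2 * Real.pi * ‖z - x‖ := by
    simp [abs_of_pos Real.pi_pos, norm_sub_rev (x : ℂ) z]
  rw [kernel_ofReal_of_ne E hzx, norm_div, norm_div, hden]
  calc _ = ‖kernelNum E x z‖ / (2 * Real.pi * ‖E z‖) := by field_simp
    _ ≤ 2 * ‖E x‖ * ‖E z‖ / (2 * Real.pi * ‖E z‖) := by
      gcongr
      exact norm_kernelNum_le hE x hz
    _ = ‖E x‖ / Real.pi := by field_simp
    _ ≤ ‖E x‖ := div_le_self (norm_nonneg _) (by linarith [Real.pi_gt_three])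

theorem im_le_norm_sub_ofReal (z : ℂ) (x : ℝ) : z.im ≤ ‖z - x‖ := by
  simpa using (le_abs_self _).trans (Complex.abs_im_le_norm (z - x))

theorem one_le_norm_add_I {z : ℂ} (hz : 0 ≤ z.im) : 1 ≤ ‖z + Complex.I‖ := by
  have him := (le_abs_self _).trans (Complex.abs_im_le_norm (z + Complex.I))
  rw [Complex.add_im, Complex.I_im] at him
  linarith

theorem boundedType_of_norm_mul_norm_sub_le {k : ℂ → ℂ} {x M : ℝ}
    (hk : DifferentiableOn ℂ k upperHalf) (hle : ∀ z ∈ upperHalf, ‖k z‖ * ‖z - x‖ ≤ M) :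
    BoundedType k := by
  have hge : ∀ z ∈ upperHalf, 1 ≤ ‖z + Complex.I‖ := fun z hz => one_le_norm_add_I (le_of_lt hz)
  have hne : ∀ z ∈ upperHalf, z + Complex.I ≠ 0 := fun z hz =>
    norm_pos_iff.1 (one_pos.trans_le (hge z hz))
  have hq : DifferentiableOn ℂ (fun z : ℂ => (z - x) / (z + Complex.I)) upperHalf :=
    DifferentiableOn.div (by fun_prop) (by fun_prop) hne
  refine ⟨hk, fun z => k z * ((z - x) / (z + Complex.I)), fun z => (z - x) / (z + Complex.I),
    ⟨hk.mul hq, M, fun z hz => ?_⟩, ⟨hq, 1 + ‖(x : ℂ) + Complex.I‖, fun z hz => ?_⟩,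
    ⟨Complex.I, by simp [upperHalf], ?_⟩, fun z _ => rfl⟩
  · rw [norm_mul, norm_div (z - x), ← mul_div_assoc]
    exact (div_le_self (by positivity) (hge z hz)).trans (hle z hz)
  · rw [norm_div, div_le_iff₀ (one_pos.trans_le (hge z hz))]
    have htri : ‖z - x‖ ≤ ‖z + Complex.I‖ + ‖(x : ℂ) + Complex.I‖ := by
      rw [← add_sub_add_right_eq_sub z (x : ℂ) Complex.I]
      exact norm_sub_le _ _
    nlinarith [hge z hz, norm_nonneg ((x : ℂ) + Complex.I)]
  · refine div_ne_zero (norm_pos_iff.1 (one_pos.trans_le ?_)) (hne _ (by simp [upperHalf]))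
    simpa using im_le_norm_sub_ofReal Complex.I x

theorem meanType_nonpos_of_norm_mul_norm_sub_le {k : ℂ → ℂ} {x M : ℝ}
    (hle : ∀ z ∈ upperHalf, ‖k z‖ * ‖z - x‖ ≤ M) : meanType k ≤ 0 := by
  refine meanType_nonpos_of_eventually_norm_le (M := M) ?_
  filter_upwards [eventually_ge_atTop 1] with y hy
  have hmem : (y : ℂ) * Complex.I ∈ upperHalf := by simpa [upperHalf] using by linarith
  have hge : 1 ≤ ‖(y : ℂ) * Complex.I - x‖ :=
    hy.trans (by simpa using im_le_norm_sub_ofReal (y * Complex.I) x)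
  exact (le_mul_of_one_le_right (norm_nonneg _) hge).trans (hle _ hmem)

theorem memLp_of_norm_mul_abs_sub_le {k : ℝ → ℂ} {x M : ℝ} (hk : Continuous k)
    (hle : ∀ t, ‖k t‖ * |t - x| ≤ M) : MemLp k 2 := by
  obtain ⟨B, hB⟩ := (isCompact_closedBall x 1).exists_bound_of_continuousOn hk.continuousOn
  have hM : 0 ≤ M := (mul_nonneg (norm_nonneg _) (abs_nonneg _)).trans (hle x)
  have hbound (t : ℝ) : ‖k t‖ ≤ |B| + M := by
    rcases le_or_gt |t - x| 1 with hnear | hfar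
    · have hmem : t ∈ closedBall x 1 := by rwa [mem_closedBall, Real.dist_eq]
      linarith [hB t hmem, le_abs_self B]
    · linarith [hle t, le_mul_of_one_le_right (norm_nonneg (k t)) hfar.le, abs_nonneg B]
  set p : ℂ := x - Complex.I with hp
  have hpim : p.im ≠ 0 := by simp [hp]
  refine (memLp_inv_sub hpim).of_le_mul (c := |B| + 2 * M) hk.aestronglyMeasurable
    (Eventually.of_forall fun t => ?_)
  have htri : ‖(t : ℂ) - p‖ ≤ |t - x| + 1 := by
    rw [hp, ← sub_add, ← Complex.ofReal_sub]
    refine (norm_add_le _ _).trans_eq ?_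
    rw [Complex.norm_real, Real.norm_eq_abs, Complex.norm_I]
  rw [norm_inv, ← div_eq_mul_inv, le_div_iff₀ (norm_pos_iff.2 (ofReal_sub_ne_zero hpim t))]
  calc ‖k t‖ * ‖(t : ℂ) - p‖ ≤ ‖k t‖ * (|t - x| + 1) := by gcongr
    _ ≤ |B| + 2 * M := by linarith [hle t, hbound t]

theorem kernel_mem_space (hE : HermiteBiehler E) (hEr : NoRealZeros E) (x : ℝ) :
    kernel E x ∈ space E := by
  have hd := differentiable_kernel hE.1 x
  have han := hE.analyticOnNhd_div hEr hd
  have hle {z : ℂ} (hz : z ∈ closedUpperHalf) := norm_kernel_div_mul_le hE hEr x hz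
  have hle' : ∀ z ∈ upperHalf, ‖kernel E x z / E z‖ * ‖z - x‖ ≤ ‖E x‖ :=
    fun z hz => hle (upperHalf_subset_closedUpperHalf hz)
  have hbt := boundedType_of_norm_mul_norm_sub_le
    (han.mono upperHalf_subset_closedUpperHalf).differentiableOn hle'
  have hmt : meanType (fun z => kernel E x z / E z) ≤ 0 :=
    meanType_nonpos_of_norm_mul_norm_sub_le hle'
  have hcont := continuous_ofReal_of_analyticOnNhd han
  have hmem := memLp_of_norm_mul_abs_sub_le (x := x) (M := ‖E x‖) hcont fun t => by
    rw [← Real.norm_eq_abs, ← Complex.norm_real, Complex.ofReal_sub]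
    exact hle (ofReal_mem_closedUpperHalf t)
  refine ⟨hd, (memLp_two_iff_integrable_sq_norm hcont.aestronglyMeasurable).1 hmem, hbt, hmt, ?_⟩
  rw [sharp_kernel hE.1 x]
  exact ⟨hbt, hmt⟩

theorem kernel_mem_hardySpace (hE : HermiteBiehler E) (hEr : NoRealZeros E) (x : ℝ) :
    kernel E x ∈ hardySpace E :=
  space_subset_hardySpace hE hEr (kernel_mem_space hE hEr x)

theorem conj_kernel_div {x t : ℝ} (hEt : E t ≠ 0) (htx : (t : ℂ) ≠ x) :
    conj (kernel E x t / E t) =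
      (E x - conj (E x) * (E t / conj (E t))) * (t - x : ℂ)⁻¹ / (2 * Real.pi * Complex.I) := by
  have hconj : conj (E t) ≠ 0 := by simpa using hEt
  have hsub : (t : ℂ) - x ≠ 0 := sub_ne_zero.2 htx
  have hsub' : (x : ℂ) - t = -(t - x) := by ring
  rw [kernel_ofReal_of_ne E htx, kernelNum]
  simp only [sharp_ofReal, map_div₀, map_sub, map_mul, Complex.conj_conj, Complex.conj_I,
    Complex.conj_ofReal, map_ofNat]
  rw [hsub']
  field_simp

theorem ofReal_sq_norm_inv_sub_sub_I (x t : ℝ) :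
    ((‖((t : ℂ) - (x - Complex.I))⁻¹‖ ^ 2 : ℝ) : ℂ) =
      (((t : ℂ) - (x - Complex.I)) * ((t : ℂ) - (x + Complex.I)))⁻¹ := by
  rw [norm_inv, inv_pow, ← Complex.normSq_eq_norm_sq, Complex.ofReal_inv, ← Complex.mul_conj]
  congr 2
  simp only [map_sub, Complex.conj_ofReal, Complex.conj_I, sub_neg_eq_add]

theorem ofReal_ne_sub_I (x : ℝ) : (x : ℂ) ≠ x - Complex.I := fun h => by
  simpa using congrArg Complex.im h

-- Off `x`, the integrand of the reproducing formula splits into two difference quotients, whose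
-- integrals vanish, and a multiple of the Poisson kernel of `x + i`.
theorem mul_conj_kernel_eq {x t : ℝ} (hEx : E x ≠ 0) (hEt : E t ≠ 0) (htx : (t : ℂ) ≠ x) :
    f t / E t * conj (kernel E x t / E t) =
      E x / (2 * Real.pi * Complex.I) *
          dslope (cauchyAux (fun z => f z / E z) x (x - Complex.I)) x t -
        conj (E x) / (2 * Real.pi * Complex.I) *
          conj (dslope (cauchyAux (fun z => sharp f z / E z) x (x - Complex.I)) x t) +
        f x / Real.pi * (‖((t : ℂ) - (x - Complex.I))⁻¹‖ ^ 2 : ℝ) := by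
  have hxp := ofReal_ne_sub_I x
  have hsub : (t : ℂ) - x ≠ 0 := sub_ne_zero.2 htx
  have hcEx : conj (E x) ≠ 0 := by simpa using hEx
  have hcEt : conj (E t) ≠ 0 := by simpa using hEt
  have hp : (t : ℂ) - (x - Complex.I) ≠ 0 := ofReal_sub_ne_zero (by simp) t
  have hq : (t : ℂ) - (x + Complex.I) ≠ 0 := ofReal_sub_ne_zero (by simp) t
  rw [conj_kernel_div hEt htx, ofReal_sq_norm_inv_sub_sub_I, dslope_cauchyAux_ofReal _ hxp htx,
    dslope_cauchyAux_ofReal _ hxp htx]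
  simp only [sharp_ofReal, map_div₀, map_sub, map_mul, Complex.conj_conj, Complex.conj_I,
    Complex.conj_ofReal, map_inv₀, sub_neg_eq_add]
  field_simp
  ring

theorem integral_mul_conj_kernel (hEr : NoRealZeros E) (hf : f ∈ hardySpace E) (x : ℝ) :
    ∫ t : ℝ, f t / E t * conj (kernel E x t / E t) = f x := by
  obtain ⟨-, hg, hh⟩ := hf
  have hp : ((x : ℂ) - Complex.I).im < 0 := by simp
  have hxp := ofReal_ne_sub_I x
  have hgi := integrable_dslope_cauchyAux hg.analytic hg.memLp hp hxp
  have hhi : Integrable fun t : ℝ =>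
      conj (dslope (cauchyAux (fun z => sharp f z / E z) x (x - Complex.I)) x t) :=
    (LinearIsometryEquiv.integrable_comp_iff (RCLike.conjLIE (K := ℂ))).2
      (integrable_dslope_cauchyAux hh.analytic hh.memLp hp hxp)
  have hPi : Integrable fun t : ℝ => ((‖((t : ℂ) - (x - Complex.I))⁻¹‖ ^ 2 : ℝ) : ℂ) :=
    (integrable_sq_norm_inv_sub hp.ne).ofReal
  have hdiff : Integrable fun t : ℝ =>
      E x / (2 * Real.pi * Complex.I) *
          dslope (cauchyAux (fun z => f z / E z) x (x - Complex.I)) x t -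
        conj (E x) / (2 * Real.pi * Complex.I) *
          conj (dslope (cauchyAux (fun z => sharp f z / E z) x (x - Complex.I)) x t) :=
    (hgi.const_mul _).sub (hhi.const_mul _)
  have hae : ∀ᵐ t : ℝ, t ≠ x := by simp [ae_iff]
  rw [integral_congr_ae (hae.mono fun t ht => mul_conj_kernel_eq (hEr x) (hEr t) (mod_cast ht)),
    integral_add hdiff (hPi.const_mul _),
    integral_sub (hgi.const_mul _) (hhi.const_mul _), integral_const_mul, integral_const_mul,
    integral_const_mul, integral_conj, hg.integral_dslope_cauchyAux hp hxp,
    hh.integral_dslope_cauchyAux hp hxp, integral_complex_ofReal, integral_sq_norm_inv_sub hp.ne]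
  simp [Real.pi_ne_zero]

theorem kernel_self_eq_normSq (hE : HermiteBiehler E) (hEr : NoRealZeros E) (x : ℝ) :
    kernel E x x = (normSq E (kernel E x) : ℂ) := by
  rw [← integral_mul_conj_kernel hEr (kernel_mem_hardySpace hE hEr x) x, normSq,
    ← integral_complex_ofReal]
  simp only [Complex.mul_conj, Complex.normSq_eq_norm_sq]

theorem kernel_ne_zero (hE : HermiteBiehler E) {x : ℝ} (hEx : E x ≠ 0) : kernel E x ≠ 0 := by
  intro hzero
  have hmem : (x : ℂ) + Complex.I ∈ upperHalf := by simp [upperHalf]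
  have hker := congrFun hzero ((x : ℂ) + Complex.I)
  rw [kernel_ofReal_of_ne E (by simp), Pi.zero_apply,
    div_eq_zero_iff, or_iff_left (by simp [Real.pi_ne_zero]), kernelNum, Complex.conj_ofReal,
    sub_eq_zero] at hker
  have hnorm := congrArg norm hker
  rw [norm_mul, norm_mul, RCLike.norm_conj] at hnorm
  exact (hE.norm_sharp_lt hmem).ne' (mul_left_cancel₀ (norm_ne_zero_iff.2 hEx) hnorm)

theorem kernel_self_re_pos (hE : HermiteBiehler E) (hEr : NoRealZeros E) (x : ℝ) :
    0 < (kernel E x x).re := by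
  rw [kernel_self_eq_normSq hE hEr, Complex.ofReal_re]
  refine (integral_nonneg fun _ => by positivity : 0 ≤ normSq E _).lt_of_ne' fun hnorm => ?_
  have hae : (fun t : ℝ => ‖kernel E x t / E t‖ ^ 2) =ᵐ[volume] 0 :=
    (integral_eq_zero_iff_of_nonneg (fun _ => by positivity)
      (kernel_mem_space hE hEr x).2.1).1 hnorm
  refine kernel_ne_zero hE (hEr x)
    (eq_zero_of_ofReal_eq_zero (differentiable_kernel hE.1 x) fun y => ?_)
  rw [← integral_mul_conj_kernel hEr (kernel_mem_hardySpace hE hEr x) y]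
  refine integral_eq_zero_of_ae (hae.mono fun t ht => ?_)
  have hquot : kernel E x t / E t = 0 := by simpa using ht
  simp [hquot]

theorem deriv_kernelNum (hE : Differentiable ℂ E) (x : ℝ) :
    deriv (kernelNum E x) x = 2 * (conj (E x) * deriv E x).im * Complex.I := by
  have hsharp := hasDerivAt_sharp hE (x : ℂ)
  rw [Complex.conj_ofReal] at hsharp
  have hnum : HasDerivAt (kernelNum E x)
      (conj (E x) * deriv E x - E x * conj (deriv E x)) x := by
    refine (((hE x).hasDerivAt.const_mul (conj (E x))).sub
      (hsharp.const_mul (E x))).congr_of_eventuallyEq (Eventually.of_forall fun z => ?_)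
    simp [kernelNum]
  have hsub := Complex.sub_conj (conj (E x) * deriv E x)
  rw [map_mul, Complex.conj_conj] at hsub
  rw [hnum.deriv, hsub]
  push_cast
  ring

theorem kernel_self_re_eq_im (hE : Differentiable ℂ E) (x : ℝ) :
    (kernel E x x).re = -(conj (E x) * deriv E x).im / Real.pi := by
  have hker : kernel E x x = ((-(conj (E x) * deriv E x).im / Real.pi : ℝ) : ℂ) := by
    rw [kernel, Complex.conj_ofReal, if_pos rfl, deriv_kernelNum hE]
    push_cast
    field_simp
  rw [hker, Complex.ofReal_re]

theorem IsPhase.conj_mul_eq {φ : ℝ → ℝ} (hφ : IsPhase E φ) (x t : ℝ) :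
    conj (E x) * E t = ((‖E x‖ * ‖E t‖ : ℝ) : ℂ) *
      (Complex.cos (φ x - φ t : ℝ) + Complex.sin (φ x - φ t : ℝ) * Complex.I) := by
  have hconj : conj (Complex.exp (-Complex.I * φ x)) = Complex.exp (Complex.I * φ x) := by
    rw [← Complex.exp_conj]
    simp
  have hadd : Complex.exp ((φ x - φ t : ℝ) * Complex.I) =
      Complex.exp (Complex.I * φ x) * Complex.exp (-Complex.I * φ t) := by
    rw [← Complex.exp_add]
    congr 1
    push_cast
    ring
  rw [← Complex.exp_mul_I, hadd]
  conv_lhs => rw [hφ.2.2 t, hφ.2.2 x]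
  rw [map_mul, hconj, Complex.conj_ofReal]
  push_cast
  ring

theorem IsPhase.eventuallyEq_sub_log (hEr : NoRealZeros E) {φ : ℝ → ℝ} (hφ : IsPhase E φ) (x : ℝ) :
    φ =ᶠ[𝓝 x] fun t => φ x - (Complex.log (conj (E x) * E t)).im := by
  filter_upwards [(hφ.1.tendsto x).eventually (ball_mem_nhds (φ x) Real.pi_pos)] with t ht
  rw [Real.dist_eq] at ht
  obtain ⟨hlo, hhi⟩ := abs_lt.1 ht
  rw [Complex.log_im, hφ.conj_mul_eq x t, Complex.arg_mul_cos_add_sin_mul_I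
    (mul_pos (norm_pos_iff.2 (hEr x)) (norm_pos_iff.2 (hEr t))) ⟨by linarith, by linarith⟩]
  ring

theorem kernel_self_re_eq_deriv_phase (hE : Differentiable ℂ E) (hEr : NoRealZeros E)
    {φ : ℝ → ℝ} (hφ : IsPhase E φ) (x : ℝ) :
    (kernel E x x).re = deriv φ x * ‖E x‖ ^ 2 / Real.pi := by
  have hEx : 0 < ‖E x‖ := norm_pos_iff.2 (hEr x)
  have hself : conj (E x) * E x = ((‖E x‖ ^ 2 : ℝ) : ℂ) := by
    rw [mul_comm, Complex.mul_conj, Complex.normSq_eq_norm_sq]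
  have hslit : conj (E x) * E x ∈ Complex.slitPlane := by
    rw [hself, Complex.ofReal_mem_slitPlane]
    positivity
  have hlog : HasDerivAt (fun t : ℝ => (Complex.log (conj (E x) * E t)).im)
      ((conj (E x) * deriv E x) / (conj (E x) * E x)).im x :=
    Complex.imCLM.hasFDerivAt.comp_hasDerivAt x
      ((((hE x).hasDerivAt.comp_ofReal).const_mul _).clog_real hslit)
  have hderiv : deriv φ x = -((conj (E x) * deriv E x) / (conj (E x) * E x)).im := by
    rw [(hφ.eventuallyEq_sub_log hEr x).deriv_eq]
    exact (hlog.const_sub (φ x)).deriv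
  rw [hderiv, kernel_self_re_eq_im hE, hself, Complex.div_ofReal_im]
  field_simp

theorem kernel_mul_self_re (hE : Differentiable ℂ E) (hF : Differentiable ℂ F)
    (x : ℝ) : (kernel (fun z => E z * F z) x x).re =
      ‖F x‖ ^ 2 * (kernel E x x).re + ‖E x‖ ^ 2 * (kernel F x x).re := by
  have hderiv : deriv (fun z => E z * F z) x = deriv E x * F x + E x * deriv F x :=
    ((hE x).hasDerivAt.mul (hF x).hasDerivAt).deriv
  have hsplit : conj (E x * F x) * deriv (fun z => E z * F z) x =
      ((‖F x‖ ^ 2 : ℝ) : ℂ) * (conj (E x) * deriv E x) +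
        ((‖E x‖ ^ 2 : ℝ) : ℂ) * (conj (F x) * deriv F x) := by
    rw [hderiv, ← Complex.normSq_eq_norm_sq, ← Complex.normSq_eq_norm_sq, ← Complex.mul_conj,
      ← Complex.mul_conj, map_mul]
    ring
  have hEF : Differentiable ℂ fun z => E z * F z := hE.mul hF
  rw [kernel_self_re_eq_im hEF, kernel_self_re_eq_im hE, kernel_self_re_eq_im hF, hsplit,
    Complex.add_im, Complex.im_ofReal_mul, Complex.im_ofReal_mul]
  ring

theorem kernel_mul_self_re_le (hE : Differentiable ℂ E) (hF : Differentiable ℂ F)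
    (hEr : NoRealZeros E) (hFr : NoRealZeros F) {φE φF : ℝ → ℝ} (hφE : IsPhase E φE)
    (hφF : IsPhase F φF) {C x : ℝ} (h : deriv φF x ≤ C * deriv φE x) :
    (kernel (fun z => E z * F z) x x).re ≤ (1 + C) * (‖F x‖ ^ 2 * (kernel E x x).re) := by
  rw [kernel_mul_self_re hE hF, kernel_self_re_eq_deriv_phase hE hEr hφE,
    kernel_self_re_eq_deriv_phase hF hFr hφF, add_mul, one_mul]
  refine add_le_add le_rfl ?_
  calc _ = deriv φF x * (‖E x‖ ^ 2 * ‖F x‖ ^ 2 / Real.pi) := by ring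
    _ ≤ C * deriv φE x * (‖E x‖ ^ 2 * ‖F x‖ ^ 2 / Real.pi) := by gcongr
    _ = _ := by ring

end Kernel

section Orthonormal

variable {𝕜 H ι : Type*} [RCLike 𝕜] [NormedAddCommGroup H] [InnerProductSpace 𝕜 H] {e : ι → H}

theorem mem_orthogonal_span_range_iff {u : H} :
    u ∈ (Submodule.span 𝕜 (range e))ᗮ ↔ ∀ i, inner 𝕜 (e i) u = 0 := by
  refine ⟨fun hu i => hu _ (Submodule.subset_span (mem_range_self i)), fun hu v hv => ?_⟩
  induction hv using Submodule.span_induction with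
  | mem v hv => obtain ⟨i, rfl⟩ := hv; exact hu i
  | zero => exact inner_zero_left u
  | add v w _ _ hv hw => rw [inner_add_left, hv, hw, add_zero]
  | smul c v _ hv => rw [inner_smul_left, hv, mul_zero]

theorem exists_norm_starProjection_le {M D : Submodule 𝕜 H} [M.HasOrthogonalProjection]
    [FiniteDimensional 𝕜 D] (hMD : Disjoint M D) :
    ∃ k : ℝ, 0 ≤ k ∧ k < 1 ∧ ∀ r ∈ D, ‖M.starProjection r‖ ≤ k * ‖r‖ := by
  have hker : (Mᗮ.starProjection.toLinearMap ∘ₗ D.subtype).ker = ⊥ := by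
    refine (Submodule.eq_bot_iff _).2 fun r hr => ?_
    have hrM : (r : H) ∈ Mᗮᗮ := (Submodule.starProjection_apply_eq_zero_iff _).1 hr
    rw [Submodule.orthogonal_orthogonal] at hrM
    exact Subtype.ext (Submodule.disjoint_def.1 hMD r hrM r.2)
  obtain ⟨K, hK, hanti⟩ := LinearMap.exists_antilipschitzWith _ hker
  have hK' : 0 < ((K : ℝ) ^ 2)⁻¹ := by positivity
  refine ⟨√(1 - ((K : ℝ) ^ 2)⁻¹), Real.sqrt_nonneg _,
    (Real.sqrt_lt' one_pos).2 (by linarith), fun r hr => ?_⟩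
  have hle : ‖r‖ ≤ K * ‖Mᗮ.starProjection r‖ :=
    ZeroHomClass.bound_of_antilipschitz _ hanti (⟨r, hr⟩ : D)
  have hsq : ((K : ℝ) ^ 2)⁻¹ * ‖r‖ ^ 2 ≤ ‖Mᗮ.starProjection r‖ ^ 2 := by
    rw [inv_mul_le_iff₀ (by positivity), ← mul_pow]
    gcongr
  calc ‖M.starProjection r‖ ≤ √((1 - ((K : ℝ) ^ 2)⁻¹) * ‖r‖ ^ 2) :=
        Real.le_sqrt_of_sq_le (by linarith [M.norm_sq_eq_add_norm_sq_starProjection r])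
    _ = _ := by rw [Real.sqrt_mul' _ (sq_nonneg _), Real.sqrt_sq (norm_nonneg r)]

variable [CompleteSpace H]

theorem tsum_sq_norm_inner_eq_sq_norm_starProjection (he : Orthonormal 𝕜 e) (u : H) :
    ∑' i, ‖inner 𝕜 (e i) u‖ ^ 2 =
      ‖(Submodule.span 𝕜 (range e)).topologicalClosure.starProjection u‖ ^ 2 := by
  set W := (Submodule.span 𝕜 (range e)).topologicalClosure
  have heW (i : ι) : e i ∈ W :=
    Submodule.le_topologicalClosure _ (Submodule.subset_span (mem_range_self i))
  have hbot : (Submodule.span 𝕜 (range fun i => (⟨e i, heW i⟩ : W)))ᗮ = ⊥ := by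
    refine (Submodule.eq_bot_iff _).2 fun w hw => Subtype.ext ?_
    have hw' : (w : H) ∈ Wᗮ := by
      rw [Submodule.orthogonal_closure]
      exact mem_orthogonal_span_range_iff.2 fun i => mem_orthogonal_span_range_iff.1 hw i
    exact inner_self_eq_zero.1 (Submodule.inner_right_of_mem_orthogonal w.2 hw')
  let b := HilbertBasis.mkOfOrthogonalEqBot (he.codRestrict W heW) hbot
  have hb (i : ι) : inner 𝕜 (b i) (W.orthogonalProjectionOnto u) = inner 𝕜 (e i) u := by
    rw [show b i = ⟨e i, heW i⟩ from
      congrFun (HilbertBasis.coe_mkOfOrthogonalEqBot (he.codRestrict W heW) hbot) i]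
    exact Submodule.inner_orthogonalProjectionOnto_eq_of_mem_left _ _
  have hsum := b.hasSum_inner_mul_inner (W.orthogonalProjectionOnto u)
    (W.orthogonalProjectionOnto u)
  simp only [← inner_conj_symm _ (b _), hb, RCLike.conj_mul, inner_self_eq_norm_sq_to_K] at hsum
  exact ((RCLike.hasSum_ofReal 𝕜).1 (mod_cast hsum)).tsum_eq

-- If `r` is the component of `u ∈ M` orthogonal to all `e i`, then `‖r‖² = ⟪P r, u⟫`, where the
-- projection `P` onto `M` is a strict contraction on the finite-dimensional space containing `r`.
theorem exists_le_tsum_sq_norm_inner (he : Orthonormal 𝕜 e) {M N : Submodule 𝕜 H}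
    (hM : IsClosed (M : Set H)) (hN : IsClosed (N : Set H)) (hMN : M ≤ N) (heN : ∀ i, e i ∈ N)
    [FiniteDimensional 𝕜 ↥(N ⊓ (Submodule.span 𝕜 (range e))ᗮ)]
    (hdisj : Disjoint M (Submodule.span 𝕜 (range e))ᗮ) :
    ∃ δ : ℝ, 0 < δ ∧ ∀ u ∈ M, δ * ‖u‖ ^ 2 ≤ ∑' i, ‖inner 𝕜 (e i) u‖ ^ 2 := by
  have : CompleteSpace M := hM.completeSpace_coe
  set W := (Submodule.span 𝕜 (range e)).topologicalClosure with hW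
  have hWN : W ≤ N :=
    Submodule.topologicalClosure_minimal _ (Submodule.span_le.2 (range_subset_iff.2 heN)) hN
  obtain ⟨k, hk, hk_lt, hproj⟩ := exists_norm_starProjection_le (hdisj.mono_right inf_le_right :
    Disjoint M (N ⊓ (Submodule.span 𝕜 (range e))ᗮ))
  refine ⟨1 - k ^ 2, by nlinarith, fun u hu => ?_⟩
  rw [tsum_sq_norm_inner_eq_sq_norm_starProjection he]
  set r := Wᗮ.starProjection u with hr
  have hrW : r ∈ Wᗮ := Wᗮ.starProjection_apply_mem u
  have hrN : r ∈ N := by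
    rw [hr, W.starProjection_orthogonal_val]
    exact N.sub_mem (hMN hu) (hWN (W.starProjection_apply_mem u))
  have hinner : inner 𝕜 (M.starProjection r) u = (‖r‖ : 𝕜) ^ 2 := by
    rw [M.inner_starProjection_left_eq_right, Submodule.starProjection_eq_self_iff.2 hu,
      ← Submodule.starProjection_eq_self_iff.2 hrW, Submodule.inner_starProjection_left_eq_right,
      Submodule.starProjection_eq_self_iff.2 hrW, inner_self_eq_norm_sq_to_K]
  have hmul : ‖r‖ * ‖r‖ ≤ k * ‖u‖ * ‖r‖ :=
    calc ‖r‖ * ‖r‖ = ‖inner 𝕜 (M.starProjection r) u‖ := by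
          rw [hinner, norm_pow, RCLike.norm_ofReal, abs_norm, sq]
      _ ≤ ‖M.starProjection r‖ * ‖u‖ := norm_inner_le_norm _ _
      _ ≤ k * ‖r‖ * ‖u‖ := by
          gcongr
          exact hproj r ⟨hrN, by rwa [hW, Submodule.orthogonal_closure] at hrW⟩
      _ = _ := by ring
  have hle : ‖r‖ ≤ k * ‖u‖ := by
    rcases (norm_nonneg r).eq_or_lt with hzero | hpos
    · rw [← hzero]; positivity
    · exact le_of_mul_le_mul_right hmul hpos
  have hsq : ‖r‖ ^ 2 ≤ k ^ 2 * ‖u‖ ^ 2 := by rw [← mul_pow]; gcongr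
  linarith [W.norm_sq_eq_add_norm_sq_starProjection u]

end Orthonormal

section EntireGrowth

theorem norm_sq_sub_sq_of_norm_eq {z : ℂ} {R : ℝ} (hz : ‖z‖ = R) :
    ‖z ^ 2 - (R : ℂ) ^ 2‖ = 2 * R * |z.im| := by
  have hfactor : z ^ 2 - (R : ℂ) ^ 2 = z * (z - conj z) := by
    rw [← hz, ← Complex.mul_conj']
    ring
  rw [hfactor, norm_mul, Complex.sub_conj, norm_mul, Complex.norm_I, mul_one, Complex.norm_real,
    Real.norm_eq_abs, abs_mul, abs_two, hz]
  ring

theorem norm_mul_norm_sq_sub_sq_pow_le {f : ℂ → ℂ} (hf : Differentiable ℂ f) {R M : ℝ}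
    (hR : 0 < R) {k : ℕ} (h : ∀ z, ‖z‖ = R → ‖f z‖ * |z.im| ^ k ≤ M) {z : ℂ} (hz : ‖z‖ ≤ R) :
    ‖f z‖ * ‖z ^ 2 - (R : ℂ) ^ 2‖ ^ k ≤ M * (2 * R) ^ k := by
  have hmax : ‖f z * (z ^ 2 - R ^ 2) ^ k‖ ≤ M * (2 * R) ^ k := by
    refine norm_le_on_closedBall_of_norm_le_on_sphere hR
      (f := fun z => f z * (z ^ 2 - R ^ 2) ^ k) (by fun_prop) (fun y hy => ?_) (by simpa using hz)
    have hyR : ‖y‖ = R := by simpa using hy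
    rw [norm_mul, norm_pow, norm_sq_sub_sq_of_norm_eq hyR, mul_pow, mul_comm (_ ^ k), ← mul_assoc]
    gcongr
    exact h y hyR
  rwa [norm_mul, norm_pow] at hmax

theorem norm_mul_abs_im_pow_le {f : ℂ → ℂ} {R M : ℝ} {k : ℕ} (hk : k ≠ 0) (hM : 0 ≤ M)
    (hup : ∀ z ∈ upperHalf, ‖z‖ = R → ‖f z‖ * z.im ^ k ≤ M)
    (hlow : ∀ z ∈ upperHalf, ‖z‖ = R → ‖sharp f z‖ * z.im ^ k ≤ M) {z : ℂ} (hz : ‖z‖ = R) :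
    ‖f z‖ * |z.im| ^ k ≤ M := by
  rcases lt_trichotomy z.im 0 with him | him | him
  · have hconj := hlow (conj z) (by simpa [upperHalf] using him) (by simpa using hz)
    rwa [sharp_conj, RCLike.norm_conj, Complex.conj_im, ← abs_of_neg him] at hconj
  · rwa [him, abs_zero, zero_pow hk, mul_zero]
  · rw [abs_of_pos him]
    exact hup z him hz

-- The maximum principle is applied to `f(z) (z² - R²)ᵏ`: on the circle `‖z‖ = R` the second factor
-- has modulus `(2 R |Im z|)ᵏ`, which compensates for the blow-up of the bound near the real axis.
theorem norm_le_of_norm_mul_im_pow_le {f : ℂ → ℂ} (hf : Differentiable ℂ f) {R M : ℝ} (hR : 0 < R)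
    {k : ℕ} (hk : k ≠ 0) (hup : ∀ z ∈ upperHalf, ‖z‖ = R → ‖f z‖ * z.im ^ k ≤ M)
    (hlow : ∀ z ∈ upperHalf, ‖z‖ = R → ‖sharp f z‖ * z.im ^ k ≤ M) {z : ℂ} (hz : ‖z‖ ≤ R / 2) :
    ‖f z‖ ≤ M * (3 / R) ^ k := by
  have hM : 0 ≤ M := by
    refine le_trans ?_ (hup (R * Complex.I) (by simpa [upperHalf] using hR) (by simp [hR.le]))
    simp only [Complex.mul_I_im, Complex.ofReal_re]
    positivity
  have hmax := norm_mul_norm_sq_sub_sq_pow_le hf hR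
    (fun y hy => norm_mul_abs_im_pow_le hk hM hup hlow hy) (z := z) (by linarith)
  have hfar : 3 * R ^ 2 / 4 ≤ ‖z ^ 2 - (R : ℂ) ^ 2‖ := by
    have htriangle := norm_sub_norm_le ((R : ℂ) ^ 2) (z ^ 2)
    rw [norm_sub_rev, norm_pow, norm_pow, Complex.norm_real, Real.norm_eq_abs, sq_abs] at htriangle
    nlinarith [norm_nonneg z]
  refine le_of_mul_le_mul_right (a := (3 * R ^ 2 / 4) ^ k) ?_ (by positivity)
  calc ‖f z‖ * (3 * R ^ 2 / 4) ^ k ≤ ‖f z‖ * ‖z ^ 2 - (R : ℂ) ^ 2‖ ^ k := by gcongr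
    _ ≤ M * (2 * R) ^ k := hmax
    _ ≤ M * (3 / R * (3 * R ^ 2 / 4)) ^ k := by
        have hconst : 2 * R ≤ 3 / R * (3 * R ^ 2 / 4) := by
          field_simp
          linarith
        gcongr
    _ = M * (3 / R) ^ k * (3 * R ^ 2 / 4) ^ k := by rw [mul_pow, mul_assoc]

theorem norm_deriv_le_of_norm_le {f : ℂ → ℂ} (hf : Differentiable ℂ f) {b : ℝ → ℝ}
    (hb : Monotone b) (h : ∀ z, ‖f z‖ ≤ b ‖z‖) (z : ℂ) {R : ℝ} (hR : 0 < R) :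
    ‖deriv f z‖ ≤ b (‖z‖ + R) / R := by
  refine Complex.norm_deriv_le_of_forall_mem_sphere_norm_le hR hf.diffContOnCl fun w hw => ?_
  refine (h w).trans (hb ?_)
  rw [← mem_sphere_iff_norm.1 hw]
  exact norm_le_norm_add_norm_sub' w z

theorem exists_affine_of_linear_growth {f : ℂ → ℂ} (hf : Differentiable ℂ f) {M : ℝ}
    (h : ∀ z, ‖f z‖ ≤ M * (1 + ‖z‖)) : ∃ a b : ℂ, ∀ z, f z = a + b * z := by
  have hM : 0 ≤ M := by simpa using (norm_nonneg _).trans (h 0)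
  have hderiv : ∀ z, ‖deriv f z‖ ≤ 2 * M := fun z => by
    have hR : 0 < 1 + ‖z‖ := by positivity
    refine (norm_deriv_le_of_norm_le hf (b := fun r => M * (1 + r))
      (fun r s hrs => by dsimp only; gcongr) h z hR).trans (le_of_eq ?_)
    field_simp
    ring
  have hconst : ∀ z, deriv f z = deriv f 0 := fun z =>
    hf.deriv.apply_eq_apply_of_bounded
      (isBounded_iff_forall_norm_le.2 ⟨2 * M, forall_mem_range.2 hderiv⟩) z 0
  refine ⟨f 0, deriv f 0, fun z => ?_⟩
  have hline : ∀ w, HasDerivAt (fun w => f w - deriv f 0 * w) 0 w := fun w =>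
    ((hf w).hasDerivAt.fun_sub ((hasDerivAt_id' w).const_mul (deriv f 0))).congr_deriv
      (by rw [hconst w, mul_one, sub_self])
  have hsame := is_const_of_deriv_eq_zero (fun w => (hline w).differentiableAt)
    (fun w => (hline w).deriv) z 0
  simp only [mul_zero, sub_zero] at hsame
  rw [← hsame, sub_add_cancel]

theorem exists_const_of_sqrt_growth {f : ℂ → ℂ} (hf : Differentiable ℂ f) {M : ℝ}
    (h : ∀ z, ‖f z‖ ^ 2 ≤ M * (1 + ‖z‖)) : ∃ a : ℂ, ∀ z, f z = a := by
  have hM : 0 ≤ M := by simpa using (sq_nonneg _).trans (h 0)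
  have hderiv : ∀ z, deriv f z = 0 := fun z => by
    have hle : ‖deriv f z‖ ^ 2 ≤ 0 := by
      refine ge_of_tendsto (tendsto_const_nhds.div_atTop tendsto_id : Tendsto (fun R : ℝ =>
        2 * M / R) atTop (𝓝 0)) ?_
      filter_upwards [eventually_ge_atTop (1 + ‖z‖)] with R hR
      have hR0 : 0 < R := (by positivity : 0 < 1 + ‖z‖).trans_le hR
      have hcauchy := norm_deriv_le_of_norm_le hf (b := fun r => √(M * (1 + r)))
        (fun r s hrs => by dsimp only; gcongr) (fun z => Real.le_sqrt_of_sq_le (h z)) z hR0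
      calc ‖deriv f z‖ ^ 2 ≤ (√(M * (1 + (‖z‖ + R))) / R) ^ 2 := by gcongr
        _ = M * (1 + ‖z‖ + R) / R ^ 2 := by
            rw [div_pow, Real.sq_sqrt (by positivity), add_assoc]
        _ ≤ M * (R + R) / R ^ 2 := by gcongr
        _ = 2 * M / R := by field_simp; ring
    simpa using hle
  exact ⟨f 0, fun z => is_const_of_deriv_eq_zero hf hderiv z 0⟩

theorem exists_affine_of_norm_mul_im_le {h : ℂ → ℂ} (hh : Differentiable ℂ h) {K : ℝ}
    (hup : ∀ z ∈ upperHalf, ‖h z‖ * z.im ≤ K * (‖z‖ ^ 2 + 1))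
    (hlow : ∀ z ∈ upperHalf, ‖sharp h z‖ * z.im ≤ K * (‖z‖ ^ 2 + 1)) :
    ∃ a b : ℂ, ∀ z, h z = a + b * z := by
  have hK : 0 ≤ K := nonneg_of_mul_nonneg_left
    ((by positivity : 0 ≤ ‖h Complex.I‖ * 1).trans
      (by simpa using hup Complex.I (by simp [upperHalf]))) (by norm_num : (0 : ℝ) < 1 + 1)
  refine exists_affine_of_linear_growth hh (M := 12 * K) fun z => ?_
  set R := 2 * (1 + ‖z‖) with hR
  have hR1 : 1 ≤ R := by linarith [norm_nonneg z]
  have hcirc := norm_le_of_norm_mul_im_pow_le hh (zero_lt_one.trans_le hR1) one_ne_zero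
    (M := K * (R ^ 2 + 1)) (fun y hy hyR => by simpa [hyR] using hup y hy)
    (fun y hy hyR => by simpa [hyR] using hlow y hy) (z := z) (by linarith)
  calc ‖h z‖ ≤ K * (R ^ 2 + 1) * (3 / R) ^ 1 := hcirc
    _ ≤ K * (R ^ 2 + R ^ 2) * (3 / R) ^ 1 := by gcongr; nlinarith
    _ = 6 * K * R := by field_simp; ring
    _ = 12 * K * (1 + ‖z‖) := by rw [hR]; ring

theorem exists_affine_of_re_nonneg {h : ℂ → ℂ} (hh : Differentiable ℂ h)
    (hup : ∀ z ∈ upperHalf, 0 ≤ (h z).re) (hlow : ∀ z ∈ upperHalf, (h (conj z)).re ≤ 0) :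
    ∃ a b : ℂ, ∀ z, h z = a + b * z := by
  obtain ⟨C, hC, hgrowth⟩ := exists_norm_le_of_re_nonneg (a := Complex.I) (by simp [upperHalf])
  have hbound : ∀ {g : ℂ → ℂ}, DifferentiableOn ℂ g upperHalf → (∀ z ∈ upperHalf, 0 ≤ (g z).re) →
      ‖g Complex.I‖ ≤ ‖h Complex.I‖ + ‖sharp h Complex.I‖ → ∀ z ∈ upperHalf,
      ‖g z‖ * z.im ≤ C * (‖h Complex.I‖ + ‖sharp h Complex.I‖) * (‖z‖ ^ 2 + 1) := by
    intro g hg hg0 hgI z hz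
    have hz' : 0 < z.im := hz
    rw [← le_div_iff₀ hz']
    calc ‖g z‖ ≤ C * (‖z‖ ^ 2 + 1) / z.im * ‖g Complex.I‖ := hgrowth g hg hg0 z hz
      _ ≤ C * (‖z‖ ^ 2 + 1) / z.im * (‖h Complex.I‖ + ‖sharp h Complex.I‖) := by gcongr
      _ = _ := by ring
  refine exists_affine_of_norm_mul_im_le hh
    (hbound hh.differentiableOn hup (le_add_of_nonneg_right (norm_nonneg _))) fun z hz => ?_
  rw [← norm_neg]
  exact hbound (g := fun z => -sharp h z) (differentiable_sharp hh).neg.differentiableOn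
    (fun z hz => by simpa [sharp] using hlow z hz)
    (by rw [norm_neg]; exact le_add_of_nonneg_left (norm_nonneg _)) z hz

theorem exists_exp_eq {f : ℂ → ℂ} (hf : Differentiable ℂ f) (hf0 : ∀ z, f z ≠ 0) :
    ∃ h : ℂ → ℂ, Differentiable ℂ h ∧ ∀ z, f z = Complex.exp (h z) := by
  obtain ⟨g, hg⟩ := (hf.deriv.div hf hf0).isExactOn_univ
  have hg' : ∀ z, HasDerivAt g (deriv f z / f z) z := fun z => by simpa using hg z (mem_univ z)
  have hquot : ∀ z, HasDerivAt (fun z => f z * Complex.exp (-g z)) 0 z := fun z => by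
    refine ((hf z).hasDerivAt.mul (hg' z).neg.cexp).congr_deriv ?_
    have := hf0 z
    simp only [Pi.neg_apply]
    field_simp
    ring
  have hconst : ∀ z, f z * Complex.exp (-g z) = f 0 * Complex.exp (-g 0) := fun z =>
    is_const_of_deriv_eq_zero (fun z => (hquot z).differentiableAt) (fun z => (hquot z).deriv) z 0
  refine ⟨fun z => Complex.log (f 0 * Complex.exp (-g 0)) + g z,
    fun z => ((hg' z).const_add _).differentiableAt, fun z => ?_⟩
  rw [Complex.exp_add, Complex.exp_log (mul_ne_zero (hf0 0) (Complex.exp_ne_zero _)), ← hconst z,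
    mul_assoc, ← Complex.exp_add, neg_add_cancel, Complex.exp_zero, mul_one]

end EntireGrowth

section HardySubmodule

theorem sq_norm_eq_integral_sq_norm {α 𝕜 : Type*} [MeasurableSpace α] {μ : Measure α} [RCLike 𝕜]
    (u : Lp 𝕜 2 μ) : ‖u‖ ^ 2 = ∫ t, ‖u t‖ ^ 2 ∂μ := by
  have hinner : inner 𝕜 u u = ∫ t, ((‖u t‖ ^ 2 : ℝ) : 𝕜) ∂μ := by
    rw [L2.inner_def]
    simp only [inner_self_eq_norm_sq_to_K, RCLike.ofReal_pow]
  rw [integral_ofReal, inner_self_eq_norm_sq_to_K] at hinner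
  exact_mod_cast hinner

theorem exists_entire_tendsto {f : ℕ → ℂ → ℂ} (hf : ∀ n, Differentiable ℂ (f n))
    (hunif : ∀ R, 0 < R → UniformCauchySeqOn f atTop (closedBall 0 R)) :
    ∃ g : ℂ → ℂ, Differentiable ℂ g ∧ ∀ z, Tendsto (fun n => f n z) atTop (𝓝 (g z)) := by
  have hlim : ∀ z, ∃ y, Tendsto (fun n => f n z) atTop (𝓝 y) := fun z =>
    cauchySeq_tendsto_of_complete ((hunif (‖z‖ + 1) (by positivity)).cauchySeq (by simp))
  choose g hg using hlim
  have hloc : TendstoLocallyUniformlyOn f g atTop univ := by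
    rw [tendstoLocallyUniformlyOn_iff_forall_isCompact isOpen_univ]
    intro K _ hK
    obtain ⟨R, hR, hKR⟩ := hK.isBounded.subset_closedBall_lt 0 (0 : ℂ)
    exact ((hunif R hR).tendstoUniformlyOn_of_tendsto fun z _ => hg z).mono hKR
  exact ⟨g, differentiableOn_univ.1
    (hloc.differentiableOn (Eventually.of_forall fun n => (hf n).differentiableOn) isOpen_univ), hg⟩

theorem isHardy_zero : IsHardy fun _ => 0 :=
  ⟨fun _ _ => analyticAt_const, MemLp.zero', 0, fun z _ => by simp⟩

theorem IsHardy.add {f g : ℂ → ℂ} (hf : IsHardy f) (hg : IsHardy g) :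
    IsHardy fun z => f z + g z := by
  obtain ⟨K, hK⟩ := hf.bound
  obtain ⟨K', hK'⟩ := hg.bound
  refine ⟨fun z hz => (hf.analytic z hz).fun_add (hg.analytic z hz), hf.memLp.add hg.memLp,
    K + K', fun z hz => ?_⟩
  rw [add_mul]
  exact (norm_add_le _ _).trans (add_le_add (hK z hz) (hK' z hz))

theorem IsHardy.const_mul {f : ℂ → ℂ} (hf : IsHardy f) (c : ℂ) : IsHardy fun z => c * f z := by
  obtain ⟨K, hK⟩ := hf.bound
  refine ⟨fun z hz => analyticAt_const.fun_mul (hf.analytic z hz), hf.memLp.const_mul c,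
    ‖c‖ * K, fun z hz => ?_⟩
  rw [norm_mul, mul_assoc]
  exact mul_le_mul_of_nonneg_left (hK z hz) (norm_nonneg _)

theorem exists_norm_le_of_sq_norm_le {g : ℂ → ℂ} {N : ℝ}
    (h : ∀ z ∈ upperHalf, ‖g z‖ ^ 2 ≤ N / (4 * Real.pi * z.im)) :
    ∃ K : ℝ, ∀ z ∈ upperHalf, ‖g z‖ ≤ K * (1 + 1 / z.im) := by
  refine ⟨√(|N| / (4 * Real.pi)), fun z hz => ?_⟩
  have hz' : 0 < z.im := hz
  have hone := one_le_one_add_one_div hz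
  refine le_of_sq_le_sq ?_ (by positivity)
  rw [mul_pow, Real.sq_sqrt (by positivity)]
  calc ‖g z‖ ^ 2 ≤ |N| / (4 * Real.pi * z.im) := (h z hz).trans (by gcongr; exact le_abs_self N)
    _ = |N| / (4 * Real.pi) * (1 / z.im) := by field_simp
    _ ≤ |N| / (4 * Real.pi) * (1 + 1 / z.im) ^ 2 := by gcongr; nlinarith

theorem isHardy_of_tendsto {q : ℕ → ℂ → ℂ} {r : ℂ → ℂ} {N : ℝ} (hq : ∀ n, IsHardy (q n))
    (hN : ∀ n, ∫ t : ℝ, ‖q n t‖ ^ 2 ≤ N) (hr : AnalyticOnNhd ℂ r closedUpperHalf)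
    (hr2 : MemLp (fun t : ℝ => r t) 2)
    (hlim : ∀ z ∈ upperHalf, Tendsto (fun n => q n z) atTop (𝓝 (r z))) : IsHardy r := by
  refine ⟨hr, hr2, exists_norm_le_of_sq_norm_le (N := N) fun z hz => ?_⟩
  have hz' : 0 < z.im := hz
  refine le_of_tendsto' ((hlim z hz).norm.pow 2) fun n => ((hq n).sq_norm_le hz).trans ?_
  gcongr
  exact hN n

theorem sharp_sharp (f : ℂ → ℂ) : sharp (sharp f) = f := by
  ext z
  simp [sharp]

theorem sharp_add (f g : ℂ → ℂ) : sharp (fun z => f z + g z) = fun z => sharp f z + sharp g z := by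
  ext z
  simp [sharp]

theorem sharp_const_mul (c : ℂ) (f : ℂ → ℂ) :
    sharp (fun z => c * f z) = fun z => conj c * sharp f z := by
  ext z
  simp [sharp]

variable {E f g : ℂ → ℂ}

theorem sharp_mem_hardySpace (hf : f ∈ hardySpace E) : sharp f ∈ hardySpace E :=
  ⟨differentiable_sharp hf.1, hf.2.2, by rw [sharp_sharp]; exact hf.2.1⟩

theorem zero_mem_hardySpace (E : ℂ → ℂ) : (fun _ => 0) ∈ hardySpace E :=
  ⟨differentiable_const _, by simpa using isHardy_zero, by simpa [sharp] using isHardy_zero⟩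

theorem add_mem_hardySpace (hf : f ∈ hardySpace E) (hg : g ∈ hardySpace E) :
    (fun z => f z + g z) ∈ hardySpace E := by
  refine ⟨hf.1.add hg.1, ?_, ?_⟩
  · simpa only [add_div] using hf.2.1.add hg.2.1
  · simpa only [sharp_add, add_div] using hf.2.2.add hg.2.2

theorem const_mul_mem_hardySpace (hf : f ∈ hardySpace E) (c : ℂ) :
    (fun z => c * f z) ∈ hardySpace E := by
  refine ⟨hf.1.const_mul c, ?_, ?_⟩
  · simpa only [mul_div_assoc] using hf.2.1.const_mul c
  · simpa only [sharp_const_mul, mul_div_assoc] using hf.2.2.const_mul (conj c)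

theorem sub_mem_hardySpace (hf : f ∈ hardySpace E) (hg : g ∈ hardySpace E) :
    (fun z => f z - g z) ∈ hardySpace E := by
  simpa only [neg_one_mul, ← sub_eq_add_neg] using
    add_mem_hardySpace hf (const_mul_mem_hardySpace hg (-1))

theorem normSq_nonneg (E f : ℂ → ℂ) : 0 ≤ normSq E f := integral_nonneg fun _ => by positivity

theorem normSq_sharp (E f : ℂ → ℂ) : normSq E (sharp f) = normSq E f := by
  simp only [normSq, norm_div, norm_sharp_ofReal]

/-- The functions `f / E` with `f ∈ hardySpace E`, as a subspace of `L²(ℝ)`. This is the model of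
the de Branges space of `E` in which orthogonal projections are taken. -/
noncomputable def hardySubmodule (E : ℂ → ℂ) : Submodule ℂ (Lp ℂ 2 (volume : Measure ℝ)) where
  carrier := {u | ∃ f ∈ hardySpace E, u =ᵐ[volume] fun t : ℝ => f t / E t}
  add_mem' := by
    rintro u v ⟨f, hf, hu⟩ ⟨g, hg, hv⟩
    refine ⟨_, add_mem_hardySpace hf hg, ?_⟩
    filter_upwards [hu, hv, Lp.coeFn_add u v] with t hut hvt hadd
    rw [hadd, Pi.add_apply, hut, hvt, add_div]
  zero_mem' := by
    refine ⟨_, zero_mem_hardySpace E, ?_⟩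
    filter_upwards [Lp.coeFn_zero ℂ 2 (volume : Measure ℝ)] with t hzero
    rw [hzero, Pi.zero_apply, zero_div]
  smul_mem' := by
    rintro c u ⟨f, hf, hu⟩
    refine ⟨_, const_mul_mem_hardySpace hf c, ?_⟩
    filter_upwards [hu, Lp.coeFn_smul c u] with t hut hsmul
    rw [hsmul, Pi.smul_apply, hut, smul_eq_mul, mul_div_assoc]

theorem sq_norm_eq_normSq {u : Lp ℂ 2 (volume : Measure ℝ)}
    (hu : u =ᵐ[volume] fun t : ℝ => f t / E t) : ‖u‖ ^ 2 = normSq E f := by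
  rw [sq_norm_eq_integral_sq_norm, normSq]
  exact integral_congr_ae (hu.mono fun t ht => congrArg (‖·‖ ^ 2) ht)

theorem sq_norm_le_normSq_div (hE : HermiteBiehler E) (hEr : NoRealZeros E)
    (hf : f ∈ hardySpace E) {z : ℂ} (hz : z ∈ upperHalf) :
    ‖f z‖ ^ 2 ≤ normSq E f / (4 * Real.pi * z.im) * ‖E z‖ ^ 2 := by
  have hEz := norm_pos_iff.2 (hE.ne_zero hEr (upperHalf_subset_closedUpperHalf hz))
  rw [← div_le_iff₀ (by positivity), ← div_pow, ← norm_div]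
  exact hf.2.1.sq_norm_le hz

theorem sq_norm_mul_im_le (hE : HermiteBiehler E) (hEr : NoRealZeros E)
    (hf : f ∈ hardySpace E) {z : ℂ} (hz : z ∈ upperHalf) :
    (‖f z‖ * z.im) ^ 2 ≤ ‖z‖ * ‖E z‖ ^ 2 * normSq E f := by
  have hz' : 0 < z.im := hz
  have hN := normSq_nonneg E f
  have him : z.im ≤ ‖z‖ := (le_abs_self _).trans (Complex.abs_im_le_norm z)
  calc (‖f z‖ * z.im) ^ 2 = ‖f z‖ ^ 2 * z.im ^ 2 := mul_pow _ _ _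
    _ ≤ normSq E f / (4 * Real.pi * z.im) * ‖E z‖ ^ 2 * z.im ^ 2 := by
        gcongr
        exact sq_norm_le_normSq_div hE hEr hf hz
    _ = z.im * ‖E z‖ ^ 2 * normSq E f / (4 * Real.pi) := by field_simp
    _ ≤ z.im * ‖E z‖ ^ 2 * normSq E f :=
        div_le_self (by positivity) (by linarith [Real.pi_gt_three])
    _ ≤ ‖z‖ * ‖E z‖ ^ 2 * normSq E f := by gcongr

theorem exists_sq_norm_le (hE : HermiteBiehler E) (hEr : NoRealZeros E) {R : ℝ} (hR : 0 < R) :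
    ∃ C : ℝ, 0 ≤ C ∧ ∀ f ∈ hardySpace E, ∀ z : ℂ, ‖z‖ ≤ R → ‖f z‖ ^ 2 ≤ C * normSq E f := by
  obtain ⟨M, hM⟩ := (isCompact_closedBall (0 : ℂ) (2 * R)).exists_bound_of_continuousOn
    hE.1.continuous.continuousOn
  refine ⟨2 * R * M ^ 2 * (3 / (2 * R)) ^ 2, by positivity, fun f hf z hz => ?_⟩
  have hN := normSq_nonneg E f
  have hcirc : ∀ g ∈ hardySpace E, normSq E g = normSq E f → ∀ y ∈ upperHalf, ‖y‖ = 2 * R →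
      ‖g y‖ * y.im ^ 1 ≤ √(2 * R * M ^ 2 * normSq E f) := by
    intro g hg hgf y hy hyR
    have hEy : ‖E y‖ ≤ M := hM y (by simp [hyR])
    rw [pow_one]
    refine Real.le_sqrt_of_sq_le ((sq_norm_mul_im_le hE hEr hg hy).trans ?_)
    rw [hgf, hyR]
    gcongr
  have hle := norm_le_of_norm_mul_im_pow_le hf.1 (by positivity) one_ne_zero (hcirc f hf rfl)
    (hcirc (sharp f) (sharp_mem_hardySpace hf) (normSq_sharp E f)) (z := z) (by linarith)
  calc ‖f z‖ ^ 2 ≤ (√(2 * R * M ^ 2 * normSq E f) * (3 / (2 * R)) ^ 1) ^ 2 := by gcongr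
    _ = 2 * R * M ^ 2 * (3 / (2 * R)) ^ 2 * normSq E f := by
        rw [mul_pow, Real.sq_sqrt (by positivity)]
        ring

theorem uniformCauchySeqOn_of_cauchySeq (hE : HermiteBiehler E) (hEr : NoRealZeros E)
    {v : ℕ → Lp ℂ 2 (volume : Measure ℝ)} {f : ℕ → ℂ → ℂ} (hv : CauchySeq v)
    (hf : ∀ n, f n ∈ hardySpace E) (hfv : ∀ n, v n =ᵐ[volume] fun t : ℝ => f n t / E t) {R : ℝ}
    (hR : 0 < R) : UniformCauchySeqOn f atTop (closedBall 0 R) := by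
  obtain ⟨C, hC, hbound⟩ := exists_sq_norm_le hE hEr hR
  have hdist : ∀ m n, ∀ z ∈ closedBall (0 : ℂ) R, dist (f m z) (f n z) ≤ √C * dist (v m) (v n) := by
    intro m n z hz
    have hdiff : (v m - v n : Lp ℂ 2 (volume : Measure ℝ)) =ᵐ[volume]
        fun t : ℝ => (f m t - f n t) / E t := by
      filter_upwards [hfv m, hfv n, Lp.coeFn_sub (v m) (v n)] with t hm hn hsub
      rw [hsub, Pi.sub_apply, hm, hn, sub_div]
    have hsq := hbound _ (sub_mem_hardySpace (hf m) (hf n)) z (by simpa using hz)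
    rw [← sq_norm_eq_normSq hdiff] at hsq
    rw [dist_eq_norm, dist_eq_norm]
    refine le_of_sq_le_sq ?_ (by positivity)
    rwa [mul_pow, Real.sq_sqrt hC]
  rw [Metric.uniformCauchySeqOn_iff]
  intro ε hε
  obtain ⟨n₀, hn₀⟩ := Metric.cauchySeq_iff.1 hv (ε / (√C + 1)) (by positivity)
  refine ⟨n₀, fun m hm n hn z hz => (hdist m n z hz).trans_lt ?_⟩
  calc √C * dist (v m) (v n) ≤ (√C + 1) * dist (v m) (v n) := by gcongr; linarith
    _ < (√C + 1) * (ε / (√C + 1)) := by gcongr; exact hn₀ m hm n hn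
    _ = ε := by field_simp

theorem ae_eq_of_tendsto_Lp {v : ℕ → Lp ℂ 2 (volume : Measure ℝ)}
    {u : Lp ℂ 2 (volume : Measure ℝ)} (hvu : Tendsto v atTop (𝓝 u)) {k : ℕ → ℝ → ℂ} {l : ℝ → ℂ}
    (hvk : ∀ n, v n =ᵐ[volume] k n) (hkl : ∀ t, Tendsto (fun n => k n t) atTop (𝓝 (l t))) :
    u =ᵐ[volume] l := by
  obtain ⟨φ, hφ, hsub⟩ := (tendstoInMeasure_of_tendsto_Lp hvu).exists_seq_tendsto_ae
  filter_upwards [hsub, ae_all_iff.2 hvk] with t ht hall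
  simp only [hall] at ht
  exact tendsto_nhds_unique ht ((hkl t).comp hφ.tendsto_atTop)

theorem isClosed_hardySubmodule (hE : HermiteBiehler E) (hEr : NoRealZeros E) :
    IsClosed (hardySubmodule E : Set (Lp ℂ 2 (volume : Measure ℝ))) := by
  refine IsSeqClosed.isClosed fun v u hv hvu => ?_
  choose f hf hfv using hv
  obtain ⟨g, hgd, hg⟩ := exists_entire_tendsto (fun n => (hf n).1) fun R hR =>
    uniformCauchySeqOn_of_cauchySeq hE hEr hvu.cauchySeq hf hfv hR
  have hu : u =ᵐ[volume] fun t : ℝ => g t / E t :=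
    ae_eq_of_tendsto_Lp hvu hfv fun t => (hg t).div_const _
  have hgL2 : MemLp (fun t : ℝ => g t / E t) 2 := (Lp.memLp u).ae_eq hu
  obtain ⟨N, hN⟩ := (hvu.norm.pow 2).bddAbove_range
  have hfN : ∀ n, normSq E (f n) ≤ N := fun n => by
    rw [← sq_norm_eq_normSq (hfv n)]
    exact hN (mem_range_self n)
  have hsharp := hE.analyticOnNhd_div hEr (differentiable_sharp hgd)
  refine ⟨g, ⟨hgd, isHardy_of_tendsto (fun n => (hf n).2.1) hfN (hE.analyticOnNhd_div hEr hgd) hgL2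
    fun z _ => (hg z).div_const _, isHardy_of_tendsto (fun n => (hf n).2.2)
    (fun n => (normSq_sharp E (f n)).trans_le (hfN n)) hsharp ?_ fun z _ => ?_⟩, hu⟩
  · refine hgL2.of_le (continuous_ofReal_of_analyticOnNhd hsharp).aestronglyMeasurable
      (Eventually.of_forall fun t => ?_)
    rw [norm_div, norm_div, norm_sharp_ofReal]
  · exact ((Complex.continuous_conj.tendsto _).comp (hg (conj z))).div_const _

end HardySubmodule

section AddSharp

theorem exists_entire_quotient {f A : ℂ → ℂ} (hf : Differentiable ℂ f) (hA : Differentiable ℂ A)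
    (h : ∀ z, A z = 0 → deriv A z ≠ 0 ∧ f z = 0) :
    ∃ D : ℂ → ℂ, Differentiable ℂ D ∧ ∀ z, f z = D z * A z := by
  classical
  refine ⟨fun z => if A z = 0 then deriv f z / deriv A z else f z / A z, fun a => ?_, fun z => ?_⟩
  · by_cases ha : A a = 0
    · obtain ⟨hderiv, hfa⟩ := h a ha
      have hfd := analyticAt_dslope (a := a) (hf.analyticAt a)
      have hAd := analyticAt_dslope (a := a) (hA.analyticAt a)
      have hAda : dslope A a a ≠ 0 := by rwa [dslope_same]
      refine (hfd.fun_div hAd hAda).differentiableAt.congr_of_eventuallyEq ?_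
      filter_upwards [hAd.continuousAt.eventually_ne hAda] with z hz
      rcases eq_or_ne z a with rfl | hza
      · simp only [if_pos ha, dslope_same]
      · rw [dslope_eq_div hza, ha, sub_zero] at hz
        rw [dslope_eq_div hza, dslope_eq_div hza, hfa, ha, sub_zero, sub_zero,
          if_neg (div_ne_zero_iff.1 hz).1, div_div_div_cancel_right₀ (sub_ne_zero.2 hza)]
    · refine ((hf a).fun_div (hA a) ha).congr_of_eventuallyEq ?_
      filter_upwards [(hA a).continuousAt.eventually_ne ha] with z hz
      rw [if_neg hz]
  · by_cases hz : A z = 0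
    · rw [hz, mul_zero, (h z hz).2]
    · simp only [if_neg hz, div_mul_cancel₀ _ hz]

variable {B f D : ℂ → ℂ}

theorem HermiteBiehler.im_eq_zero_of_add_sharp_eq_zero (hB : HermiteBiehler B) {z : ℂ}
    (hz : B z + sharp B z = 0) : z.im = 0 := by
  have hnorm : ‖B z‖ = ‖sharp B z‖ := by rw [eq_neg_of_add_eq_zero_left hz, norm_neg]
  rcases lt_trichotomy z.im 0 with hneg | hzero | hpos
  · have hlt := hB.2 (conj z) (by simpa using hneg)
    rw [Complex.conj_conj] at hlt
    rw [sharp, RCLike.norm_conj] at hnorm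
    exact absurd hnorm hlt.ne
  · exact hzero
  · exact absurd hnorm (hB.norm_sharp_lt hpos).ne'

theorem kernelNum_of_add_sharp_eq_zero {x : ℝ} (hx : B x + sharp B x = 0) :
    kernelNum B x = fun z => conj (B x) * (B z + sharp B z) := by
  ext z
  rw [sharp_ofReal] at hx
  rw [kernelNum, Complex.conj_ofReal]
  linear_combination (-sharp B z) * hx

theorem kernel_of_add_sharp_eq_zero {x y : ℝ} (hx : B x + sharp B x = 0)
    (hy : B y + sharp B y = 0) (hxy : y ≠ x) : kernel B x y = 0 := by
  rw [kernel_ofReal_of_ne B (by exact_mod_cast hxy), kernelNum_of_add_sharp_eq_zero hx]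
  simp only [hy, mul_zero, zero_div]

-- A double zero of `B + B*` at `x` would force `K_B(x, x) = 0`.
theorem deriv_add_sharp_ne_zero (hB : HermiteBiehler B) (hBr : NoRealZeros B) {x : ℝ}
    (hx : B x + sharp B x = 0) : deriv (fun z => B z + sharp B z) x ≠ 0 := by
  intro hderiv
  have hnum : deriv (kernelNum B x) x = 0 := by
    rw [kernelNum_of_add_sharp_eq_zero hx, deriv_const_mul_field, hderiv, mul_zero]
  have hpos := kernel_self_re_pos hB hBr x
  rw [kernel, Complex.conj_ofReal, if_pos rfl, hnum, neg_zero, zero_div, Complex.zero_re] at hpos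
  exact hpos.false

theorem exists_norm_add_sharp_div_ge (hB : HermiteBiehler B) (hBr : NoRealZeros B) :
    ∃ c : ℝ, 0 < c ∧ ∀ z ∈ upperHalf,
      c * z.im / (‖z‖ ^ 2 + 1) * ‖B z‖ ≤ ‖B z + sharp B z‖ := by
  have hBz : ∀ z ∈ upperHalf, 0 < ‖B z‖ := fun z hz =>
    (norm_nonneg _).trans_lt (hB.norm_sharp_lt hz)
  obtain ⟨c, hc, hle⟩ := exists_le_one_sub_norm (θ := fun z => sharp B z / B z)
    ((hB.analyticOnNhd_div hBr (differentiable_sharp hB.1)).differentiableOn.mono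
      upperHalf_subset_closedUpperHalf)
    fun z hz => by
      rw [norm_div, div_lt_one (hBz z hz)]
      exact hB.norm_sharp_lt hz
  refine ⟨c, hc, fun z hz => ?_⟩
  calc c * z.im / (‖z‖ ^ 2 + 1) * ‖B z‖ ≤ (1 - ‖sharp B z / B z‖) * ‖B z‖ := by
        gcongr
        exact hle z hz
    _ = ‖B z‖ - ‖-sharp B z‖ := by
        rw [norm_div, sub_mul, one_mul, div_mul_cancel₀ _ (hBz z hz).ne', norm_neg]
    _ ≤ ‖B z - -sharp B z‖ := norm_sub_norm_le _ _
    _ = ‖B z + sharp B z‖ := by rw [sub_neg_eq_add]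

theorem exists_sq_norm_mul_sq_im_le (hB : HermiteBiehler B) (hBr : NoRealZeros B) :
    ∃ C : ℝ, 0 ≤ C ∧ ∀ f ∈ hardySpace B, ∀ z ∈ upperHalf, ∀ d : ℂ,
      f z = d * (B z + sharp B z) →
      (‖d‖ * z.im ^ 2) ^ 2 ≤ C * normSq B f * (‖z‖ * (‖z‖ ^ 2 + 1) ^ 2) := by
  obtain ⟨c, hc, hlow⟩ := exists_norm_add_sharp_div_ge hB hBr
  refine ⟨(c ^ 2)⁻¹, by positivity, fun f hf z hz d hd => ?_⟩
  have hz' : 0 < z.im := hz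
  have hBz : 0 < ‖B z‖ := (norm_nonneg _).trans_lt (hB.norm_sharp_lt hz)
  have hmul : ‖d‖ * (c * z.im / (‖z‖ ^ 2 + 1) * ‖B z‖) ≤ ‖f z‖ := by
    rw [hd, norm_mul]
    gcongr
    exact hlow z hz
  calc (‖d‖ * z.im ^ 2) ^ 2
      = (‖d‖ * (c * z.im / (‖z‖ ^ 2 + 1) * ‖B z‖)) ^ 2 *
          (z.im ^ 2 * (‖z‖ ^ 2 + 1) ^ 2 / (c ^ 2 * ‖B z‖ ^ 2)) := by field_simp
    _ ≤ ‖f z‖ ^ 2 * (z.im ^ 2 * (‖z‖ ^ 2 + 1) ^ 2 / (c ^ 2 * ‖B z‖ ^ 2)) := by gcongr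
    _ = (‖f z‖ * z.im) ^ 2 * ((‖z‖ ^ 2 + 1) ^ 2 / (c ^ 2 * ‖B z‖ ^ 2)) := by ring
    _ ≤ ‖z‖ * ‖B z‖ ^ 2 * normSq B f * ((‖z‖ ^ 2 + 1) ^ 2 / (c ^ 2 * ‖B z‖ ^ 2)) := by
        gcongr
        exact sq_norm_mul_im_le hB hBr hf hz
    _ = (c ^ 2)⁻¹ * normSq B f * (‖z‖ * (‖z‖ ^ 2 + 1) ^ 2) := by field_simp

theorem exists_eq_const_of_mul_add_sharp (hB : HermiteBiehler B) (hBr : NoRealZeros B)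
    (hf : f ∈ hardySpace B) (hD : Differentiable ℂ D)
    (hfD : ∀ z, f z = D z * (B z + sharp B z)) : ∃ a : ℂ, ∀ z, D z = a := by
  obtain ⟨C, hC, hle⟩ := exists_sq_norm_mul_sq_im_le hB hBr
  have hN := normSq_nonneg B f
  have hsharp : ∀ z, sharp f z = sharp D z * (B z + sharp B z) := fun z => by
    simp only [sharp, hfD, map_mul, map_add, Complex.conj_conj, add_comm]
  have hup : ∀ y ∈ upperHalf, ‖D y‖ * y.im ^ 2 ≤
      √(C * normSq B f * (‖y‖ * (‖y‖ ^ 2 + 1) ^ 2)) := fun y hy =>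
    Real.le_sqrt_of_sq_le (hle f hf y hy _ (hfD y))
  have hlow : ∀ y ∈ upperHalf, ‖sharp D y‖ * y.im ^ 2 ≤
      √(C * normSq B f * (‖y‖ * (‖y‖ ^ 2 + 1) ^ 2)) := fun y hy => by
    rw [← normSq_sharp B f]
    exact Real.le_sqrt_of_sq_le (hle _ (sharp_mem_hardySpace hf) y hy _ (hsharp y))
  refine exists_const_of_sqrt_growth hD (M := C * normSq B f * 648) fun z => ?_
  obtain ⟨R, hR⟩ : ∃ R, R = 2 * (1 + ‖z‖) := ⟨_, rfl⟩
  have hz := norm_nonneg z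
  have hR0 : 0 < R := by linarith
  have hDz := norm_le_of_norm_mul_im_pow_le hD hR0 two_ne_zero
    (fun y hy hyR => hyR ▸ hup y hy) (fun y hy hyR => hyR ▸ hlow y hy) (z := z) (by linarith)
  calc ‖D z‖ ^ 2 ≤ (√(C * normSq B f * (R * (R ^ 2 + 1) ^ 2)) * (3 / R) ^ 2) ^ 2 := by gcongr
    _ = C * normSq B f * (R * (R ^ 2 + 1) ^ 2) * (3 / R) ^ 4 := by
        rw [mul_pow, Real.sq_sqrt (by positivity), ← pow_mul]
    _ ≤ C * normSq B f * (R * (2 * R ^ 2) ^ 2) * (3 / R) ^ 4 := by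
        gcongr
        nlinarith
    _ = C * normSq B f * 324 * R := by field_simp; ring
    _ = C * normSq B f * 648 * (1 + ‖z‖) := by rw [hR]; ring

theorem exists_eq_const_mul_add_sharp (hB : HermiteBiehler B) (hBr : NoRealZeros B)
    (hf : f ∈ hardySpace B) (h : ∀ x : ℝ, B x + sharp B x = 0 → f x = 0) :
    ∃ a : ℂ, ∀ z, f z = a * (B z + sharp B z) := by
  obtain ⟨D, hD, hfD⟩ := exists_entire_quotient hf.1 (hB.1.fun_add (differentiable_sharp hB.1))
    fun z hz => by
      have hzr := ofReal_re_eq_of_im_eq_zero (hB.im_eq_zero_of_add_sharp_eq_zero hz)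
      rw [← hzr] at hz ⊢
      exact ⟨deriv_add_sharp_ne_zero hB hBr hz, h _ hz⟩
  obtain ⟨a, ha⟩ := exists_eq_const_of_mul_add_sharp hB hBr hf hD hfD
  exact ⟨a, fun z => by rw [hfD, ha]⟩

end AddSharp

section ZeroFree

variable {E F f : ℂ → ℂ}

theorem HermiteBiehler.exists_norm_sharp_div_eq_exp (hF : HermiteBiehler F)
    (hF0 : ∀ z, F z ≠ 0) :
    ∃ a : ℝ, 0 < a ∧ ∀ z, ‖sharp F z / F z‖ = Real.exp (-(a * z.im)) := by
  have hsF0 : ∀ z, sharp F z ≠ 0 := fun z => by simpa [sharp] using hF0 (conj z)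
  obtain ⟨h, hd, hh⟩ := exists_exp_eq (hF.1.fun_div (differentiable_sharp hF.1) hsF0)
    fun z => div_ne_zero (hF0 z) (hsF0 z)
  have hnorm : ∀ z, ‖F z‖ / ‖sharp F z‖ = Real.exp (h z).re := fun z => by
    rw [← norm_div, ← Complex.norm_exp, ← hh]
  have hpos : ∀ z ∈ upperHalf, 0 < (h z).re := fun z hz => by
    rw [← Real.one_lt_exp_iff, ← hnorm, one_lt_div (norm_pos_iff.2 (hsF0 z))]
    exact hF.norm_sharp_lt hz
  have hreal : ∀ t : ℝ, (h t).re = 0 := fun t => by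
    rw [← Real.exp_eq_one_iff, ← hnorm, norm_sharp_ofReal, div_self (norm_ne_zero_iff.2 (hF0 t))]
  have hconj : ∀ z, (h (conj z)).re = -(h z).re := fun z => by
    rw [← Real.exp_eq_exp, Real.exp_neg, ← hnorm, ← hnorm, sharp_conj, sharp, RCLike.norm_conj,
      RCLike.norm_conj, inv_div]
  obtain ⟨a, b, hab⟩ := exists_affine_of_re_nonneg hd (fun z hz => (hpos z hz).le) fun z hz => by
    rw [hconj]
    exact neg_nonpos.2 (hpos z hz).le
  have ha : a.re = 0 := by simpa [hab] using hreal 0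
  have hb : b.re = 0 := by simpa [hab, ha] using hreal 1
  have hre : ∀ z, (h z).re = -b.im * z.im := fun z => by simp [hab, ha, hb]
  refine ⟨-b.im, ?_, fun z => ?_⟩
  · simpa [hre] using hpos Complex.I (by simp [upperHalf])
  · rw [Real.exp_neg, ← hre, ← hnorm, inv_div, norm_div]

theorem ofReal_mul_I_mem_upperHalf {y : ℝ} (hy : 0 < y) : (y : ℂ) * Complex.I ∈ upperHalf := by
  simpa [upperHalf] using hy

theorem HermiteBiehler.tendsto_sharp_div (hF : HermiteBiehler F) (hF0 : ∀ z, F z ≠ 0) :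
    Tendsto (fun y : ℝ => sharp F (y * Complex.I) / F (y * Complex.I)) atTop (𝓝 0) := by
  obtain ⟨a, ha, hexp⟩ := hF.exists_norm_sharp_div_eq_exp hF0
  rw [tendsto_zero_iff_norm_tendsto_zero]
  simp only [hexp, Complex.mul_I_im, Complex.ofReal_re]
  exact Real.tendsto_exp_neg_atTop_nhds_zero.comp (tendsto_id.const_mul_atTop ha)

theorem IsHardy.tendsto_mul_I {g : ℂ → ℂ} (hg : IsHardy g) :
    Tendsto (fun y : ℝ => g (y * Complex.I)) atTop (𝓝 0) := by
  have hinv : Tendsto (fun y : ℝ => (∫ t : ℝ, ‖g t‖ ^ 2) / (4 * Real.pi * y)) atTop (𝓝 0) :=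
    tendsto_const_nhds.div_atTop (tendsto_id.const_mul_atTop (by positivity))
  have hsq : Tendsto (fun y : ℝ => ‖g (y * Complex.I)‖ ^ 2) atTop (𝓝 0) := by
    refine squeeze_zero' (Eventually.of_forall fun y => by positivity) ?_ hinv
    filter_upwards [eventually_gt_atTop 0] with y hy
    simpa using hg.sq_norm_le (ofReal_mul_I_mem_upperHalf hy)
  rw [tendsto_zero_iff_norm_tendsto_zero]
  simpa using hsq.sqrt

variable {c : ℂ}

theorem ne_zero_of_mul_eq_const_mul_add_sharp (hE : HermiteBiehler E) (hF : HermiteBiehler F)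
    (hFr : NoRealZeros F) (hc : c ≠ 0)
    (h : ∀ z, f z * F z = c * (E z * F z + sharp E z * sharp F z)) (z : ℂ) : F z ≠ 0 := by
  intro hz
  have hmul : c * (E z * F z + sharp E z * sharp F z) = 0 := by rw [← h, hz, mul_zero]
  have hzero : E z * F z + sharp (fun z => E z * F z) z = 0 := by
    rw [sharp_mul]
    exact (mul_eq_zero.1 hmul).resolve_left hc
  rw [← ofReal_re_eq_of_im_eq_zero ((hE.mul hF).im_eq_zero_of_add_sharp_eq_zero hzero)] at hz
  exact hFr _ hz

theorem tendsto_div_of_mul_eq_const_mul_add_sharp (hE : HermiteBiehler E) (hF : HermiteBiehler F)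
    (hF0 : ∀ z, F z ≠ 0) (h : ∀ z, f z * F z = c * (E z * F z + sharp E z * sharp F z)) :
    Tendsto (fun y : ℝ => f (y * Complex.I) / E (y * Complex.I)) atTop (𝓝 c) := by
  have hEz : ∀ z ∈ upperHalf, 0 < ‖E z‖ := fun z hz =>
    (norm_nonneg _).trans_lt (hE.norm_sharp_lt hz)
  have hsharp : Tendsto (fun y : ℝ => sharp E (y * Complex.I) / E (y * Complex.I) *
      (sharp F (y * Complex.I) / F (y * Complex.I))) atTop (𝓝 0) := by
    refine squeeze_zero_norm' ?_ (tendsto_zero_iff_norm_tendsto_zero.1 (hF.tendsto_sharp_div hF0))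
    filter_upwards [eventually_gt_atTop 0] with y hy
    have hy' := ofReal_mul_I_mem_upperHalf hy
    rw [norm_mul, norm_div (sharp E _)]
    exact mul_le_of_le_one_left (norm_nonneg _)
      (div_le_one_of_le₀ (hE.norm_sharp_lt hy').le (norm_nonneg _))
  have hlim := (hsharp.const_add 1).const_mul c
  rw [add_zero, mul_one] at hlim
  refine hlim.congr' ?_
  filter_upwards [eventually_gt_atTop 0] with y hy
  have hE0 := norm_pos_iff.1 (hEz _ (ofReal_mul_I_mem_upperHalf hy))
  have hFy := hF0 (y * Complex.I)
  rw [eq_div_iff hE0]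
  refine mul_right_cancel₀ hFy ?_
  rw [h]
  field_simp

theorem eq_zero_of_mul_eq_const_mul_add_sharp (hE : HermiteBiehler E) (hF : HermiteBiehler F)
    (hFr : NoRealZeros F) (hf : f ∈ hardySpace E)
    (h : ∀ z, f z * F z = c * (E z * F z + sharp E z * sharp F z)) : c = 0 := by
  by_contra hc
  have hF0 := ne_zero_of_mul_eq_const_mul_add_sharp hE hF hFr hc h
  exact hc (tendsto_nhds_unique (tendsto_div_of_mul_eq_const_mul_add_sharp hE hF hF0 h)
    hf.2.1.tendsto_mul_I)

end ZeroFree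

section NormalizedKernels

theorem IsHardy.of_norm_le {g k : ℂ → ℂ} (hg : IsHardy g) (hk : AnalyticOnNhd ℂ k closedUpperHalf)
    (h : ∀ z ∈ closedUpperHalf, ‖k z‖ ≤ ‖g z‖) : IsHardy k := by
  obtain ⟨K, hK⟩ := hg.bound
  exact ⟨hk, hg.memLp.of_le (continuous_ofReal_of_analyticOnNhd hk).aestronglyMeasurable
    (Eventually.of_forall fun t => h t (ofReal_mem_closedUpperHalf t)), K,
    fun z hz => (h z (upperHalf_subset_closedUpperHalf hz)).trans (hK z hz)⟩

variable {B E F f g : ℂ → ℂ}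

theorem NoRealZeros.mul (hEr : NoRealZeros E) (hFr : NoRealZeros F) :
    NoRealZeros fun z => E z * F z :=
  fun x => mul_ne_zero (hEr x) (hFr x)

theorem mul_mem_hardySpace (hE : HermiteBiehler E) (hF : HermiteBiehler F)
    (hEr : NoRealZeros E) (hFr : NoRealZeros F) (hf : f ∈ hardySpace E) :
    (fun z => f z * F z) ∈ hardySpace fun z => E z * F z := by
  have hd : Differentiable ℂ fun z => f z * F z := hf.1.mul hF.1
  have han {k : ℂ → ℂ} (hk : Differentiable ℂ k) :=
    (hE.mul hF).analyticOnNhd_div (hEr.mul hFr) hk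
  refine ⟨hd, hf.2.1.of_norm_le (han hd) fun z hz => ?_,
    hf.2.2.of_norm_le (han (differentiable_sharp hd)) fun z hz => ?_⟩
  · rw [mul_div_mul_right _ _ (hF.ne_zero hFr hz)]
  · rw [sharp_mul, mul_div_mul_comm, norm_mul, norm_div (sharp F z)]
    exact mul_le_of_le_one_right (norm_nonneg _)
      (div_le_one_of_le₀ (hF.norm_sharp_le hz) (norm_nonneg _))

theorem ae_eq_mul_div_mul {u : ℝ → ℂ} (hFr : NoRealZeros F)
    (hu : u =ᵐ[volume] fun t : ℝ => f t / E t) :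
    u =ᵐ[volume] fun t : ℝ => f t * F t / (E t * F t) :=
  hu.trans (Eventually.of_forall fun t => (mul_div_mul_right _ _ (hFr t)).symm)

theorem hardySubmodule_le_mul (hE : HermiteBiehler E) (hF : HermiteBiehler F)
    (hEr : NoRealZeros E) (hFr : NoRealZeros F) :
    hardySubmodule E ≤ hardySubmodule fun z => E z * F z := by
  rintro u ⟨f, hf, hu⟩
  exact ⟨_, mul_mem_hardySpace hE hF hEr hFr hf, ae_eq_mul_div_mul hFr hu⟩

/-- The function `f / E` with `f ∈ hardySpace E`, as an element of `L²(ℝ)`. -/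
noncomputable def toL2 (hf : f ∈ hardySpace E) : Lp ℂ 2 (volume : Measure ℝ) :=
  hf.2.1.memLp.toLp fun t : ℝ => f t / E t

theorem coeFn_toL2 (hf : f ∈ hardySpace E) : toL2 hf =ᵐ[volume] fun t : ℝ => f t / E t :=
  hf.2.1.memLp.coeFn_toLp

theorem toL2_mem_hardySubmodule (hf : f ∈ hardySpace E) : toL2 hf ∈ hardySubmodule E :=
  ⟨f, hf, coeFn_toL2 hf⟩

theorem inner_toL2_kernel (hE : HermiteBiehler E) (hEr : NoRealZeros E) (hf : f ∈ hardySpace E)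
    {u : Lp ℂ 2 (volume : Measure ℝ)} (hu : u =ᵐ[volume] fun t : ℝ => f t / E t) (x : ℝ) :
    ⟪toL2 (kernel_mem_hardySpace hE hEr x), u⟫_ℂ = f x := by
  rw [L2.inner_def, ← integral_mul_conj_kernel hEr hf x]
  refine integral_congr_ae ?_
  filter_upwards [hu, coeFn_toL2 (kernel_mem_hardySpace hE hEr x)] with t hut hkt
  rw [hut, hkt, RCLike.inner_apply]

theorem kernel_self_eq_re (hE : HermiteBiehler E) (hEr : NoRealZeros E) (x : ℝ) :
    kernel E x x = ((kernel E x x).re : ℂ) := by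
  rw [kernel_self_eq_normSq hE hEr, Complex.ofReal_re]

theorem sq_norm_apply_le (hE : HermiteBiehler E) (hEr : NoRealZeros E) (hf : f ∈ hardySpace E)
    (x : ℝ) : ‖f x‖ ^ 2 ≤ (kernel E x x).re * normSq E f := by
  rw [kernel_self_eq_normSq hE hEr, Complex.ofReal_re,
    ← sq_norm_eq_normSq (coeFn_toL2 (kernel_mem_hardySpace hE hEr x)),
    ← sq_norm_eq_normSq (coeFn_toL2 hf), ← inner_toL2_kernel hE hEr hf (coeFn_toL2 hf) x, ← mul_pow]
  exact pow_le_pow_left₀ (norm_nonneg _) (norm_inner_le_norm _ _) 2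

-- `K(x, x)` is the squared norm of the evaluation functional at `x`.
theorem kernel_self_re_le {E₁ E₂ : ℂ → ℂ} (hE₁ : HermiteBiehler E₁) (hE₂ : HermiteBiehler E₂)
    (hE₁r : NoRealZeros E₁) (hE₂r : NoRealZeros E₂) (hs : space E₁ ⊆ space E₂) {C : ℝ}
    (hC : ∀ f ∈ space E₁, normSq E₂ f ≤ C * normSq E₁ f) (x : ℝ) :
    (kernel E₁ x x).re ≤ C * (kernel E₂ x x).re := by
  have hmem := kernel_mem_space hE₁ hE₁r x
  have hpos := kernel_self_re_pos hE₁ hE₁r x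
  have hpos' := kernel_self_re_pos hE₂ hE₂r x
  have hnorm : normSq E₁ (kernel E₁ x) = (kernel E₁ x x).re := by
    rw [kernel_self_eq_normSq hE₁ hE₁r x, Complex.ofReal_re]
  refine le_of_mul_le_mul_right ?_ hpos
  calc (kernel E₁ x x).re * (kernel E₁ x x).re = ‖kernel E₁ x x‖ ^ 2 := by
        rw [kernel_self_eq_re hE₁ hE₁r, Complex.norm_real, Real.norm_of_nonneg hpos.le,
          Complex.ofReal_re, sq]
    _ ≤ (kernel E₂ x x).re * normSq E₂ (kernel E₁ x) :=
        sq_norm_apply_le hE₂ hE₂r (space_subset_hardySpace hE₂ hE₂r (hs hmem)) x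
    _ ≤ (kernel E₂ x x).re * (C * normSq E₁ (kernel E₁ x)) := by
        gcongr
        exact hC _ hmem
    _ = C * (kernel E₂ x x).re * (kernel E₁ x x).re := by
        rw [hnorm]
        ring

/-- The reproducing kernel of `B` at the real point `x`, divided by its norm, as an element
of `L²(ℝ)`. -/
noncomputable def normalizedKernel (hB : HermiteBiehler B) (hBr : NoRealZeros B) (x : ℝ) :
    Lp ℂ 2 (volume : Measure ℝ) :=
  (((√(kernel B x x).re)⁻¹ : ℝ) : ℂ) • toL2 (kernel_mem_hardySpace hB hBr x)

theorem normalizedKernel_mem_hardySubmodule (hB : HermiteBiehler B) (hBr : NoRealZeros B)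
    (x : ℝ) : normalizedKernel hB hBr x ∈ hardySubmodule B :=
  Submodule.smul_mem _ _ (toL2_mem_hardySubmodule _)

theorem inner_normalizedKernel (hB : HermiteBiehler B) (hBr : NoRealZeros B)
    (hg : g ∈ hardySpace B) {u : Lp ℂ 2 (volume : Measure ℝ)}
    (hu : u =ᵐ[volume] fun t : ℝ => g t / B t) (x : ℝ) :
    ⟪normalizedKernel hB hBr x, u⟫_ℂ = (((√(kernel B x x).re)⁻¹ : ℝ) : ℂ) * g x := by
  rw [normalizedKernel, inner_smul_left, Complex.conj_ofReal, inner_toL2_kernel hB hBr hg hu]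

theorem sq_norm_inner_normalizedKernel (hB : HermiteBiehler B) (hBr : NoRealZeros B)
    (hg : g ∈ hardySpace B) {u : Lp ℂ 2 (volume : Measure ℝ)}
    (hu : u =ᵐ[volume] fun t : ℝ => g t / B t) (x : ℝ) :
    ‖⟪normalizedKernel hB hBr x, u⟫_ℂ‖ ^ 2 = ‖g x‖ ^ 2 / (kernel B x x).re := by
  rw [inner_normalizedKernel hB hBr hg hu, norm_mul, mul_pow, Complex.norm_real, Real.norm_eq_abs,
    sq_abs, inv_pow, Real.sq_sqrt (kernel_self_re_pos hB hBr x).le, inv_mul_eq_div]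

variable {ι : Type*} {lam : ι → ℝ}

theorem orthonormal_normalizedKernel (hB : HermiteBiehler B) (hBr : NoRealZeros B)
    (hinj : Function.Injective lam) (hzero : ∀ i, B (lam i) + sharp B (lam i) = 0) :
    Orthonormal ℂ fun i => normalizedKernel hB hBr (lam i) := by
  classical
  rw [orthonormal_iff_ite]
  intro i j
  conv_lhs => rw [normalizedKernel.eq_def hB hBr (lam j), inner_smul_right]
  rw [inner_normalizedKernel hB hBr (kernel_mem_hardySpace hB hBr (lam j)) (coeFn_toL2 _)]
  split_ifs with hij
  · subst hij
    have hpos := kernel_self_re_pos hB hBr (lam i)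
    rw [kernel_self_eq_re hB hBr (lam i), ← Complex.ofReal_mul, ← Complex.ofReal_mul,
      Complex.ofReal_re, ← mul_assoc, ← mul_inv, Real.mul_self_sqrt hpos.le,
      inv_mul_cancel₀ hpos.ne', Complex.ofReal_one]
  · rw [kernel_of_add_sharp_eq_zero (hzero j) (hzero i) fun h => hij (hinj h), mul_zero, mul_zero]

theorem exists_eq_const_mul_add_sharp_of_mem_orthogonal (hB : HermiteBiehler B)
    (hBr : NoRealZeros B) (hlam : ∀ x : ℝ, B x + sharp B x = 0 → x ∈ range lam)
    (hg : g ∈ hardySpace B) {u : Lp ℂ 2 (volume : Measure ℝ)}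
    (hu : u =ᵐ[volume] fun t : ℝ => g t / B t)
    (horth : u ∈ (Submodule.span ℂ (range fun i => normalizedKernel hB hBr (lam i)))ᗮ) :
    ∃ a : ℂ, ∀ z, g z = a * (B z + sharp B z) := by
  refine exists_eq_const_mul_add_sharp hB hBr hg fun x hx => ?_
  obtain ⟨i, rfl⟩ := hlam x hx
  have hsq := sq_norm_inner_normalizedKernel hB hBr hg hu (lam i)
  rw [mem_orthogonal_span_range_iff.1 horth i, norm_zero, zero_pow two_ne_zero, eq_comm,
    div_eq_zero_iff, or_iff_left (kernel_self_re_pos hB hBr _).ne'] at hsq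
  exact norm_eq_zero.1 (sq_eq_zero_iff.1 hsq)

theorem finiteDimensional_of_forall_exists_eq_smul {𝕜 V : Type*} [DivisionRing 𝕜] [AddCommGroup V]
    [Module 𝕜 V] {S : Submodule 𝕜 V} (h : ∀ r ∈ S, r ≠ 0 → ∀ v ∈ S, ∃ c : 𝕜, c • r = v) :
    FiniteDimensional 𝕜 S := by
  rcases eq_or_ne S ⊥ with rfl | hS
  · infer_instance
  · obtain ⟨r, hrS, hr⟩ := Submodule.exists_mem_ne_zero_of_ne_bot hS
    exact Submodule.finiteDimensional_of_le fun v hv =>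
      Submodule.mem_span_singleton.2 (h r hrS hr v hv)

theorem finiteDimensional_hardySubmodule_inf_orthogonal (hB : HermiteBiehler B)
    (hBr : NoRealZeros B) (hlam : ∀ x : ℝ, B x + sharp B x = 0 → x ∈ range lam) :
    FiniteDimensional ℂ ↥(hardySubmodule B ⊓
      (Submodule.span ℂ (range fun i => normalizedKernel hB hBr (lam i)))ᗮ) := by
  refine finiteDimensional_of_forall_exists_eq_smul ?_
  rintro r ⟨⟨g, hg, hr⟩, hr_orth⟩ hr0 v ⟨⟨k, hk, hv⟩, hv_orth⟩
  obtain ⟨a, ha⟩ := exists_eq_const_mul_add_sharp_of_mem_orthogonal hB hBr hlam hg hr hr_orth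
  obtain ⟨b, hb⟩ := exists_eq_const_mul_add_sharp_of_mem_orthogonal hB hBr hlam hk hv hv_orth
  have ha0 : a ≠ 0 := by
    rintro rfl
    refine hr0 ((Lp.eq_zero_iff_ae_eq_zero).2 (hr.trans (Eventually.of_forall fun t => ?_)))
    simp only [ha, zero_mul, zero_div, Pi.zero_apply]
  refine ⟨b / a, Lp.ext ?_⟩
  filter_upwards [hr, hv, Lp.coeFn_smul (b / a) r] with t hrt hvt hsmul
  rw [hsmul, Pi.smul_apply, hrt, hvt, ha, hb, smul_eq_mul]
  field_simp

theorem disjoint_hardySubmodule_orthogonal (hE : HermiteBiehler E) (hF : HermiteBiehler F)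
    (hEr : NoRealZeros E) (hFr : NoRealZeros F)
    (hlam : ∀ x : ℝ, E x * F x + sharp E x * sharp F x = 0 → x ∈ range lam) :
    Disjoint (hardySubmodule E) (Submodule.span ℂ
      (range fun i => normalizedKernel (hE.mul hF) (hEr.mul hFr) (lam i)))ᗮ := by
  rw [Submodule.disjoint_def]
  rintro u ⟨f, hf, hu⟩ horth
  obtain ⟨a, ha⟩ := exists_eq_const_mul_add_sharp_of_mem_orthogonal (hE.mul hF) (hEr.mul hFr)
    (by simpa only [sharp_mul] using hlam) (mul_mem_hardySpace hE hF hEr hFr hf)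
    (ae_eq_mul_div_mul hFr hu) horth
  rw [sharp_mul] at ha
  rw [Lp.eq_zero_iff_ae_eq_zero]
  refine (ae_eq_mul_div_mul hFr hu).trans (Eventually.of_forall fun t => ?_)
  simp only [ha, eq_zero_of_mul_eq_const_mul_add_sharp hE hF hFr hf ha, zero_mul, zero_div,
    Pi.zero_apply]

theorem exists_tsum_bounds (hE : HermiteBiehler E) (hF : HermiteBiehler F)
    (hEr : NoRealZeros E) (hFr : NoRealZeros F) (hinj : Function.Injective lam)
    (hlam : ∀ x : ℝ, x ∈ range lam ↔ E x * F x + sharp E x * sharp F x = 0) :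
    ∃ δ : ℝ, 0 < δ ∧ ∀ f ∈ hardySpace E,
      Summable (fun i => ‖f (lam i) * F (lam i)‖ ^ 2 /
        (kernel (fun z => E z * F z) (lam i) (lam i)).re) ∧
      δ * normSq E f ≤ ∑' i, ‖f (lam i) * F (lam i)‖ ^ 2 /
        (kernel (fun z => E z * F z) (lam i) (lam i)).re ∧
      ∑' i, ‖f (lam i) * F (lam i)‖ ^ 2 /
        (kernel (fun z => E z * F z) (lam i) (lam i)).re ≤ normSq E f := by
  have hB := hE.mul hF
  have hBr := hEr.mul hFr
  have he := orthonormal_normalizedKernel hB hBr hinj fun i => by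
    rw [sharp_mul]
    exact (hlam _).1 (mem_range_self i)
  have := finiteDimensional_hardySubmodule_inf_orthogonal (lam := lam) hB hBr
    (by simpa only [sharp_mul] using fun x => (hlam x).2)
  obtain ⟨δ, hδ, hlow⟩ := exists_le_tsum_sq_norm_inner he (isClosed_hardySubmodule hE hEr)
    (isClosed_hardySubmodule hB hBr) (hardySubmodule_le_mul hE hF hEr hFr)
    (fun i => normalizedKernel_mem_hardySubmodule hB hBr _)
    (disjoint_hardySubmodule_orthogonal hE hF hEr hFr fun x => (hlam x).2)
  refine ⟨δ, hδ, fun f hf => ?_⟩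
  simp only [← sq_norm_inner_normalizedKernel hB hBr (mul_mem_hardySpace hE hF hEr hFr hf)
    (ae_eq_mul_div_mul hFr (coeFn_toL2 hf)), ← sq_norm_eq_normSq (coeFn_toL2 hf)]
  exact ⟨he.inner_products_summable _, hlow _ (toL2_mem_hardySubmodule hf),
    he.tsum_inner_products_le _⟩

end NormalizedKernels

section Sampling

theorem summable_and_tsum_le_mul_tsum {ι : Type*} {a b : ι → ℝ} {C : ℝ} (ha : ∀ i, 0 ≤ a i)
    (hab : ∀ i, a i ≤ C * b i) (hb : Summable b) : Summable a ∧ ∑' i, a i ≤ C * ∑' i, b i := by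
  have hsum := Summable.of_nonneg_of_le ha hab (hb.mul_left C)
  exact ⟨hsum, (hsum.tsum_le_tsum hab (hb.mul_left C)).trans_eq tsum_mul_left⟩

theorem div_le_mul_div_of_le_mul {s p q C : ℝ} (hs : 0 ≤ s) (hp : 0 < p) (hq : 0 < q)
    (hpq : p ≤ C * q) : s / q ≤ C * (s / p) := by
  rw [← mul_div_assoc, div_le_div_iff₀ hq hp]
  calc s * p ≤ s * (C * q) := by gcongr
    _ = C * s * q := by ring

variable {E₀ E F : ℂ → ℂ}

theorem NormalizedSampling.of_sameSpace {ι : Type*} {lam : ι → ℝ} (hE₀ : HermiteBiehler E₀)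
    (hE : HermiteBiehler E) (hE₀r : NoRealZeros E₀) (hEr : NoRealZeros E)
    (hspace : SameSpace E₀ E) (h : NormalizedSampling E lam) : NormalizedSampling E₀ lam := by
  obtain ⟨hs, c, C, hc, hC, hnorm⟩ := hspace
  obtain ⟨A, B, hA, hB, hsamp⟩ := h
  have hpos₀ := kernel_self_re_pos hE₀ hE₀r
  have hpos := kernel_self_re_pos hE hEr
  have hle : ∀ x : ℝ, (kernel E₀ x x).re ≤ C * (kernel E x x).re :=
    kernel_self_re_le hE₀ hE hE₀r hEr hs.subset fun f hf => (hnorm f hf).2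
  have hge : ∀ x : ℝ, (kernel E x x).re ≤ c⁻¹ * (kernel E₀ x x).re :=
    kernel_self_re_le hE hE₀ hEr hE₀r hs.superset fun f hf =>
      (le_inv_mul_iff₀ hc).2 (hnorm f (hs.superset hf)).1
  refine ⟨A * c / C, c⁻¹ * (B * C), by positivity, by positivity, fun f hf => ?_⟩
  obtain ⟨hsum, hlower, hupper⟩ := hsamp f (hs.subset hf)
  obtain ⟨hsum₀, hupper₀⟩ := summable_and_tsum_le_mul_tsum
    (fun i => div_nonneg (sq_nonneg ‖f (lam i)‖) (hpos₀ (lam i)).le)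
    (fun i => div_le_mul_div_of_le_mul (sq_nonneg ‖f (lam i)‖) (hpos _) (hpos₀ _) (hge _)) hsum
  have hlower₀ := (summable_and_tsum_le_mul_tsum
    (fun i => div_nonneg (sq_nonneg ‖f (lam i)‖) (hpos (lam i)).le)
    (fun i => div_le_mul_div_of_le_mul (sq_nonneg ‖f (lam i)‖) (hpos₀ _) (hpos _) (hle _))
    hsum₀).2
  refine ⟨hsum₀, ?_, hupper₀.trans ?_⟩
  · rw [div_mul_eq_mul_div, div_le_iff₀' hC, mul_assoc]
    exact ((mul_le_mul_of_nonneg_left (hnorm f hf).1 hA.le).trans hlower).trans hlower₀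
  · rw [mul_assoc c⁻¹, mul_assoc B]
    gcongr
    exact hupper.trans (mul_le_mul_of_nonneg_left (hnorm f hf).2 hB.le)

theorem sq_norm_mul_div_kernel_mul_le (hE : HermiteBiehler E) (hF : HermiteBiehler F)
    (hEr : NoRealZeros E) (hFr : NoRealZeros F) (f : ℂ → ℂ) (x : ℝ) :
    ‖f x * F x‖ ^ 2 / (kernel (fun z => E z * F z) x x).re ≤ ‖f x‖ ^ 2 / (kernel E x x).re := by
  have hFx : 0 < ‖F x‖ ^ 2 := pow_pos (norm_pos_iff.2 (hFr x)) 2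
  have hE_pos := kernel_self_re_pos hE hEr x
  have hF_pos := kernel_self_re_pos hF hFr x
  rw [norm_mul, mul_pow, mul_comm, ← mul_div_mul_left _ (kernel E x x).re hFx.ne']
  refine div_le_div_of_nonneg_left (by positivity) (by positivity) ?_
  rw [kernel_mul_self_re hE.1 hF.1 x]
  exact le_add_of_nonneg_right (by positivity)

theorem sq_norm_div_kernel_le {C : ℝ} (hE : HermiteBiehler E) (hF : HermiteBiehler F)
    (hEr : NoRealZeros E) (hFr : NoRealZeros F) {x : ℝ}
    (hK : (kernel (fun z => E z * F z) x x).re ≤ C * (‖F x‖ ^ 2 * (kernel E x x).re))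
    (f : ℂ → ℂ) :
    ‖f x‖ ^ 2 / (kernel E x x).re ≤
      C * (‖f x * F x‖ ^ 2 / (kernel (fun z => E z * F z) x x).re) := by
  have hFx : 0 < ‖F x‖ ^ 2 := pow_pos (norm_pos_iff.2 (hFr x)) 2
  have hE_pos := kernel_self_re_pos hE hEr x
  rw [← mul_div_mul_left _ (kernel E x x).re hFx.ne', mul_comm (‖F x‖ ^ 2) (‖f x‖ ^ 2), ← mul_pow,
    ← norm_mul]
  exact div_le_mul_div_of_le_mul (sq_nonneg _) (kernel_self_re_pos (hE.mul hF) (hEr.mul hFr) x)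
    (by positivity) hK

theorem injective_re_of_im_eq_zero {Λ : Set ℂ} (h : ∀ z ∈ Λ, z.im = 0) :
    Function.Injective fun z : Λ => (z : ℂ).re :=
  fun z w hzw => Subtype.ext (Complex.ext hzw ((h z z.2).trans (h w w.2).symm))

theorem mem_range_re_iff_of_im_eq_zero {Λ : Set ℂ} (h : ∀ z ∈ Λ, z.im = 0) {x : ℝ} :
    x ∈ range (fun z : Λ => (z : ℂ).re) ↔ (x : ℂ) ∈ Λ := by
  refine ⟨?_, fun hx => ⟨⟨x, hx⟩, Complex.ofReal_re x⟩⟩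
  rintro ⟨z, rfl⟩
  rw [ofReal_re_eq_of_im_eq_zero (h z z.2)]
  exact z.2

theorem im_eq_zero_of_mem_zeroSet (hE : HermiteBiehler E) (hF : HermiteBiehler F) :
    ∀ z ∈ zeroSet (fun z => E z * F z + sharp E z * sharp F z), z.im = 0 := fun z hz =>
  (hE.mul hF).im_eq_zero_of_add_sharp_eq_zero <| by
    rw [sharp_mul]
    exact hz

theorem normalizedSamplingSet_zeroSet {C : ℝ} (hE : HermiteBiehler E) (hF : HermiteBiehler F)
    (hEr : NoRealZeros E) (hFr : NoRealZeros F)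
    (hK : ∀ x : ℝ, (kernel (fun z => E z * F z) x x).re ≤ C * (‖F x‖ ^ 2 * (kernel E x x).re)) :
    NormalizedSamplingSet E (zeroSet fun z => E z * F z + sharp E z * sharp F z) := by
  have him := im_eq_zero_of_mem_zeroSet hE hF
  have hC : 0 < C := by
    have hpos := (kernel_self_re_pos (hE.mul hF) (hEr.mul hFr) 0).trans_le (hK 0)
    exact pos_of_mul_pos_left hpos
      (mul_nonneg (sq_nonneg _) (kernel_self_re_pos hE hEr 0).le)
  obtain ⟨δ, hδ, hbounds⟩ := exists_tsum_bounds hE hF hEr hFr (injective_re_of_im_eq_zero him)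
    fun x => mem_range_re_iff_of_im_eq_zero him
  refine ⟨him, δ, C, hδ, hC, fun f hf => ?_⟩
  obtain ⟨hsum, hlower, hupper⟩ := hbounds f (space_subset_hardySpace hE hEr hf)
  obtain ⟨hsumE, hupperE⟩ := summable_and_tsum_le_mul_tsum
    (fun z => div_nonneg (sq_nonneg _) (kernel_self_re_pos hE hEr _).le)
    (fun z => sq_norm_div_kernel_le hE hF hEr hFr (hK _) f) hsum
  exact ⟨hsumE,
    hlower.trans (hsum.tsum_le_tsum (fun z => sq_norm_mul_div_kernel_mul_le hE hF hEr hFr f _)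
      hsumE),
    hupperE.trans (mul_le_mul_of_nonneg_left hupper hC.le)⟩

end Sampling

end DeBranges

theorem mainTheorem9 (E₀ E F : ℂ → ℂ)
    (hE₀ : DeBranges.HermiteBiehler E₀) (hE : DeBranges.HermiteBiehler E)
    (hF : DeBranges.HermiteBiehler F)
    (hE₀r : DeBranges.NoRealZeros E₀) (hEr : DeBranges.NoRealZeros E)
    (hFr : DeBranges.NoRealZeros F)
    (hspace : DeBranges.SameSpace E₀ E)
    (φE φF : ℝ → ℝ) (hφE : DeBranges.IsPhase E φE) (hφF : DeBranges.IsPhase F φF)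
    (hdom : ∃ C : ℝ, 0 < C ∧ ∀ x : ℝ, deriv φF x ≤ C * deriv φE x) :
    DeBranges.NormalizedSamplingSet E₀
      (DeBranges.zeroSet
        (fun z => E z * F z + DeBranges.sharp E z * DeBranges.sharp F z)) := by
  obtain ⟨C, -, hphase⟩ := hdom
  have hE_sampling := DeBranges.normalizedSamplingSet_zeroSet hE hF hEr hFr fun x =>
    DeBranges.kernel_mul_self_re_le hE.1 hF.1 hEr hFr hφE hφF (hphase x)
  exact ⟨hE_sampling.1, hE_sampling.2.of_sameSpace hE₀ hE hE₀r hEr hspace⟩
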